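/- **MPC model.** $M$ machines work in synchronous rounds, each with a memory of $S$ words, a word being a natural number with $O(\log n)$ bits. In a round every machine performs an arbitrary local computation, keeps some words, and sends words to other machines; after each round the words kept and received by a machine together number at most $S$, and it sends at most $S$ words in the round. The total space is $M\cdot S$. **Procedure.** Let $G=(V,E)$ be a simple graph and let $\alpha$ be a natural number that is at least the arboricity of $G$ (the least number of forests whose union is $G$), for instance the arboricity itself. $d_Q$ and $N_Q$ denote degrees and neighbourhoods in the induced subgraph $G[Q]$. $\textsc{Count-Triangles}(G)$, given $\alpha$, starts with $Q_0=V$ and $T=0$, and for $i=0,1,\dots,\lceil\log_{3/2}\log_2 n\rceil$ (for $n=1$: only for $i=0$) puts $\gamma_i=2^{(3/2)^i}\cdot 2\alpha$, $A_i=\{v\in Q_i: d_{Q_i}(v)\le\gamma_i\}$, lets every $v\in A_i$ send its list $L_v=N_{Q_i}(v)$ to all its neighbours in $Q_i$, adds $$\sum_{w\in Q_i}\ \sum_{v\in N_{Q_i}(w)}\frac{R_w(v)-1}{c_{w,v}}$$ to $T$, and sets $Q_{i+1}=Q_i\setminus A_i$. Here $R_w(v)$ is the number of occurrences of $v$ in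 the concatenation of $N_{Q_i}(w)$ and all lists received by $w$, and $c_{w,v}=2,4,6$ if two, one, none, respectively, of $d_{Q_i}(v),d_{Q_i}(w)$ exceed $\gamma_i$. It returns $T$. **Theorem.** Let $\delta>0$. For every graph $G$ with $n\ge 1$ vertices, $m$ edges and arboricity at most $\alpha$, $\textsc{Count-Triangles}(G)$, given $\alpha$, returns exactly the number of triangles of $G$. Moreover it can be executed in the MPC model in $O_\delta(\max\{1,\log\log n\})$ rounds, with $O(n^\delta)$ words of space per machine and total space $O(\max\{1,m\alpha\})$, where the constants in the two space bounds and in the word length are absolute and the constant in the round bound depends only on $\delta$. More precisely, for all $n,m,\alpha$ there are such $M,S$, an MPC program and a schedule of rounds $0=r_0\le r_1\le\cdots$, depending on $n,m,\alpha,\delta$ only, such that for every such $G$ on the vertex set $\{0,\dots,n-1\}$ whose edges are initially distributed over the machines in an arbitrary way with at most $\lceil m/M\rceil$ edges per machine, the program respects the space bounds, after $r_i$ rounds the machines hold exactly the edges of $G[Q_i]$ (each once) and the value of $T$ at the beginning of iteration $i$, for every $i$ up to the number of iterations $\lceil\log_{3/2}\log_2 n\rceil+1$ ($1$ if $n=1$),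 and after the last of these rounds machine $0$ holds exactly the number of triangles of $G$. -/

import Mathlib

/-! ### Arboricity -/

/-- The arboricity of a graph: the least number of forests (acyclic graphs on the same vertex set)
whose union is the graph. -/
noncomputable def arboricity {V : Type*} (G : SimpleGraph V) : ℕ :=
  sInf {k : ℕ | ∃ F : Fin k → SimpleGraph V, (∀ i, (F i).IsAcyclic) ∧ (⨆ i, F i) = G}

/-! ### The procedure Count-Triangles

`Q` is the current set of unprocessed vertices and `γ` the current degree threshold. -/

namespace CountTriangles

section Procedure

variable {n : ℕ} (G : SimpleGraph (Fin n)) [DecidableRel G.Adj]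

/-- The neighbours of `v` in the induced subgraph `G[Q]`. -/
def nbrs (Q : Finset (Fin n)) (v : Fin n) : Finset (Fin n) :=
  Q.filter fun u => G.Adj v u

/-- The degree `d_Q(v)` of `v` in `G[Q]`. -/
def deg (Q : Finset (Fin n)) (v : Fin n) : ℕ := (nbrs G Q v).card

/-- The vertices of `Q` whose degree in `G[Q]` is at most the threshold `γ`. -/
noncomputable def low (γ : ℝ) (Q : Finset (Fin n)) : Finset (Fin n) :=
  Q.filter fun v => (deg G Q v : ℝ) ≤ γ

/-- The lists received by `w`, with multiplicity: every low-degree neighbour `v` of `w` sends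
its list `L_v` of neighbours in `G[Q]`. -/
noncomputable def received (γ : ℝ) (Q : Finset (Fin n)) (w : Fin n) : Multiset (Fin n) :=
  ∑ v ∈ (low G γ Q).filter (fun v => G.Adj w v), (nbrs G Q v).val

/-- The number `R` of occurrences of `v` in the list consisting of the lists received by `w`
and of the list of the neighbours of `w`. -/
noncomputable def occurrences (γ : ℝ) (Q : Finset (Fin n)) (w v : Fin n) : ℕ :=
  (received G γ Q w + (nbrs G Q w).val).count v

/-- The procedure Find-Triangles-Exact for the vertex `w`. -/
noncomputable def findTrianglesExact (γ : ℝ) (Q : Finset (Fin n)) (w : Fin n) : ℚ :=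
  ∑ v ∈ nbrs G Q w,
    if γ < deg G Q v ∧ γ < deg G Q w then
      ((occurrences G γ Q w v : ℚ) - 1) / 2
    else if (γ < deg G Q v ∧ (deg G Q w : ℝ) ≤ γ) ∨ ((deg G Q v : ℝ) ≤ γ ∧ γ < deg G Q w) then
      ((occurrences G γ Q w v : ℚ) - 1) / 4
    else
      ((occurrences G γ Q w v : ℚ) - 1) / 6

/-- The threshold `γ_i = 2^((3/2)^i) · 2α` of iteration `i`. -/
noncomputable def threshold (α i : ℕ) : ℝ :=
  (2 : ℝ) ^ ((3 / 2 : ℝ) ^ i) * (2 * (α : ℝ))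

/-- The set `Q_i` of the vertices that are unprocessed at the beginning of iteration `i`. -/
noncomputable def remaining (α : ℕ) : ℕ → Finset (Fin n)
  | 0 => Finset.univ
  | i + 1 => remaining α i \ low G (threshold α i) (remaining α i)

/-- The value of the counter `T` at the beginning of iteration `i`. -/
noncomputable def counter (α : ℕ) : ℕ → ℚ
  | 0 => 0
  | i + 1 => counter α i +
      ∑ w ∈ remaining G α i, findTrianglesExact G (threshold α i) (remaining G α i) w

/-- The number of iterations: the loop runs over `i = 0, …, ⌈log_{3/2} (log₂ n)⌉`.
(For `n ≤ 1` this is a single iteration.) -/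
noncomputable def iterations (n : ℕ) : ℕ :=
  ⌈Real.logb (3 / 2) (Real.logb 2 n)⌉₊ + 1

/-- The value returned by Count-Triangles on `G`, given the bound `α` on the arboricity. -/
noncomputable def output (α : ℕ) : ℚ := counter G α (iterations n)

end Procedure

end CountTriangles

/-! ### The MPC model -/

/-- A program for `M` machines. The memory of a machine is a list of words, which are natural
numbers. In a round, machine `j` with memory `x` performs an arbitrary local computation, whose
result is the memory that it keeps, and for every machine `k` the (possibly empty) message,
a list of words, that it sends to `k`. -/
structure MPCProgram (M : ℕ) where
  compute : (round : ℕ) → (j : Fin M) → (x : List ℕ) → List ℕ × (Fin M → List ℕ)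

namespace MPCProgram

variable {M : ℕ}

/-- The memories of all machines after `t` rounds. After a round, the memory of a machine holds
what the machine kept, followed by the messages it received, in the order of the senders. -/
def run (P : MPCProgram M) (input : Fin M → List ℕ) : ℕ → Fin M → List ℕ
  | 0 => input
  | t + 1 => fun j =>
      (P.compute t j (run P input t j)).1 ++
        (List.finRange M).flatMap fun k => (P.compute t k (run P input t k)).2 j

/-- During the first `R` rounds no machine ever holds more than `S` words (received messages
included), no machine sends more than `S` words in a round, and every word is smaller than `W`. -/
def RespectsSpace (P : MPCProgram M) (input : Fin M → List ℕ) (R S W : ℕ) : Prop :=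
  (∀ t ≤ R, ∀ j, (P.run input t j).length ≤ S ∧ ∀ x ∈ P.run input t j, x < W) ∧
  ∀ t < R, ∀ j, ∑ k, ((P.compute t j (P.run input t j)).2 k).length ≤ S

end MPCProgram

/-- Memory layout for a graph with edges distributed over the machines and a counter `T`:
the first word of machine `0` is `T` and the first word of every other machine is `0`; then
machine `j` lists the two end points of each edge in `es j`. -/
def graphMemory {n M : ℕ} (es : Fin M → List (Fin n × Fin n)) (T : ℕ) (j : Fin M) : List ℕ :=
  (if (j : ℕ) = 0 then T else 0) :: (es j).flatMap fun e => [(e.1 : ℕ), (e.2 : ℕ)]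

/-- The machines together list every edge of `G[Q]` exactly once (in any order, with its end
points in any order, on any machine), and nothing else. -/
def ListsEdges {n M : ℕ} (G : SimpleGraph (Fin n)) (Q : Finset (Fin n))
    (es : Fin M → List (Fin n × Fin n)) : Prop :=
  (((List.finRange M).flatMap es).map fun e => s(e.1, e.2)).Nodup ∧
  ∀ u v : Fin n, s(u, v) ∈ ((List.finRange M).flatMap es).map (fun e => s(e.1, e.2)) ↔
    G.Adj u v ∧ u ∈ Q ∧ v ∈ Q

/-! Counting. For adjacent `w`, `v` in `G[Q]`, the number of occurrences of `v` minus one is the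
number of low common neighbours of `w` and `v`. A triangle of `G[Q]` is therefore seen from exactly
those ordered pairs of its vertices whose third vertex is low: 2, 4 or 6 pairs if it has one, two or
three low vertices. In the last case and in the first one all pairs carry the divisor 6 and 2,
respectively, and with two low vertices each of the four pairs is mixed and carries 4. So an
iteration adds exactly the number of triangles destroyed by deleting the low vertices
(`sum_findTrianglesExact`), and counted plus surviving triangles stay constant (`six_mul_found`).

Decay. A union of `α` forests has at most `α|Q|` edges inside `Q`, so by Markov's inequality the
unprocessed set shrinks by the factor `2^((3/2)^i)` in iteration `i`. The exponents sum up
geometrically, and after `O(log log n)` iterations at most one vertex is left. Moreover the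
potential `γ_i · ∑ d_{Q_i}(v)` never increases (`threshold_mul_sum_deg_antitone`). It starts at
`8mα` and dominates the sum of the squared degrees of the low vertices, which is the number of pairs
of edges at a common low vertex. Hence all these wedges can be written down within the total space.

Simulation. Local computation is arbitrary, so a round is legitimate as soon as the new memory and
the messages are functions of the old memory. `Round` expresses this by comparing two inputs, and
most simulation lemmas have the form "equal data give equal results"; `exists_program` extracts a
program. The machines hold an array with `f²` cells each, where `f` is about `n^(δ/2)`. Three
primitives take a number of rounds depending only on the depth `D`: scans (`reach_scan`), routing
along injective destinations (`exists_reach_route`), and radix sort in base `f`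
(`exists_reach_sort`). With them, each edge becomes two arcs. Sorting yields degrees and ranks. An
arc with low origin of degree `d` is copied `d` times, the `d × d` square of copies at one origin is
transposed by routing, and each cell of the square then knows two arcs with this origin, that is, a
wedge (`exists_reach_pairing`). A wedge whose centre is the least low vertex of its potential
triangle asks for the closing edge, and one more sort by end points answers all queries
(`reach_count`).

Since `D` depends only on `δ`, an iteration costs `O_δ(1)` rounds. If the whole array is smaller
than the memory of one machine, a single machine does everything locally. -/

/-! ### Forests and arboricity -/

theorem exists_forests {V : Type*} [Finite V] (G : SimpleGraph V) :
    ∃ F : Fin (arboricity G) → SimpleGraph V, (∀ i, (F i).IsAcyclic) ∧ (⨆ i, F i) = G := by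
  refine Nat.sInf_mem (s := {k : ℕ | ∃ F : Fin k → SimpleGraph V,
    (∀ i, (F i).IsAcyclic) ∧ (⨆ i, F i) = G}) ?_
  -- The infimum over an empty set would be a meaningless 0, so some decomposition must exist: every
  -- single edge is a forest, and there are finitely many edges.
  have hac : ∀ s : G.edgeSet, (SimpleGraph.fromEdgeSet {(s : Sym2 V)}).IsAcyclic := by
    rintro ⟨s, hs⟩
    induction s with
    | h x y =>
      have hxy : ¬ (⊥ : SimpleGraph V).Reachable x y := by
        rw [SimpleGraph.reachable_bot]
        exact G.ne_of_adj hs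
      have := (SimpleGraph.isAcyclic_add_edge_iff_of_not_reachable x y hxy).2
        SimpleGraph.isAcyclic_bot
      simpa [SimpleGraph.edge] using this
  obtain ⟨k, ⟨e⟩⟩ := Finite.exists_equiv_fin G.edgeSet
  refine ⟨k, fun i => SimpleGraph.fromEdgeSet {(e.symm i : Sym2 V)}, fun i => hac _, ?_⟩
  · ext x y
    simp only [SimpleGraph.iSup_adj, SimpleGraph.fromEdgeSet_adj, Set.mem_singleton_iff]
    constructor
    · rintro ⟨i, h, -⟩
      have := (e.symm i).2
      rw [← h] at this
      exact this
    · intro h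
      exact ⟨e ⟨s(x, y), h⟩, by simp, G.ne_of_adj h⟩

/-- A forest extends to a spanning tree of the complete graph, which has one edge less than
vertices. The empty vertex set has no spanning tree and is treated apart. -/
theorem SimpleGraph.IsAcyclic.card_edgeFinset_le {V : Type*} [Fintype V] {H : SimpleGraph V}
    [Fintype H.edgeSet] (hH : H.IsAcyclic) : H.edgeFinset.card ≤ Fintype.card V := by
  classical
  cases isEmpty_or_nonempty V
  · have : H.edgeFinset = ∅ := by
      ext e
      induction e with
      | h x y => exact (IsEmpty.false x).elim
    simp [this]
  · obtain ⟨T, hHT, -, hT⟩ := SimpleGraph.Connected.exists_isTree_le_of_le_of_isAcyclic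
      (G := (⊤ : SimpleGraph V)) SimpleGraph.connected_top le_top hH
    have h1 := hT.card_edgeFinset
    have h2 : H.edgeFinset.card ≤ T.edgeFinset.card :=
      Finset.card_le_card (SimpleGraph.edgeFinset_mono hHT)
    omega

/-! ### Degree sums and the decay of the unprocessed set -/

namespace CountTriangles

section Graph

variable {n : ℕ}

theorem mem_nbrs {G : SimpleGraph (Fin n)} [DecidableRel G.Adj] {Q : Finset (Fin n)}
    {u v : Fin n} : u ∈ nbrs G Q v ↔ u ∈ Q ∧ G.Adj v u := by
  simp [nbrs]

theorem mem_low {G : SimpleGraph (Fin n)} [DecidableRel G.Adj] {Q : Finset (Fin n)} {γ : ℝ}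
    {v : Fin n} : v ∈ low G γ Q ↔ v ∈ Q ∧ (deg G Q v : ℝ) ≤ γ := by
  simp [low]

theorem sum_deg_le_of_isAcyclic (F : SimpleGraph (Fin n)) [DecidableRel F.Adj]
    (hF : F.IsAcyclic) (Q : Finset (Fin n)) : ∑ v ∈ Q, deg F Q v ≤ 2 * Q.card := by
  classical
  let H := F.induce (Q : Set (Fin n))
  have hH : H.IsAcyclic := hF.induce _
  have h1 : ∑ v ∈ Q, deg F Q v = ∑ v : (Q : Set (Fin n)), H.degree v := by
    rw [← Finset.sum_coe_sort Q]
    refine Finset.sum_congr rfl fun v _ => ?_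
    rw [← SimpleGraph.card_neighborFinset_eq_degree, deg]
    symm
    refine Finset.card_bij (fun a _ => (a : Fin n)) ?_ ?_ ?_
    · intro a ha
      rw [SimpleGraph.mem_neighborFinset] at ha
      rw [mem_nbrs]
      exact ⟨a.2, ha⟩
    · intro a _ b _ h
      exact Subtype.ext h
    · intro b hb
      rw [mem_nbrs] at hb
      exact ⟨⟨b, hb.1⟩, by rw [SimpleGraph.mem_neighborFinset]; exact hb.2, rfl⟩
  rw [h1, SimpleGraph.sum_degrees_eq_twice_card_edges]
  have := hH.card_edgeFinset_le
  simp only [Finset.coe_sort_coe, Fintype.card_coe] at this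
  omega

/-- Each forest contributes at most `|Q|` edges inside `Q`. This is the only form in which the
arboricity bound enters the proof. -/
theorem sum_deg_le (G : SimpleGraph (Fin n)) [DecidableRel G.Adj] {α : ℕ}
    (hα : arboricity G ≤ α) (Q : Finset (Fin n)) : ∑ v ∈ Q, deg G Q v ≤ 2 * α * Q.card := by
  classical
  obtain ⟨F, hF, hG⟩ := exists_forests G
  have h1 : ∀ v ∈ Q, deg G Q v ≤ ∑ i, deg (F i) Q v := by
    intro v _
    have : nbrs G Q v ⊆ Finset.univ.biUnion fun i => nbrs (F i) Q v := by
      intro u hu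
      rw [mem_nbrs, ← hG, SimpleGraph.iSup_adj] at hu
      obtain ⟨hQ, i, hi⟩ := hu
      simp only [Finset.mem_biUnion, Finset.mem_univ, true_and, mem_nbrs]
      exact ⟨i, hQ, hi⟩
    exact (Finset.card_le_card this).trans Finset.card_biUnion_le
  calc ∑ v ∈ Q, deg G Q v ≤ ∑ v ∈ Q, ∑ i, deg (F i) Q v := Finset.sum_le_sum h1
    _ = ∑ i, ∑ v ∈ Q, deg (F i) Q v := Finset.sum_comm
    _ ≤ ∑ _i : Fin (arboricity G), 2 * Q.card :=
      Finset.sum_le_sum fun i _ => sum_deg_le_of_isAcyclic (F i) (hF i) Q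
    _ = arboricity G * (2 * Q.card) := by simp
    _ ≤ α * (2 * Q.card) := Nat.mul_le_mul_right _ hα
    _ = 2 * α * Q.card := by ring

theorem one_le_two_rpow (i : ℕ) : (1 : ℝ) ≤ (2 : ℝ) ^ ((3 / 2 : ℝ) ^ i) :=
  Real.one_le_rpow (by norm_num) (by positivity)

theorem threshold_nonneg (α i : ℕ) : 0 ≤ threshold α i := by
  unfold threshold; positivity

variable (G : SimpleGraph (Fin n)) [DecidableRel G.Adj]

theorem remaining_succ (α i : ℕ) : remaining G α (i + 1) =
    remaining G α i \ low G (threshold α i) (remaining G α i) := rfl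

theorem mem_remaining_succ {α i : ℕ} {v : Fin n} : v ∈ remaining G α (i + 1) ↔
    v ∈ remaining G α i ∧ threshold α i < deg G (remaining G α i) v := by
  rw [remaining_succ, Finset.mem_sdiff, mem_low, not_and, not_le]
  exact ⟨fun h => ⟨h.1, h.2 h.1⟩, fun h => ⟨h.1, fun _ => h.2⟩⟩

/-- Markov's inequality: every survivor has degree above the threshold. -/
theorem card_remaining_succ_mul_le (α i : ℕ) :
    ((remaining G α (i + 1)).card : ℝ) * threshold α i ≤
      ∑ v ∈ remaining G α i, (deg G (remaining G α i) v : ℝ) := by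
  calc ((remaining G α (i + 1)).card : ℝ) * threshold α i
      = ∑ _v ∈ remaining G α (i + 1), threshold α i := by simp
    _ ≤ ∑ v ∈ remaining G α (i + 1), (deg G (remaining G α i) v : ℝ) :=
      Finset.sum_le_sum fun v hv => ((mem_remaining_succ G).1 hv).2.le
    _ ≤ _ := Finset.sum_le_sum_of_subset_of_nonneg Finset.sdiff_subset fun _ _ _ => by positivity

theorem sum_deg_le_real {α : ℕ} (hα : arboricity G ≤ α) (Q : Finset (Fin n)) :
    ∑ v ∈ Q, (deg G Q v : ℝ) ≤ 2 * α * Q.card := by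
  exact_mod_cast sum_deg_le G hα Q

/-- Write `γ_i = x · 2α`. Markov and sparsity give `x · D_{i+1} ≤ D_i` for the degree sums, while
the threshold grows by a factor of at most `x`; the two effects cancel. This is why the growth rate
`3/2` is harmless for the space. -/
theorem threshold_mul_sum_deg_antitone {α : ℕ} (hα : arboricity G ≤ α) (i : ℕ) :
    threshold α (i + 1) * ∑ v ∈ remaining G α (i + 1), (deg G (remaining G α (i + 1)) v : ℝ) ≤
      threshold α i * ∑ v ∈ remaining G α i, (deg G (remaining G α i) v : ℝ) := by
  have h1 := card_remaining_succ_mul_le G α i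
  have h2 := sum_deg_le_real G hα (remaining G α (i + 1))
  set D := ∑ v ∈ remaining G α i, (deg G (remaining G α i) v : ℝ)
  set D' := ∑ v ∈ remaining G α (i + 1), (deg G (remaining G α (i + 1)) v : ℝ)
  set x := (2 : ℝ) ^ ((3 / 2 : ℝ) ^ i) with hx
  have hx1 : 1 ≤ x := one_le_two_rpow i
  have hD' : 0 ≤ D' := Finset.sum_nonneg fun _ _ => by positivity
  have ht : threshold α i = x * (2 * α) := rfl
  -- Only `3/2 ≤ 2` matters here: the next threshold factor is at most the square of the present
  -- one.
  have hxx : (2 : ℝ) ^ ((3 / 2 : ℝ) ^ (i + 1)) ≤ x * x := by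
    rw [hx, ← Real.rpow_add (by norm_num)]
    refine Real.rpow_le_rpow_of_exponent_le (by norm_num) ?_
    have : (0 : ℝ) ≤ (3 / 2 : ℝ) ^ i := by positivity
    rw [pow_succ]; linarith
  have ht' : threshold α (i + 1) ≤ x * x * (2 * α) :=
    mul_le_mul_of_nonneg_right hxx (by positivity)
  rw [ht] at h1 ⊢
  calc threshold α (i + 1) * D' ≤ x * x * (2 * α) * D' := mul_le_mul_of_nonneg_right ht' hD'
    _ = (x * (2 * α)) * (x * D') := by ring
    _ ≤ (x * (2 * α)) * D := by
      refine mul_le_mul_of_nonneg_left ?_ (by positivity)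
      calc x * D' ≤ x * (2 * α * (remaining G α (i + 1)).card) :=
            mul_le_mul_of_nonneg_left h2 (by positivity)
        _ = (remaining G α (i + 1)).card * (x * (2 * α)) := by ring
        _ ≤ D := h1

theorem sum_deg_univ : ∑ v, deg G Finset.univ v = 2 * G.edgeFinset.card := by
  rw [← SimpleGraph.sum_degrees_eq_twice_card_edges]
  refine Finset.sum_congr rfl fun v _ => ?_
  rw [deg, ← SimpleGraph.card_neighborFinset_eq_degree]
  congr 1
  ext u
  simp [mem_nbrs]

theorem threshold_mul_sum_deg_le {α : ℕ} (hα : arboricity G ≤ α) (i : ℕ) :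
    threshold α i * ∑ v ∈ remaining G α i, (deg G (remaining G α i) v : ℝ) ≤
      8 * (G.edgeFinset.card * α : ℕ) := by
  induction i with
  | zero =>
    have : ∑ v ∈ remaining G α 0, (deg G (remaining G α 0) v : ℝ) =
        2 * G.edgeFinset.card := by
      exact_mod_cast sum_deg_univ G
    rw [this, threshold]
    norm_num
    apply le_of_eq; ring
  | succ i ih => exact (threshold_mul_sum_deg_antitone G hα i).trans ih

/-- For a low vertex `d² ≤ γ_i · d`, so the sum of squares is bounded by the potential. It counts
the copies of arcs that an iteration has to store. -/
theorem sum_low_sq_le {α : ℕ} (hα : arboricity G ≤ α) (i : ℕ) :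
    ∑ v ∈ low G (threshold α i) (remaining G α i), deg G (remaining G α i) v ^ 2 ≤
      8 * (G.edgeFinset.card * α) := by
  have h := threshold_mul_sum_deg_le G hα i
  have : (∑ v ∈ low G (threshold α i) (remaining G α i),
      (deg G (remaining G α i) v : ℝ) ^ 2) ≤ 8 * (G.edgeFinset.card * α : ℕ) := by
    refine le_trans ?_ h
    rw [Finset.mul_sum]
    refine (Finset.sum_le_sum (g := fun v => threshold α i * (deg G (remaining G α i) v : ℝ))
      fun v hv => ?_).trans (Finset.sum_le_sum_of_subset_of_nonneg (Finset.filter_subset _ _)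
        fun v _ _ => mul_nonneg (threshold_nonneg _ _) (by positivity))
    rw [sq]
    exact mul_le_mul_of_nonneg_right (mem_low.1 hv).2 (by positivity)
  exact_mod_cast this

theorem deg_le (Q : Finset (Fin n)) (v : Fin n) : deg G Q v ≤ n :=
  (Finset.card_le_univ _).trans_eq (Fintype.card_fin n)

theorem sum_deg_remaining_le (α i : ℕ) :
    ∑ v ∈ remaining G α i, deg G (remaining G α i) v ≤ 2 * G.edgeFinset.card := by
  rw [← sum_deg_univ]
  refine (Finset.sum_le_sum (g := fun v => deg G Finset.univ v) fun v _ => ?_).trans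
    (Finset.sum_le_sum_of_subset (Finset.subset_univ _))
  exact Finset.card_le_card (Finset.filter_subset_filter _ (Finset.subset_univ _))

/-- The given `α` may be much larger than `n`. The trivial bound `d ≤ n` keeps the size of the array
polynomial in `n`, so that words of `O(log n)` bits and a depth depending only on `δ` suffice. -/
theorem sum_low_sq_le_min {α : ℕ} (hα : arboricity G ≤ α) (i : ℕ) :
    ∑ v ∈ low G (threshold α i) (remaining G α i), deg G (remaining G α i) v ^ 2 ≤
      8 * (G.edgeFinset.card * min α n) := by
  have h2 : ∑ v ∈ low G (threshold α i) (remaining G α i), deg G (remaining G α i) v ^ 2 ≤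
      8 * (G.edgeFinset.card * n) := by
    calc ∑ v ∈ low G (threshold α i) (remaining G α i), deg G (remaining G α i) v ^ 2
        ≤ ∑ v ∈ low G (threshold α i) (remaining G α i), n * deg G (remaining G α i) v := by
          refine Finset.sum_le_sum fun v _ => ?_
          rw [sq]; exact Nat.mul_le_mul_right _ (deg_le G _ _)
      _ ≤ ∑ v ∈ remaining G α i, n * deg G (remaining G α i) v :=
          Finset.sum_le_sum_of_subset (Finset.filter_subset _ _)
      _ = n * ∑ v ∈ remaining G α i, deg G (remaining G α i) v := by rw [Finset.mul_sum]
      _ ≤ n * (2 * G.edgeFinset.card) := Nat.mul_le_mul_left _ (sum_deg_remaining_le G α i)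
      _ ≤ 8 * (G.edgeFinset.card * n) := by nlinarith [Nat.zero_le (n * G.edgeFinset.card)]
  rcases le_total α n with h | h
  · rw [min_eq_left h]; exact sum_low_sq_le G hα i
  · rw [min_eq_right h]; exact h2

/-- The shrinking factors multiply, and `(3/2)^0 + … + (3/2)^(i-1) = 2((3/2)^i - 1)`. Positivity of
`α` is needed to cancel `2α`. -/
theorem card_remaining_mul_le {α : ℕ} (hα : arboricity G ≤ α) (hα0 : 0 < α) (i : ℕ) :
    ((remaining G α i).card : ℝ) * (2 : ℝ) ^ (2 * ((3 / 2 : ℝ) ^ i - 1)) ≤ n := by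
  induction i with
  | zero => simp [remaining]
  | succ i ih =>
    refine le_trans ?_ ih
    have h1 := (card_remaining_succ_mul_le G α i).trans (sum_deg_le_real G hα _)
    have hα' : (0 : ℝ) < 2 * α := by positivity
    have h2 : ((remaining G α (i + 1)).card : ℝ) * (2 : ℝ) ^ ((3 / 2 : ℝ) ^ i) ≤
        (remaining G α i).card := by
      rw [threshold] at h1
      nlinarith
    have h3 : 2 * ((3 / 2 : ℝ) ^ (i + 1) - 1) =
        (3 / 2 : ℝ) ^ i + 2 * ((3 / 2 : ℝ) ^ i - 1) := by ring
    rw [h3, Real.rpow_add (by norm_num), ← mul_assoc]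
    exact mul_le_mul_of_nonneg_right h2 (by positivity)

theorem card_remaining_iterations_le {α : ℕ} (hα : arboricity G ≤ α) (hα0 : 0 < α) :
    (remaining G α (iterations n)).card ≤ 1 := by
  rcases Nat.lt_or_ge n 2 with hn | hn
  · refine (Finset.card_le_univ _).trans ?_
    simp; omega
  have h := card_remaining_mul_le G hα hα0 (iterations n)
  have hn' : (2 : ℝ) ≤ n := by exact_mod_cast hn
  have hl : 1 ≤ Real.logb 2 n := by
    rw [Real.le_logb_iff_rpow_le (by norm_num) (by linarith)]; simpa using hn'
  have hp : Real.logb 2 n * (3 / 2) ≤ (3 / 2 : ℝ) ^ (iterations n) := by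
    rw [iterations, pow_succ]
    refine mul_le_mul_of_nonneg_right ?_ (by norm_num)
    rw [← Real.rpow_natCast, ← Real.logb_le_iff_le_rpow (by norm_num) (by linarith)]
    exact Nat.le_ceil _
  -- With `L = log₂ n ≥ 1`, the exponent is at least `2(3L/2 - 1) = 3L - 2 ≥ L`. The extra iteration
  -- beyond the ceiling provides the factor `3/2`.
  have h4 : (n : ℝ) ≤ (2 : ℝ) ^ (2 * ((3 / 2 : ℝ) ^ (iterations n) - 1)) * 1 := by
    rw [mul_one]
    calc (n : ℝ) = (2 : ℝ) ^ (Real.logb 2 n) := by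
          rw [Real.rpow_logb (by norm_num) (by norm_num) (by linarith)]
      _ ≤ _ := Real.rpow_le_rpow_of_exponent_le (by norm_num) (by linarith)
  have hpos : (0 : ℝ) < (2 : ℝ) ^ (2 * ((3 / 2 : ℝ) ^ (iterations n) - 1)) := by positivity
  have : ((remaining G α (iterations n)).card : ℝ) ≤ 1 := by
    by_contra hc
    push Not at hc
    nlinarith
  exact_mod_cast this

/-- At most one vertex is left if `α > 0`. For `α = 0` the thresholds vanish and the decay bound is
void, but then there are no edges at all. -/
theorem not_adj_of_mem_remaining_iterations {α : ℕ} (hα : arboricity G ≤ α) {u v : Fin n}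
    (hu : u ∈ remaining G α (iterations n)) (hv : v ∈ remaining G α (iterations n)) :
    ¬ G.Adj u v := by
  intro h
  rcases Nat.eq_zero_or_pos α with h0 | h0
  · have h1 := sum_deg_le G hα Finset.univ
    rw [h0] at h1
    have h2 : deg G Finset.univ u ≤ 0 := by
      refine (Finset.single_le_sum (f := fun v => deg G Finset.univ v) (fun _ _ => Nat.zero_le _)
        (Finset.mem_univ u)).trans ?_
      simpa using h1
    have h3 : v ∈ nbrs G Finset.univ u := mem_nbrs.2 ⟨Finset.mem_univ _, h⟩
    have := Finset.card_pos.2 ⟨v, h3⟩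
    unfold deg at h2; omega
  · have := Finset.card_le_one.1 (card_remaining_iterations_le G hα h0) u hu v hv
    exact G.ne_of_adj h this

end Graph

end CountTriangles

/-! ### Exactness of the count -/

namespace CountTriangles

section Count

variable {n : ℕ} (G : SimpleGraph (Fin n))

/-- The three vertices form a triangle with all vertices in `Q`. -/
def IsTriangle (Q : Finset (Fin n)) (u v w : Fin n) : Prop :=
  (u ∈ Q ∧ v ∈ Q ∧ w ∈ Q) ∧ G.Adj u v ∧ G.Adj v w ∧ G.Adj u w

/-- `u` is a low vertex that precedes `v`, where the low vertices precede the other ones. -/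
def Precedes (A : Finset (Fin n)) (u v : Fin n) : Prop := u ∈ A ∧ (v ∈ A → u < v)

open Classical in
/-- The number of triangles of `G[Q]` with a vertex in `A`. -/
noncomputable def hits (A Q : Finset (Fin n)) : ℕ :=
  ∑ u, ∑ v, ∑ w, if IsTriangle G Q u v w ∧ Precedes A u v ∧ Precedes A u w ∧ v < w then 1 else 0

open Classical in
/-- The number of ordered triangles of `G[Q]`. -/
noncomputable def orderedTriangles (Q : Finset (Fin n)) : ℕ :=
  ∑ u, ∑ v, ∑ w, if IsTriangle G Q u v w then 1 else 0

theorem sum_rotate {V A : Type*} [Fintype V] [AddCommMonoid A] (f : V → V → V → A) :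
    ∑ u, ∑ v, ∑ w, f v w u = ∑ u, ∑ v, ∑ w, f u v w := by
  rw [Finset.sum_comm]
  refine Finset.sum_congr rfl fun v _ => ?_
  rw [Finset.sum_comm]

theorem sum_swap {V A : Type*} [Fintype V] [AddCommMonoid A] (f : V → V → V → A) :
    ∑ u, ∑ v, ∑ w, f u w v = ∑ u, ∑ v, ∑ w, f u v w :=
  Finset.sum_congr rfl fun _ _ => Finset.sum_comm

variable {G} in
theorem IsTriangle.rotate {Q : Finset (Fin n)} {u v w : Fin n} :
    IsTriangle G Q v w u ↔ IsTriangle G Q u v w := by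
  unfold IsTriangle
  rw [G.adj_comm v u, G.adj_comm w u]
  tauto

variable {G} in
theorem IsTriangle.swap {Q : Finset (Fin n)} {u v w : Fin n} :
    IsTriangle G Q u w v ↔ IsTriangle G Q u v w := by
  unfold IsTriangle
  rw [G.adj_comm w v]
  tauto

-- Exactly one of the six orderings of a triangle with a vertex in `A` is counted by `hits`: first
-- its least vertex in `A`, then the other two in increasing order.
open Classical in
theorem six_mul_hits {A Q : Finset (Fin n)} :
    6 * hits G A Q = ∑ u, ∑ v, ∑ w,
      if IsTriangle G Q u v w ∧ (u ∈ A ∨ v ∈ A ∨ w ∈ A) then 1 else 0 := by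
  set f : Fin n → Fin n → Fin n → ℕ := fun u v w =>
    if IsTriangle G Q u v w ∧ Precedes A u v ∧ Precedes A u w ∧ v < w then 1 else 0 with hf
  have h0 : hits G A Q = ∑ u, ∑ v, ∑ w, f u v w := rfl
  have h1 : ∑ u, ∑ v, ∑ w, f v w u = hits G A Q := sum_rotate f
  have h2 : ∑ u, ∑ v, ∑ w, f w u v = hits G A Q :=
    (sum_rotate fun u v w => f v w u).trans h1
  have h3 : ∑ u, ∑ v, ∑ w, f u w v = hits G A Q := sum_swap f
  have h4 : ∑ u, ∑ v, ∑ w, f v u w = hits G A Q :=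
    (sum_rotate fun u v w => f u w v).trans h3
  have h5 : ∑ u, ∑ v, ∑ w, f w v u = hits G A Q :=
    (sum_rotate fun u v w => f v u w).trans h4
  have h6 : 6 * hits G A Q = ∑ u, ∑ v, ∑ w, f u v w + ∑ u, ∑ v, ∑ w, f v w u +
      ∑ u, ∑ v, ∑ w, f w u v + ∑ u, ∑ v, ∑ w, f u w v + ∑ u, ∑ v, ∑ w, f v u w +
      ∑ u, ∑ v, ∑ w, f w v u := by
    rw [h1, h2, h3, h4, h5, ← h0]; ring
  rw [h6]
  simp only [← Finset.sum_add_distrib]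
  refine Finset.sum_congr rfl fun u _ => Finset.sum_congr rfl fun v _ =>
    Finset.sum_congr rfl fun w _ => ?_
  simp only [hf]
  have e1 : IsTriangle G Q v w u ↔ IsTriangle G Q u v w := IsTriangle.rotate
  have e2 : IsTriangle G Q w u v ↔ IsTriangle G Q u v w := IsTriangle.rotate.trans IsTriangle.rotate
  have e3 : IsTriangle G Q u w v ↔ IsTriangle G Q u v w := IsTriangle.swap
  have e5 : IsTriangle G Q w v u ↔ IsTriangle G Q u v w := IsTriangle.swap.trans e2
  have e4 : IsTriangle G Q v u w ↔ IsTriangle G Q u v w := IsTriangle.rotate.trans e5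
  rw [e1, e2, e3, e4, e5]
  by_cases ht : IsTriangle G Q u v w
  · have huv : u ≠ v := G.ne_of_adj ht.2.1
    have hvw : v ≠ w := G.ne_of_adj ht.2.2.1
    have huw : u ≠ w := G.ne_of_adj ht.2.2.2
    simp only [ht, true_and, Precedes]
    rcases lt_or_gt_of_ne huv with h | h <;> rcases lt_or_gt_of_ne hvw with h' | h' <;>
      rcases lt_or_gt_of_ne huw with h'' | h'' <;>
      by_cases hu : u ∈ A <;> by_cases hv : v ∈ A <;> by_cases hw : w ∈ A <;>
      simp [hu, hv, hw, h, h', h'', h.not_gt, h'.not_gt, h''.not_gt] <;> omega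
  · simp [ht]

theorem orderedTriangles_sdiff {A Q : Finset (Fin n)} :
    orderedTriangles G Q = orderedTriangles G (Q \ A) + 6 * hits G A Q := by
  classical
  rw [six_mul_hits, orderedTriangles, orderedTriangles, ← Finset.sum_add_distrib]
  refine Finset.sum_congr rfl fun u _ => ?_
  rw [← Finset.sum_add_distrib]
  refine Finset.sum_congr rfl fun v _ => ?_
  rw [← Finset.sum_add_distrib]
  refine Finset.sum_congr rfl fun w _ => ?_
  by_cases ht : IsTriangle G Q u v w
  · have : IsTriangle G (Q \ A) u v w ↔ ¬ (u ∈ A ∨ v ∈ A ∨ w ∈ A) := by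
      simp only [IsTriangle, Finset.mem_sdiff] at ht ⊢
      tauto
    by_cases hA : u ∈ A ∨ v ∈ A ∨ w ∈ A <;> simp [ht, this, hA]
  · have : ¬ IsTriangle G (Q \ A) u v w := by
      simp only [IsTriangle, Finset.mem_sdiff] at ht ⊢
      tauto
    simp [ht, this]

/-- With `A` the set of all vertices nothing survives, and `hits` runs over the increasing triples
of pairwise adjacent vertices, which correspond to the 3-cliques. -/
theorem orderedTriangles_univ [DecidableRel G.Adj] :
    orderedTriangles G Finset.univ = 6 * (G.cliqueFinset 3).card := by
  classical
  have h := orderedTriangles_sdiff G (A := Finset.univ) (Q := Finset.univ)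
  have h0 : orderedTriangles G (Finset.univ \ Finset.univ) = 0 := by
    simp [orderedTriangles, IsTriangle]
  rw [h, h0, zero_add]
  congr 1
  have hcard : hits G Finset.univ Finset.univ = (Finset.filter (fun p : Fin n × Fin n × Fin n =>
      IsTriangle G Finset.univ p.1 p.2.1 p.2.2 ∧ Precedes Finset.univ p.1 p.2.1 ∧
      Precedes Finset.univ p.1 p.2.2 ∧ p.2.1 < p.2.2)
      (Finset.univ ×ˢ Finset.univ ×ˢ Finset.univ)).card := by
    rw [Finset.card_filter, Finset.sum_product]
    refine Finset.sum_congr rfl fun u _ => ?_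
    rw [Finset.sum_product]
  rw [hcard]
  refine Finset.card_bij (fun p _ => {p.1, p.2.1, p.2.2}) ?_ ?_ ?_
  · rintro ⟨u, v, w⟩ hp
    simp only [Finset.mem_filter, Finset.mem_product, Finset.mem_univ, true_and, IsTriangle,
      Precedes, forall_true_left, and_true] at hp
    rw [SimpleGraph.mem_cliqueFinset_iff, SimpleGraph.is3Clique_triple_iff]
    tauto
  · rintro ⟨u, v, w⟩ hp ⟨u', v', w'⟩ hp' he
    simp only [Finset.mem_filter, Finset.mem_product, Finset.mem_univ, true_and, IsTriangle,
      Precedes, forall_true_left, and_true] at hp hp' he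
    have h1 : ∀ x, x = u ∨ x = v ∨ x = w ↔ x = u' ∨ x = v' ∨ x = w' := by
      intro x
      have := Finset.ext_iff.1 he x
      simpa using this
    have a1 := (h1 u).1 (by simp)
    have a2 := (h1 v).1 (by simp)
    have a3 := (h1 w).1 (by simp)
    simp only [Prod.mk.injEq]
    obtain ⟨-, b1, b2, b3⟩ := hp
    obtain ⟨-, c1, c2, c3⟩ := hp'
    omega
  · intro s hs
    rw [SimpleGraph.mem_cliqueFinset_iff, SimpleGraph.is3Clique_iff] at hs
    obtain ⟨a, b, c, hab, hac, hbc, rfl⟩ := hs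
    have key : ∀ u v w : Fin n, G.Adj u v → G.Adj u w → G.Adj v w → u < v → v < w →
        ({u, v, w} : Finset (Fin n)) = {a, b, c} →
        ∃ p, ∃ (_ : p ∈ Finset.filter (fun p : Fin n × Fin n × Fin n =>
          IsTriangle G Finset.univ p.1 p.2.1 p.2.2 ∧ Precedes Finset.univ p.1 p.2.1 ∧
          Precedes Finset.univ p.1 p.2.2 ∧ p.2.1 < p.2.2) (Finset.univ ×ˢ Finset.univ ×ˢ Finset.univ)),
          ({p.1, p.2.1, p.2.2} : Finset (Fin n)) = {a, b, c} := by
      intro u v w h1 h2 h3 h4 h5 h6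
      refine ⟨(u, v, w), ?_, h6⟩
      simp [IsTriangle, Precedes, h1, h2, h3, h4, h5, h4.trans h5]
    rcases lt_or_gt_of_ne (G.ne_of_adj hab) with h | h <;>
      rcases lt_or_gt_of_ne (G.ne_of_adj hbc) with h' | h' <;>
      rcases lt_or_gt_of_ne (G.ne_of_adj hac) with h'' | h''
    · exact key a b c hab hac hbc h h' rfl
    · exact absurd (h.trans h') h''.not_gt
    · exact key a c b hac hab hbc.symm h'' h' (by ext; simp; tauto)
    · exact key c a b hac.symm hbc.symm hab h'' h (by ext; simp; tauto)
    · exact key b a c hab.symm hbc hac h h'' (by ext; simp; tauto)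
    · exact key b c a hbc hab.symm hac.symm h' h'' (by ext; simp; tauto)
    · exact absurd (h'.trans h) h''.not_gt
    · exact key c b a hbc.symm hac.symm hab.symm h' h (by ext; simp; tauto)

variable [DecidableRel G.Adj]

-- The subtracted 1 is the occurrence of `v` in the list of `w` itself. The others come one each
-- from the low neighbours `u` of `w` that are adjacent to `v`.
variable {G} in
theorem occurrences_sub_one {γ : ℝ} {Q : Finset (Fin n)} {w v : Fin n} (hv : v ∈ nbrs G Q w) :
    (occurrences G γ Q w v : ℚ) - 1 =
      ∑ u, if u ∈ low G γ Q ∧ G.Adj w u ∧ G.Adj u v then 1 else 0 := by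
  have h1 : Multiset.count v (nbrs G Q w).val = 1 :=
    Multiset.count_eq_one_of_mem (nbrs G Q w).nodup hv
  have h2 : occurrences G γ Q w v = (∑ u ∈ (low G γ Q).filter (fun u => G.Adj w u),
      if G.Adj u v then 1 else 0) + 1 := by
    rw [occurrences, Multiset.count_add, h1, received, Multiset.count_sum']
    congr 1
    refine Finset.sum_congr rfl fun u _ => ?_
    rw [Multiset.count_eq_of_nodup (nbrs G Q u).nodup]
    simp [mem_nbrs, (mem_nbrs.1 hv).1]
  rw [h2]
  push_cast
  rw [add_sub_cancel_right, ← Finset.sum_subset (Finset.subset_univ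
    ((low G γ Q).filter fun u => G.Adj w u))]
  · refine Finset.sum_congr rfl fun u hu => ?_
    simp only [Finset.mem_filter] at hu
    simp [hu]
  · intro u _ hu
    simp only [Finset.mem_filter] at hu
    rw [if_neg]
    tauto

-- The summand becomes a weighted sum over ordered triangles `(w, v, u)` with `u` low, where the
-- weight depends symmetrically on `w`, `v`. The weights are chosen so that the contributions to
-- each triangle with a low vertex add up to 1.
open Classical in
theorem sum_findTrianglesExact (γ : ℝ) (Q : Finset (Fin n)) :
    ∑ w ∈ Q, findTrianglesExact G γ Q w = hits G (low G γ Q) Q := by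
  set A := low G γ Q with hA
  let c : Fin n → Fin n → ℚ := fun w v =>
    if v ∉ A ∧ w ∉ A then 1 / 2 else if v ∈ A ∧ w ∈ A then 1 / 6 else 1 / 4
  let f : Fin n → Fin n → Fin n → ℚ := fun w v u =>
    if IsTriangle G Q w v u ∧ u ∈ A then c w v else 0
  have hAm : ∀ v ∈ Q, (v ∈ A ↔ (deg G Q v : ℝ) ≤ γ) := fun v hv => by
    rw [hA, mem_low]; exact and_iff_right hv
  have h1 : ∑ w ∈ Q, findTrianglesExact G γ Q w = ∑ w, ∑ v, ∑ u, f w v u := by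
    have hw0 : ∀ w, w ∉ Q → ∑ v, ∑ u, f w v u = 0 := fun w hw =>
      Finset.sum_eq_zero fun v _ => Finset.sum_eq_zero fun u _ => by simp [f, IsTriangle, hw]
    rw [← Finset.sum_subset (Finset.subset_univ Q) fun w _ hw => hw0 w hw]
    refine Finset.sum_congr rfl fun w hw => ?_
    have hv0 : ∀ v, v ∉ nbrs G Q w → ∑ u, f w v u = 0 := fun v hv =>
      Finset.sum_eq_zero fun u _ => by
        rw [mem_nbrs] at hv
        have : ¬ IsTriangle G Q w v u := by unfold IsTriangle; tauto
        simp [f, this]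
    rw [← Finset.sum_subset (Finset.subset_univ (nbrs G Q w)) fun v _ hv => hv0 v hv,
      findTrianglesExact]
    refine Finset.sum_congr rfl fun v hv => ?_
    have hvQ := (mem_nbrs.1 hv).1
    have hvw := (mem_nbrs.1 hv).2
    have hc : ∑ u, f w v u = ((occurrences G γ Q w v : ℚ) - 1) * c w v := by
      rw [occurrences_sub_one hv, Finset.sum_mul]
      refine Finset.sum_congr rfl fun u _ => ?_
      have : (IsTriangle G Q w v u ∧ u ∈ A) ↔ (u ∈ low G γ Q ∧ G.Adj w u ∧ G.Adj u v) := by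
        unfold IsTriangle
        rw [← hA, G.adj_comm v u]
        have : u ∈ A → u ∈ Q := fun h => (mem_low.1 h).1
        tauto
      simp only [f, this]
      split_ifs <;> simp
    rw [hc]
    simp only [c, hAm v hvQ, hAm w hw, ← not_lt]
    by_cases a : γ < deg G Q v <;> by_cases b : γ < deg G Q w <;>
      simp [a, b] <;> ring
  have h2 : ∑ w, ∑ v, ∑ u, f v u w = ∑ w, ∑ v, ∑ u, f w v u := sum_rotate f
  have h3 : ∑ w, ∑ v, ∑ u, f u w v = ∑ w, ∑ v, ∑ u, f w v u :=
    (sum_rotate fun w v u => f v u w).trans h2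
  -- For a fixed ordered triangle the three rotations place each vertex once in the role of `u`. The
  -- weights obtained are `1/2`, `1/4 + 1/4` or `3 · 1/6`, always `1/2`.
  have h4 : (6 * hits G A Q : ℕ) = 2 * (∑ w, ∑ v, ∑ u, f w v u + ∑ w, ∑ v, ∑ u, f v u w +
      ∑ w, ∑ v, ∑ u, f u w v) := by
    rw [six_mul_hits]
    push_cast
    simp only [← Finset.sum_add_distrib, Finset.mul_sum]
    refine Finset.sum_congr rfl fun u _ => Finset.sum_congr rfl fun v _ =>
      Finset.sum_congr rfl fun w _ => ?_
    simp only [f, c]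
    have e1 : IsTriangle G Q v w u ↔ IsTriangle G Q u v w := IsTriangle.rotate
    have e2 : IsTriangle G Q w u v ↔ IsTriangle G Q u v w := IsTriangle.rotate.trans IsTriangle.rotate
    rw [e1, e2]
    by_cases ht : IsTriangle G Q u v w <;> by_cases hu : u ∈ A <;> by_cases hv : v ∈ A <;>
      by_cases hw : w ∈ A <;> simp [ht, hu, hv, hw] <;> norm_num
  rw [h2, h3] at h4
  rw [h1]
  push_cast at h4
  linarith

/-- The number of triangles found before iteration `i`. -/
noncomputable def found (α i : ℕ) : ℕ :=
  ∑ j ∈ Finset.range i, hits G (low G (threshold α j) (remaining G α j)) (remaining G α j)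

theorem counter_eq_found (α i : ℕ) : counter G α i = found G α i := by
  induction i with
  | zero => simp [counter, found]
  | succ i ih =>
    rw [counter, ih, sum_findTrianglesExact, found, found, Finset.sum_range_succ]
    push_cast
    rfl

/-- The loop invariant: triangles counted so far plus triangles that are still intact. -/
theorem six_mul_found (α i : ℕ) :
    6 * found G α i + orderedTriangles G (remaining G α i) = 6 * (G.cliqueFinset 3).card := by
  rw [← orderedTriangles_univ]
  induction i with
  | zero => simp [found, remaining]
  | succ i ih =>
    rw [← ih, orderedTriangles_sdiff G (A := low G (threshold α i) (remaining G α i))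
      (Q := remaining G α i), remaining_succ, found, found, Finset.sum_range_succ]
    ring

theorem found_iterations {α : ℕ} (hα : arboricity G ≤ α) :
    found G α (iterations n) = (G.cliqueFinset 3).card := by
  have h := six_mul_found G α (iterations n)
  have : orderedTriangles G (remaining G α (iterations n)) = 0 := by
    refine Finset.sum_eq_zero fun u _ => Finset.sum_eq_zero fun v _ =>
      Finset.sum_eq_zero fun w _ => ?_
    rw [if_neg]
    rintro ⟨⟨hu, hv, -⟩, h, -⟩
    exact not_adj_of_mem_remaining_iterations G hα hu hv h
  omega

/-- Guarantees that the counter fits into a word at all times. -/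
theorem found_le (α i : ℕ) : found G α i ≤ n ^ 3 := by
  have h := six_mul_found G α i
  have h2 : orderedTriangles G Finset.univ ≤ n ^ 3 := by
    classical
    calc orderedTriangles G Finset.univ ≤ ∑ _u : Fin n, ∑ _v : Fin n, ∑ _w : Fin n, 1 :=
          Finset.sum_le_sum fun u _ => Finset.sum_le_sum fun v _ => Finset.sum_le_sum fun w _ => by
            split_ifs <;> simp
      _ = n ^ 3 := by simp; ring
  rw [orderedTriangles_univ] at h2
  omega

end Count

end CountTriangles

/-! ### Fixed-width encodings -/

/-- An injective encoding by a fixed number of words. -/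
class Enc (X : Type) where
  width : ℕ
  enc : X → List ℕ
  length_enc : ∀ x, (enc x).length = width
  injective_enc : Function.Injective enc

namespace Enc

variable {X Y : Type} [Enc X] [Enc Y]

/-- All words of the encoding are smaller than `W`. -/
def Below (W : ℕ) (x : X) : Prop := ∀ y ∈ enc x, y < W

/-- Fixed width makes the concatenation decodable once the number of blocks is known; if the width
is positive, the total length reveals that number. -/
theorem flatMap_inj : ∀ {l l' : List X}, l.length = l'.length → l.flatMap enc = l'.flatMap enc →
    l = l'
  | [], [], _, _ => rfl
  | [], _ :: _, h, _ => by simp at h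
  | _ :: _, [], h, _ => by simp at h
  | x :: l, x' :: l', h, he => by
    simp only [List.flatMap_cons] at he
    obtain ⟨h1, h2⟩ := List.append_inj he (by rw [length_enc, length_enc])
    rw [injective_enc h1, flatMap_inj (by simpa using h) h2]

theorem length_flatMap (l : List X) : (l.flatMap enc).length = l.length * width X := by
  induction l with
  | nil => simp
  | cons x l ih => simp [ih, length_enc, Nat.succ_mul, Nat.add_comm]

theorem flatMap_injective (hw : 0 < width X) {l l' : List X}
    (h : l.flatMap enc = l'.flatMap enc) : l = l' := by
  refine flatMap_inj ?_ h
  have := congrArg List.length h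
  rw [length_flatMap, length_flatMap] at this
  exact Nat.eq_of_mul_eq_mul_right hw this

instance : Enc ℕ where
  width := 1
  enc x := [x]
  length_enc _ := rfl
  injective_enc x y h := by simpa using h

instance : Enc (X × Y) where
  width := width X + width Y
  enc p := enc p.1 ++ enc p.2
  length_enc p := by simp [length_enc]
  injective_enc p q h := by
    obtain ⟨h1, h2⟩ := List.append_inj h (by rw [length_enc, length_enc])
    exact Prod.ext (injective_enc h1) (injective_enc h2)

/-- The leading word 0 or 1 tells the cases apart, and the padding of `none` keeps the width
constant. -/
instance : Enc (Option X) where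
  width := width X + 1
  enc o := match o with
    | none => List.replicate (width X + 1) 0
    | some x => 1 :: enc x
  length_enc o := by cases o <;> simp [length_enc]
  injective_enc o o' h := by
    cases o <;> cases o' <;> simp_all [List.replicate_succ]
    exact injective_enc h

instance {k : ℕ} : Enc (Fin k → X) where
  width := k * width X
  enc x := (List.ofFn x).flatMap enc
  length_enc x := by rw [length_flatMap, List.length_ofFn]
  injective_enc x y h := List.ofFn_injective (flatMap_inj (by simp) h)

theorem width_nat : width ℕ = 1 := rfl
theorem width_prod : width (X × Y) = width X + width Y := rfl
theorem width_option : width (Option X) = width X + 1 := rfl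
theorem width_pi {k : ℕ} : width (Fin k → X) = k * width X := rfl

theorem below_nat {W x : ℕ} : Below W x ↔ x < W := by simp [Below, enc]

theorem below_prod {W : ℕ} {p : X × Y} : Below W p ↔ Below W p.1 ∧ Below W p.2 := by
  simp [Below, enc, or_imp, forall_and]

theorem below_mk {W : ℕ} {x : X} {y : Y} : Below W (x, y) ↔ Below W x ∧ Below W y := below_prod

theorem below_option {W : ℕ} (hW : 1 < W) {o : Option X} :
    Below W o ↔ ∀ x, o = some x → Below W x := by
  cases o with
  | none => simp [Below, enc]; omega
  | some x => simp [Below, enc, hW]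

theorem below_pi {W k : ℕ} {x : Fin k → X} : Below W x ↔ ∀ i, Below W (x i) := by
  simp only [Below, enc, List.mem_flatMap, List.mem_ofFn]
  constructor
  · exact fun h i y hy => h y ⟨_, ⟨i, rfl⟩, hy⟩
  · rintro h y ⟨_, ⟨i, rfl⟩, hy⟩
    exact h i y hy

end Enc

/-! ### Reachability of configurations

`Ω` is the set of the admissible inputs. A configuration gives the memory contents of all machines
for every input. -/

namespace MPC

variable {Ω : Type*} {M S W : ℕ}

/-- In one round, with words smaller than `W` and at most `S` words of memory, the machines can
pass from `c` to `c'`: what a machine keeps and sends is determined by its memory. -/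
def Round (S W : ℕ) (c c' : Ω → Fin M → List ℕ) : Prop :=
  ∃ (kept : Ω → Fin M → List ℕ) (msg : Ω → Fin M → Fin M → List ℕ),
    (∀ ω ω' j, c ω j = c ω' j → kept ω j = kept ω' j ∧ msg ω j = msg ω' j) ∧
    (∀ ω j, c' ω j = kept ω j ++ (List.finRange M).flatMap fun k => msg ω k j) ∧
    (∀ ω j, ∑ k, (msg ω j k).length ≤ S) ∧
    ∀ ω j, (c' ω j).length ≤ S ∧ ∀ x ∈ c' ω j, x < W

/-- In `t` rounds the machines can pass from `c` to `c'`. -/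
def Reach (S W t : ℕ) (c c' : Ω → Fin M → List ℕ) : Prop :=
  ∃ d : ℕ → Ω → Fin M → List ℕ, d 0 = c ∧ d t = c' ∧ ∀ s < t, Round S W (d s) (d (s + 1))

theorem Reach.refl (c : Ω → Fin M → List ℕ) : Reach S W 0 c c := ⟨fun _ => c, rfl, rfl, by simp⟩

theorem Reach.trans {s t : ℕ} {c c' c'' : Ω → Fin M → List ℕ} (h : Reach S W s c c')
    (h' : Reach S W t c' c'') : Reach S W (s + t) c c'' := by
  obtain ⟨d, h0, hs, hd⟩ := h
  obtain ⟨e, h0', ht, he⟩ := h'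
  refine ⟨fun i => if i ≤ s then d i else e (i - s), by simpa using h0, ?_, fun i hi => ?_⟩
  · rcases Nat.eq_zero_or_pos t with rfl | h
    · simp [hs, ← ht, h0']
    · simp [ht, show ¬ s + t ≤ s by omega]
  · rcases lt_trichotomy i s with h | h | h
    · simpa [h.le, Nat.succ_le_of_lt h] using hd i h
    · subst h
      simpa [hs, ← h0'] using he 0 (by omega)
    · have : i + 1 - s = (i - s) + 1 := by omega
      simpa [show ¬ i ≤ s by omega, show ¬ i + 1 ≤ s by omega, this] using he (i - s) (by omega)

theorem Round.reach {c c' : Ω → Fin M → List ℕ} (h : Round S W c c') : Reach S W 1 c c' :=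
  ⟨fun i => if i = 0 then c else c', rfl, rfl, fun s hs => by
    obtain rfl : s = 0 := by omega
    exact h⟩

theorem Reach.iterate {ℓ : ℕ} {g : ℕ → Ω → Fin M → List ℕ}
    (k : ℕ) (h : ∀ i < k, Reach S W ℓ (g i) (g (i + 1))) : Reach S W (ℓ * k) (g 0) (g k) := by
  induction k with
  | zero => exact Reach.refl _
  | succ k ih => exact (ih fun i hi => h i (by omega)).trans (h k (by omega))

/-- A rule is only needed on memories that occur for some input; such an input is chosen, and the
choice is irrelevant because the data depend on the memory alone. -/
theorem Round.exists_step {c c' : Ω → Fin M → List ℕ} (h : Round S W c c') :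
    ∃ f : Fin M → List ℕ → List ℕ × (Fin M → List ℕ), ∀ ω j,
      c' ω j = (f j (c ω j)).1 ++ (List.finRange M).flatMap (fun k => (f k (c ω k)).2 j) ∧
      ∑ k, ((f j (c ω j)).2 k).length ≤ S := by
  classical
  obtain ⟨kept, msg, h1, h2, h3, -⟩ := h
  let f : Fin M → List ℕ → List ℕ × (Fin M → List ℕ) := fun j x =>
    if h : ∃ ω, c ω j = x then (kept h.choose j, msg h.choose j) else ([], fun _ => [])
  have hf : ∀ ω j, f j (c ω j) = (kept ω j, msg ω j) := by
    intro ω j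
    have h : ∃ ω', c ω' j = c ω j := ⟨ω, rfl⟩
    obtain ⟨e1, e2⟩ := h1 _ _ j h.choose_spec
    simp only [f, dif_pos h, e1, e2]
  refine ⟨f, fun ω j => ⟨?_, ?_⟩⟩
  · simp only [hf]; exact h2 ω j
  · simp only [hf]; exact h3 ω j

/-- Passes from configurations, which speak of all inputs at once, to one program for all inputs.
Each phase takes the same number `ℓ` of rounds, so that the schedule is `i ↦ ℓ * i`. -/
theorem exists_program {ℓ k : ℕ} {g : ℕ → Ω → Fin M → List ℕ}
    (h : ∀ i < k, Reach S W ℓ (g i) (g (i + 1)))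
    (h0 : ∀ ω j, (g 0 ω j).length ≤ S ∧ ∀ x ∈ g 0 ω j, x < W) :
    ∃ P : MPCProgram M, ∀ ω, P.RespectsSpace (g 0 ω) (ℓ * k) S W ∧
      ∀ i ≤ k, P.run (g 0 ω) (ℓ * i) = g i ω := by
  have hseq : ∃ d : ℕ → Ω → Fin M → List ℕ, (∀ i ≤ k, d (ℓ * i) = g i) ∧
      ∀ t < ℓ * k, Round S W (d t) (d (t + 1)) := by
    clear h0
    induction k with
    | zero =>
      refine ⟨fun _ => g 0, fun i hi => ?_, by simp⟩
      obtain rfl : i = 0 := by omega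
      rfl
    -- The sequence for the last phase is glued on at time `ℓ * k`, where both sequences are in the
    -- configuration `g k`.
    | succ k ih =>
      obtain ⟨d, hd, hd'⟩ := ih fun i hi => h i (by omega)
      obtain ⟨e, he0, he1, he⟩ := h k (by omega)
      have hk : d (ℓ * k) = e 0 := by rw [hd k le_rfl, he0]
      refine ⟨fun i => if i ≤ ℓ * k then d i else e (i - ℓ * k), fun i hi => ?_, fun t ht => ?_⟩
      · rcases Nat.lt_or_ge k i with h | h
        · obtain rfl : i = k + 1 := by omega
          rcases Nat.eq_zero_or_pos ℓ with rfl | hl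
          · simp only [zero_mul, le_refl, if_true] at hk ⊢
            rw [hk, ← he1]
          · have : ¬ ℓ * (k + 1) ≤ ℓ * k := by rw [mul_add]; omega
            beta_reduce
            rw [if_neg this, mul_add, mul_one, Nat.add_sub_cancel_left, he1]
        · simp only [Nat.mul_le_mul_left ℓ h, if_true, hd i h]
      · rw [mul_add, mul_one] at ht
        rcases lt_trichotomy t (ℓ * k) with h | h | h
        · simpa [h.le, Nat.succ_le_of_lt h] using hd' t h
        · subst h
          simpa [hk] using he 0 (by omega)
        · have : t + 1 - ℓ * k = (t - ℓ * k) + 1 := by omega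
          simpa [show ¬ t ≤ ℓ * k by omega, show ¬ t + 1 ≤ ℓ * k by omega, this] using
            he (t - ℓ * k) (by omega)
  obtain ⟨d, hd, hR⟩ := hseq
  have hd0 : d 0 = g 0 := by simpa using hd 0 (Nat.zero_le k)
  choose! f hf using fun t (ht : t < ℓ * k) => (hR t ht).exists_step
  let P : MPCProgram M := ⟨fun t => f t⟩
  have hrun : ∀ ω, ∀ t ≤ ℓ * k, P.run (g 0 ω) t = d t ω := by
    intro ω t
    induction t with
    | zero => intro _; rw [hd0]; rfl
    | succ t ih =>
      intro ht
      have ih := ih (by omega)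
      funext j
      rw [(hf t (by omega) ω j).1, MPCProgram.run, ih]
  refine ⟨P, fun ω => ⟨⟨fun t ht j => ?_, fun t ht j => ?_⟩, fun i hi => ?_⟩⟩
  · rw [hrun ω t ht]
    cases t with
    | zero => rw [hd0]; exact h0 ω j
    | succ t =>
      obtain ⟨_, _, _, _, _, h4⟩ := hR t (by omega)
      exact h4 ω j
  · rw [hrun ω t ht.le]
    exact (hf t ht ω j).2
  · rw [hrun ω _ (Nat.mul_le_mul_left ℓ hi), hd i hi]

/-! ### Messages with senders -/

/-- A message preceded by its sender and its length; nothing for an empty message. -/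
def tag (k : ℕ) (m : List ℕ) : List ℕ := if m = [] then [] else k :: m.length :: m

theorem exists_mem_of_flatMap_tag_eq_cons {ks : List (Fin M)} {m : Fin M → List ℕ} {y : ℕ}
    {l : List ℕ} (h : ks.flatMap (fun k : Fin M => tag k (m k)) = y :: l) : ∃ k ∈ ks, (k : ℕ) = y := by
  induction ks with
  | nil => simp at h
  | cons k ks ih =>
    rw [List.flatMap_cons] at h
    by_cases hk : m k = []
    · rw [tag, if_pos hk, List.nil_append] at h
      obtain ⟨k', h1, h2⟩ := ih h
      exact ⟨k', List.mem_cons_of_mem _ h1, h2⟩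
    · rw [tag, if_neg hk, List.cons_append, List.cons.injEq] at h
      exact ⟨k, List.mem_cons_self, h.1⟩

/-- The lengths delimit the messages. An empty message leaves no trace, but since no sender occurs
twice, the sender names show which messages are missing. -/
theorem eq_of_flatMap_tag_eq {ks : List (Fin M)} (hks : ks.Nodup) {m m' : Fin M → List ℕ}
    (h : ks.flatMap (fun k : Fin M => tag k (m k)) = ks.flatMap (fun k : Fin M => tag k (m' k))) :
    ∀ k ∈ ks, m k = m' k := by
  induction ks with
  | nil => simp
  | cons k ks ih =>
    rw [List.nodup_cons] at hks
    rw [List.flatMap_cons, List.flatMap_cons] at h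
    have main : m k = m' k ∧ ks.flatMap (fun k : Fin M => tag k (m k)) =
        ks.flatMap (fun k : Fin M => tag k (m' k)) := by
      by_cases h1 : m k = [] <;> by_cases h2 : m' k = []
      · rw [tag, tag, if_pos h1, if_pos h2] at h
        exact ⟨h1.trans h2.symm, h⟩
      · rw [tag, tag, if_pos h1, if_neg h2, List.nil_append, List.cons_append] at h
        obtain ⟨k', hk', he⟩ := exists_mem_of_flatMap_tag_eq_cons h
        exact absurd (Fin.ext he ▸ hk') hks.1
      · rw [tag, tag, if_neg h1, if_pos h2, List.nil_append, List.cons_append] at h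
        obtain ⟨k', hk', he⟩ := exists_mem_of_flatMap_tag_eq_cons h.symm
        exact absurd (Fin.ext he ▸ hk') hks.1
      · rw [tag, tag, if_neg h1, if_neg h2] at h
        simp only [List.cons_append, List.cons.injEq, true_and] at h
        exact List.append_inj h.2 h.1
    intro k' hk'
    rcases List.mem_cons.1 hk' with rfl | hk'
    · exact main.1
    · exact ih hks.2 main.2 k' hk'

/-- A nonempty message has at least one word, so two extra words at most triple it. -/
theorem length_tag_le {k : ℕ} {m : List ℕ} : (tag k m).length ≤ 3 * m.length := by
  unfold tag
  split_ifs with h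
  · simp
  · have := List.length_pos_iff.2 h
    simp; omega

open Enc

/-- The configuration in which every machine holds the encoding of its state. -/
def mem {X : Type} [Enc X] (x : Ω → Fin M → X) : Ω → Fin M → List ℕ := fun ω j => enc (x ω j)

/-- Every machine sends messages and computes its next state from its state and from the messages
received, whose senders it knows. -/
theorem reach_exchange {X X' : Type} [Enc X] [Enc X'] {x : Ω → Fin M → X} {x' : Ω → Fin M → X'}
    (msg : Ω → Fin M → Fin M → List ℕ) (c : ℕ)
    (hmsg : ∀ ω ω' k, x ω k = x ω' k → msg ω k = msg ω' k)
    (hx' : ∀ ω ω' j, x ω j = x ω' j → (∀ k, msg ω k j = msg ω' k j) → x' ω j = x' ω' j)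
    (hin : ∀ ω j, ∑ k : Fin M, (tag k (msg ω k j)).length ≤ c)
    (hout : ∀ ω (k : Fin M), ∑ j, (tag k (msg ω k j)).length ≤ c)
    (hS : width X + c ≤ S) (hS' : width X' ≤ S) (hM : M ≤ W) (hSW : S < W)
    (hb : ∀ ω j, Below W (x ω j)) (hb' : ∀ ω j, Below W (x' ω j))
    (hmb : ∀ ω k j, ∀ y ∈ msg ω k j, y < W) : Reach S W 2 (mem x) (mem x') := by
  let c1 : Ω → Fin M → List ℕ := fun ω j =>
    enc (x ω j) ++ (List.finRange M).flatMap fun k : Fin M => tag k (msg ω k j)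
  have hlen : ∀ ω j, ((List.finRange M).flatMap fun k : Fin M => tag k (msg ω k j)).length =
      ∑ k : Fin M, (tag k (msg ω k j)).length := by
    intro ω j
    rw [List.length_flatMap, ← List.ofFn_eq_map, List.sum_ofFn]
  have hc1 : ∀ ω j, (c1 ω j).length ≤ S := fun ω j => by
    simp only [c1, List.length_append, length_enc, hlen]
    exact (Nat.add_le_add_left (hin ω j) _).trans hS
  have h1 : Round S W (mem x) c1 := by
    refine ⟨fun ω j => enc (x ω j), fun ω k j => tag k (msg ω k j), fun ω ω' j h => ?_,
      fun ω j => rfl, fun ω j => (hout ω j).trans (by omega), fun ω j => ⟨hc1 ω j, ?_⟩⟩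
    · have := injective_enc h
      beta_reduce
      rw [this, hmsg ω ω' j this]
      exact ⟨rfl, rfl⟩
    · intro y hy
      simp only [c1, List.mem_append, List.mem_flatMap, List.mem_finRange, true_and] at hy
      rcases hy with hy | ⟨k, hy⟩
      · exact hb ω j y hy
      · have hl : (tag k (msg ω k j)).length ≤ S :=
          (Finset.single_le_sum (f := fun k : Fin M => (tag k (msg ω k j)).length)
            (fun _ _ => Nat.zero_le _) (Finset.mem_univ k)).trans ((hin ω j).trans (by omega))
        unfold tag at hy hl
        split_ifs at hy hl
        · simp at hy
        · simp only [List.length_cons] at hl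
          rcases List.mem_cons.1 hy with rfl | hy
          · exact k.2.trans_le hM
          rcases List.mem_cons.1 hy with rfl | hy
          · omega
          · exact hmb ω k j y hy
  -- The second round is local: the messages are decoded and replaced by the new state.
  have h2 : Round S W c1 (mem x') := by
    refine ⟨mem x', fun _ _ _ => [], fun ω ω' j h => ⟨?_, rfl⟩, fun ω j => by simp, by simp,
      fun ω j => ⟨?_, hb' ω j⟩⟩
    · obtain ⟨e1, e2⟩ := List.append_inj h (by rw [length_enc, length_enc])
      have := hx' ω ω' j (injective_enc e1) fun k =>
        eq_of_flatMap_tag_eq (List.nodup_finRange M) e2 k (List.mem_finRange k)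
      simp only [mem, this]
    · simpa [mem, length_enc] using hS'
  exact h1.reach.trans h2.reach

/-- Local computation. -/
theorem reach_local {X X' : Type} [Enc X] [Enc X'] {x : Ω → Fin M → X} {x' : Ω → Fin M → X'}
    (hx' : ∀ ω ω' j, x ω j = x ω' j → x' ω j = x' ω' j) (hS' : width X' ≤ S)
    (hb' : ∀ ω j, Below W (x' ω j)) : Reach S W 1 (mem x) (mem x') := by
  refine Round.reach ⟨mem x', fun _ _ _ => [], fun ω ω' j h => ⟨?_, rfl⟩, fun ω j => by simp,
    by simp, fun ω j => ⟨?_, hb' ω j⟩⟩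
  · simp only [mem, hx' ω ω' j (injective_enc h)]
  · simpa [mem, length_enc] using hS'

end MPC

/-! ### Distributed arrays and scans -/

namespace MPC

open Enc

/-- The parameters of the simulation of distributed arrays: `M` machines with `f * f` array cells
each, where aggregates are computed along a tree of degree `f` and of depth `D`. -/
structure Params (M f D S W : ℕ) : Prop where
  two_le : 2 ≤ f
  machines_le : M ≤ f ^ D
  space : 100 * (f * f) ≤ S
  space_lt : S < W
  cells_lt : M * (f * f) < W

variable {Ω : Type*} {M f D S W : ℕ} {R R' X Z : Type}

/-- The aggregate `H` over intervals of cells can be computed from the aggregates of the parts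
of a subdivision. -/
structure Aggregate (N : ℕ) (a : Ω → ℕ → R) (H : Ω → ℕ → ℕ → X) : Prop where
  append : ∀ ω ω' lo mid hi, lo ≤ mid → mid ≤ hi → hi ≤ N → H ω lo mid = H ω' lo mid →
    H ω mid hi = H ω' mid hi → H ω lo hi = H ω' lo hi
  empty : ∀ ω ω' p, H ω p p = H ω' p p
  single : ∀ ω ω' p, p < N → a ω p = a ω' p → H ω p (p + 1) = H ω' p (p + 1)

theorem Aggregate.interval {N : ℕ} {H : Ω → ℕ → ℕ → X} {a : Ω → ℕ → R} (hH : Aggregate N a H) {ω ω' : Ω} {lo : ℕ} :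
    ∀ k, lo + k ≤ N → (∀ i < k, a ω (lo + i) = a ω' (lo + i)) → H ω lo (lo + k) = H ω' lo (lo + k)
  | 0, _, _ => hH.empty _ _ _
  | k + 1, h, he => hH.append _ _ lo (lo + k) _ (by omega) (by omega) h
      (hH.interval k (by omega) fun i hi => he i (by omega))
      (hH.single _ _ _ (by omega) (he k (by omega)))

variable [Enc R] [Enc R'] [Enc X] [Enc Z]

theorem Params.machines_lt (hp : Params M f D S W) : M < W := by
  have h1 := hp.two_le
  have : M * 1 ≤ M * (f * f) := Nat.mul_le_mul_left _ (by nlinarith)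
  have := hp.cells_lt
  omega

theorem Params.four_le (hp : Params M f D S W) : 4 ≤ f * f := by
  have h1 := hp.two_le
  nlinarith

theorem Params.one_lt (hp : Params M f D S W) : 1 < W := by
  have := hp.four_le
  have := hp.space
  have := hp.space_lt
  omega

/-- The memory contents for an array `a` with `b` cells on each machine and one further word on
each machine. -/
def arr (M b : ℕ) (τ : Ω → Fin M → ℕ) (a : Ω → ℕ → R) : Ω → Fin M → List ℕ :=
  mem fun ω j => (τ ω j, fun i : Fin b => a ω (b * j + i))

theorem cell_lt {b : ℕ} (j : Fin M) (i : Fin b) : b * j + i < M * b := by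
  have : b * (j + 1) ≤ b * M := Nat.mul_le_mul_left _ j.2
  rw [mul_comm M b]
  have := i.2
  rw [mul_add] at *
  omega

theorem exists_cell {b p : ℕ} (h : p < M * b) : ∃ (j : Fin M) (i : Fin b), p = b * j + i := by
  have hb : 0 < b := Nat.pos_of_ne_zero (by rintro rfl; simp at h)
  refine ⟨⟨p / b, Nat.div_lt_of_lt_mul (by rwa [mul_comm])⟩, ⟨p % b, Nat.mod_lt _ hb⟩, ?_⟩
  exact (Nat.div_add_mod p b).symm

theorem below_block {b : ℕ} {τ : Ω → Fin M → ℕ} {a : Ω → ℕ → R} (hτ : ∀ ω j, τ ω j < W)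
    (ha : ∀ ω, ∀ p < M * b, Below W (a ω p)) (ω : Ω) (j : Fin M) :
    Below W (τ ω j, fun i : Fin b => a ω (b * j + i)) :=
  below_mk.2 ⟨below_nat.2 (hτ ω j), below_pi.2 fun i => ha ω _ (cell_lt j i)⟩

/-- A map over an array. -/
theorem reach_map (hp : Params M f D S W) {τ : Ω → Fin M → ℕ} {a : Ω → ℕ → R} {a' : Ω → ℕ → R'}
    (ha' : ∀ ω ω' p, p < M * (f * f) → a ω p = a ω' p → a' ω p = a' ω' p)
    (hR' : width R' ≤ 49) (hτ : ∀ ω j, τ ω j < W)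
    (hb' : ∀ ω, ∀ p < M * (f * f), Below W (a' ω p)) :
    Reach S W 1 (arr M (f * f) τ a) (arr M (f * f) τ a') := by
  refine reach_local (fun ω ω' j h => ?_) ?_ (below_block hτ hb')
  · rw [Prod.mk.injEq] at h ⊢
    exact ⟨h.1, funext fun i => ha' _ _ _ (cell_lt j i) (congrFun h.2 i)⟩
  · have h1 := hp.space
    have h2 := hp.four_le
    rw [width_prod, width_nat, width_pi]
    have : f * f * width R' ≤ f * f * 49 := Nat.mul_le_mul_left _ hR'
    omega

/-- Machines `k` and `j` exchange messages if their distance is a small multiple of `d`. -/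
def Linked (f d k j : ℕ) : Prop := ∃ t, 0 < t ∧ t < f ∧ (k + t * d = j ∨ j + t * d = k)

theorem Linked.symm {f d k j : ℕ} (h : Linked f d k j) : Linked f d j k := by
  obtain ⟨t, h1, h2, h3⟩ := h
  exact ⟨t, h1, h2, h3.symm⟩

/-- A machine has at most `2f` partners, namely `j ± t * d` with `t < f`. This is why aggregates of
`O(f)` words can be exchanged within memory `O(f²)`. -/
theorem sum_tag_le_of_linked {d c : ℕ} {j : ℕ} {m : Fin M → List ℕ} (s : Fin M → ℕ)
    (hm : ∀ k : Fin M, m k ≠ [] → Linked f d k j) (hc : ∀ k, (m k).length ≤ c) :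
    ∑ k, (tag (s k) (m k)).length ≤ 2 * f * (c + 2) := by
  classical
  let F : Finset (Fin M) := Finset.univ.filter fun k => m k ≠ []
  have hF : F.card ≤ 2 * f := by
    have hsub : F.image (fun k : Fin M => (k : ℕ)) ⊆
        (Finset.range f).image (fun t => j - t * d) ∪ (Finset.range f).image (fun t => j + t * d) := by
      intro x hx
      simp only [F, Finset.mem_image, Finset.mem_filter, Finset.mem_univ, true_and] at hx
      obtain ⟨k, hk, rfl⟩ := hx
      obtain ⟨t, -, h2, h3⟩ := hm k hk
      simp only [Finset.mem_union, Finset.mem_image, Finset.mem_range]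
      rcases h3 with h3 | h3
      · exact Or.inl ⟨t, h2, by omega⟩
      · exact Or.inr ⟨t, h2, h3⟩
    have h1 := Finset.card_le_card hsub
    rw [Finset.card_image_of_injective _ Fin.val_injective] at h1
    have h2 := Finset.card_union_le ((Finset.range f).image (fun t => j - t * d))
      ((Finset.range f).image (fun t => j + t * d))
    have h3 := Finset.card_image_le (s := Finset.range f) (f := fun t => j - t * d)
    have h4 := Finset.card_image_le (s := Finset.range f) (f := fun t => j + t * d)
    rw [Finset.card_range] at h3 h4
    omega
  rw [← Finset.sum_subset (Finset.subset_univ F)]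
  · calc ∑ k ∈ F, (tag (s k) (m k)).length ≤ ∑ _k ∈ F, (c + 2) := by
          refine Finset.sum_le_sum fun k _ => ?_
          have := hc k
          unfold tag
          split_ifs
          · simp
          · simp only [List.length_cons]; omega
      _ = F.card * (c + 2) := by simp
      _ ≤ _ := Nat.mul_le_mul_right _ hF
  · intro k _ hk
    simp only [F, Finset.mem_filter, Finset.mem_univ, true_and, not_not] at hk
    simp [hk, tag]

section Scan

variable {H : Ω → ℕ → ℕ → X}

variable (M f) in
/-- The state of a machine during a scan: its cells and the aggregates over the blocks of the
`f ^ s` machines that end and that begin with its own one. -/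
def scanState (τ : Ω → Fin M → ℕ) (a : Ω → ℕ → R) (H : Ω → ℕ → ℕ → X) (s : ℕ) (ω : Ω)
    (j : Fin M) : (ℕ × (Fin (f * f) → R)) × X × X :=
  ((τ ω j, fun i : Fin (f * f) => a ω (f * f * j + i)),
    H ω (f * f * (j + 1 - f ^ s)) (f * f * (j + 1)), H ω (f * f * j) (f * f * min M (j + f ^ s)))

theorem below_scanState {τ : Ω → Fin M → ℕ} {a : Ω → ℕ → R} (hτ : ∀ ω j, τ ω j < W)
    (hb : ∀ ω, ∀ p < M * (f * f), Below W (a ω p))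
    (hHb : ∀ ω lo hi, lo ≤ hi → hi ≤ M * (f * f) → Below W (H ω lo hi)) (s : ℕ) (ω : Ω)
    (j : Fin M) : Below W (scanState M f τ a H s ω j) := by
  refine below_mk.2 ⟨below_block hτ hb ω j, below_mk.2 ⟨hHb _ _ _ ?_ ?_, hHb _ _ _ ?_ ?_⟩⟩
  · exact Nat.mul_le_mul_left _ (by omega)
  · rw [mul_comm M]; exact Nat.mul_le_mul_left _ j.2
  · exact Nat.mul_le_mul_left _ (by have := j.2; omega)
  · rw [mul_comm M]; exact Nat.mul_le_mul_left _ (by omega)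

theorem width_scanState_le (hp : Params M f D S W) (hX : width X ≤ 8 * f) (hR : width R ≤ 32) :
    width ((ℕ × (Fin (f * f) → R)) × X × X) ≤ 41 * (f * f) := by
  have h1 := hp.two_le
  have h2 := hp.four_le
  rw [width_prod, width_prod, width_prod, width_nat, width_pi]
  have h3 : f * f * width R ≤ f * f * 32 := Nat.mul_le_mul_left _ hR
  have h4 : 16 * f ≤ 8 * (f * f) := by nlinarith
  omega

theorem reach_scan_start (hp : Params M f D S W) {τ : Ω → Fin M → ℕ} {a : Ω → ℕ → R}
    (hH : Aggregate (M * (f * f)) a H) (hX : width X ≤ 8 * f) (hR : width R ≤ 32)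
    (hτ : ∀ ω j, τ ω j < W) (hb : ∀ ω, ∀ p < M * (f * f), Below W (a ω p))
    (hHb : ∀ ω lo hi, lo ≤ hi → hi ≤ M * (f * f) → Below W (H ω lo hi)) :
    Reach S W 1 (arr M (f * f) τ a) (mem (scanState M f τ a H 0)) := by
  refine reach_local (fun ω ω' j h => ?_) ?_ (below_scanState hτ hb hHb 0)
  · have h2 := h
    rw [Prod.mk.injEq] at h2
    have hN : f * f * j + f * f ≤ M * (f * f) := by
      rw [mul_comm M]; exact Nat.mul_le_mul_left (f * f) (Nat.succ_le_of_lt j.2)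
    have e := hH.interval (ω := ω) (ω' := ω') (lo := f * f * j) (f * f) hN
      fun i hi => congrFun h2.2 ⟨i, hi⟩
    have hm : min M ((j : ℕ) + 1) = j + 1 := by have := j.2; omega
    simp only [scanState, pow_zero, Nat.add_sub_cancel, hm, Prod.mk.injEq, mul_add, mul_one, e,
      and_true]
    exact h2
  · have := width_scanState_le (X := X) (R := R) hp hX hR
    have := hp.space
    omega

/-- A window of `f^(s+1)` machines consists of `f` windows of `f^s` machines, held by machines at
distances that are multiples of `f^s`. Windows ending at a machine travel to the right, windows
beginning there travel to the left. -/
theorem reach_scan_step (hp : Params M f D S W) {τ : Ω → Fin M → ℕ} {a : Ω → ℕ → R}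
    (hH : Aggregate (M * (f * f)) a H) (hX : width X ≤ 8 * f) (hR : width R ≤ 32)
    (hτ : ∀ ω j, τ ω j < W) (hb : ∀ ω, ∀ p < M * (f * f), Below W (a ω p))
    (hHb : ∀ ω lo hi, lo ≤ hi → hi ≤ M * (f * f) → Below W (H ω lo hi)) (s : ℕ) :
    Reach S W 2 (mem (scanState M f τ a H s)) (mem (scanState M f τ a H (s + 1))) := by
  classical
  have hw := width_scanState_le (X := X) (R := R) hp hX hR
  have hsp := hp.space
  have hf := hp.two_le
  have hd : 0 < f ^ s := by positivity
  set d := f ^ s with hd'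
  let msg : Ω → Fin M → Fin M → List ℕ := fun ω k j => if Linked f d k j then
    if k < j then enc (scanState M f τ a H s ω k).2.1 else enc (scanState M f τ a H s ω k).2.2
    else []
  have hlen : ∀ ω k j, (msg ω k j).length ≤ 8 * f := by
    intro ω k j
    simp only [msg]
    split_ifs <;> simp [length_enc, hX]
  have hne : ∀ ω k j, msg ω k j ≠ [] → Linked f d k j := by
    intro ω k j h
    by_contra hc
    exact h (if_neg hc)
  -- At most `2f` messages of at most `8f` words, each with a tag of two words, and `4f ≤ 2f²`.
  have hcost : 2 * f * (8 * f + 2) ≤ 18 * (f * f) := by nlinarith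
  refine reach_exchange msg (18 * (f * f)) ?_ ?_ ?_ ?_ ?_ ?_ ?_ ?_ ?_ ?_ ?_
  · intro ω ω' k h
    funext j
    simp only [msg, h]
  · intro ω ω' j h hm
    have hblk : (scanState M f τ a H s ω j).1 = (scanState M f τ a H s ω' j).1 := by rw [h]
    have hA : ∀ k : Fin M, (k = j ∨ (Linked f d k j ∧ k < j)) →
        H ω (f * f * (k + 1 - d)) (f * f * (k + 1)) =
        H ω' (f * f * (k + 1 - d)) (f * f * (k + 1)) := by
      rintro k (rfl | ⟨hl, hk⟩)
      · exact congrArg (fun x => x.2.1) h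
      · have := hm k
        simp only [msg, hl, hk, if_true] at this
        exact injective_enc this
    have hB : ∀ k : Fin M, (k = j ∨ (Linked f d k j ∧ ¬ k < j)) →
        H ω (f * f * k) (f * f * min M (k + d)) = H ω' (f * f * k) (f * f * min M (k + d)) := by
      rintro k (rfl | ⟨hl, hk⟩)
      · exact congrArg (fun x => x.2.2) h
      · have := hm k
        simp only [msg, hl, hk, if_true, if_false] at this
        exact injective_enc this
    have hAt : ∀ t ≤ f, H ω (f * f * (j + 1 - t * d)) (f * f * (j + 1)) =
        H ω' (f * f * (j + 1 - t * d)) (f * f * (j + 1)) := by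
      intro t
      induction t with
      | zero => intro _; simpa using hH.empty _ _ _
      | succ t ih =>
        intro ht
        have ih := ih (by omega)
        have e1 : (t + 1) * d = t * d + d := by ring
        rw [e1]
        -- If `t * d > j`, the window already reaches the first cell; truncated subtraction then
        -- keeps its left end at 0 and there is nothing to add.
        rcases Nat.lt_or_ge j (t * d) with hlt | hge
        · have h1 : (j : ℕ) + 1 - (t * d + d) = 0 := by omega
          have h2 : (j : ℕ) + 1 - t * d = 0 := by omega
          rw [h1]; rwa [h2] at ih
        · have hj := j.2
          have hk := hA ⟨j - t * d, by omega⟩ (by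
            rcases Nat.eq_zero_or_pos t with rfl | ht0
            · left; ext; simp
            · right
              have : 0 < t * d := Nat.mul_pos ht0 hd
              exact ⟨⟨t, ht0, by omega, Or.inl (Nat.sub_add_cancel hge)⟩, by
                rw [Fin.lt_def]; simp only; omega⟩)
          have h1 : (j : ℕ) - t * d + 1 = j + 1 - t * d := by omega
          have h2 : (j : ℕ) + 1 - t * d - d = j + 1 - (t * d + d) := by omega
          simp only [h1, h2] at hk
          refine hH.append _ _ _ _ _ ?_ ?_ ?_ hk ih
          · exact Nat.mul_le_mul_left _ (by omega)
          · exact Nat.mul_le_mul_left _ (by omega)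
          · rw [mul_comm M]; exact Nat.mul_le_mul_left _ hj
    have hBt : ∀ t ≤ f, H ω (f * f * j) (f * f * min M (j + t * d)) =
        H ω' (f * f * j) (f * f * min M (j + t * d)) := by
      intro t
      induction t with
      | zero =>
        intro _
        have : min M ((j : ℕ) + 0 * d) = j := by have := j.2; omega
        rw [this]; exact hH.empty _ _ _
      | succ t ih =>
        intro ht
        have ih := ih (by omega)
        have e1 : (t + 1) * d = t * d + d := by ring
        rw [e1]
        rcases Nat.lt_or_ge (j + t * d) M with hlt | hge
        · have hj := j.2
          have hk := hB ⟨j + t * d, hlt⟩ (by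
            rcases Nat.eq_zero_or_pos t with rfl | ht0
            · left; ext; simp
            · right
              exact ⟨⟨t, ht0, by omega, Or.inr rfl⟩, by rw [Fin.lt_def]; simp only; omega⟩)
          have h1 : min M ((j : ℕ) + t * d) = j + t * d := by omega
          rw [h1] at ih
          simp only [add_assoc] at hk ⊢
          refine hH.append _ _ _ _ _ ?_ ?_ ?_ ih hk
          · exact Nat.mul_le_mul_left _ (by omega)
          · exact Nat.mul_le_mul_left _ (by omega)
          · rw [mul_comm M]; exact Nat.mul_le_mul_left _ (by omega)
        · have h1 : min M ((j : ℕ) + (t * d + d)) = M := by omega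
          have h2 : min M ((j : ℕ) + t * d) = M := by omega
          rw [h1]; rwa [h2] at ih
    have e : f ^ (s + 1) = f * d := by rw [pow_succ, mul_comm]
    refine Prod.ext hblk (Prod.ext ?_ ?_)
    · simp only [scanState, e]; exact hAt f le_rfl
    · simp only [scanState, e]; exact hBt f le_rfl
  · intro ω j
    exact (sum_tag_le_of_linked (m := fun k => msg ω k j) (fun k => (k : ℕ))
      (fun k => hne ω k j) fun k => hlen ω k j).trans hcost
  · intro ω k
    exact (sum_tag_le_of_linked (m := fun j => msg ω k j) (fun _ => (k : ℕ))
      (fun j h => (hne ω k j h).symm) fun j => hlen ω k j).trans hcost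
  · omega
  · omega
  · exact hp.machines_lt.le
  · exact hp.space_lt
  · exact below_scanState hτ hb hHb s
  · exact below_scanState hτ hb hHb (s + 1)
  · intro ω k j
    have h := below_scanState (f := f) hτ hb hHb s ω k
    have h2 := (below_prod.1 (below_prod.1 h).2)
    simp only [msg]
    split_ifs
    · exact h2.1
    · exact h2.2
    · simp

/-- As `M ≤ f^D`, the windows now extend to the ends of the array. The windows of the two
neighbouring machines give the aggregates strictly before and strictly after the own block, and the
rest is computed from the own cells. -/
theorem reach_scan_finish (hp : Params M f D S W) {τ : Ω → Fin M → ℕ} {a : Ω → ℕ → R}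
    {a' : Ω → ℕ → R'} (hH : Aggregate (M * (f * f)) a H)
    (ha' : ∀ ω ω' p, p < M * (f * f) → a ω p = a ω' p → H ω 0 p = H ω' 0 p →
      H ω (p + 1) (M * (f * f)) = H ω' (p + 1) (M * (f * f)) → a' ω p = a' ω' p)
    (hX : width X ≤ 8 * f) (hR : width R ≤ 32) (hR' : width R' ≤ 49)
    (hτ : ∀ ω j, τ ω j < W) (hb : ∀ ω, ∀ p < M * (f * f), Below W (a ω p))
    (hb' : ∀ ω, ∀ p < M * (f * f), Below W (a' ω p))
    (hHb : ∀ ω lo hi, lo ≤ hi → hi ≤ M * (f * f) → Below W (H ω lo hi)) :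
    Reach S W 2 (mem (scanState M f τ a H D)) (arr M (f * f) τ a') := by
  classical
  have hw := width_scanState_le (X := X) (R := R) hp hX hR
  have hsp := hp.space
  have hf := hp.two_le
  have hMD := hp.machines_le
  let msg : Ω → Fin M → Fin M → List ℕ := fun ω k j =>
    if (k : ℕ) + 1 = j then enc (scanState M f τ a H D ω k).2.1
    else if (j : ℕ) + 1 = k then enc (scanState M f τ a H D ω k).2.2 else []
  have hlen : ∀ ω k j, (msg ω k j).length ≤ 8 * f := by
    intro ω k j
    simp only [msg]
    split_ifs <;> simp [length_enc, hX]
  have hne : ∀ ω k j, msg ω k j ≠ [] → Linked f 1 k j := by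
    intro ω k j h
    simp only [msg] at h
    split_ifs at h with h1 h2
    · exact ⟨1, by omega, by omega, by omega⟩
    · exact ⟨1, by omega, by omega, by omega⟩
    · exact absurd rfl h
  have hcost : 2 * f * (8 * f + 2) ≤ 18 * (f * f) := by nlinarith
  refine reach_exchange msg (18 * (f * f)) ?_ ?_ ?_ ?_ ?_ ?_ ?_ ?_ ?_ ?_ ?_
  · intro ω ω' k h
    funext j
    simp only [msg, h]
  · intro ω ω' j h hm
    have h0 : (scanState M f τ a H D ω j).1 = (scanState M f τ a H D ω' j).1 := by rw [h]
    have hj := j.2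
    have hN : f * f * j + f * f ≤ M * (f * f) := by
      rw [mul_comm M]; exact Nat.mul_le_mul_left (f * f) (Nat.succ_le_of_lt j.2)
    have hcell : ∀ i : Fin (f * f), a ω (f * f * j + i) = a ω' (f * f * j + i) := fun i =>
      congrFun (congrArg Prod.snd h0) i
    have hpre : H ω 0 (f * f * j) = H ω' 0 (f * f * j) := by
      rcases Nat.eq_zero_or_pos j with hz | hpos
      · rw [hz]; exact hH.empty _ _ _
      · have h1 := hm ⟨j - 1, by omega⟩
        have e1 : (j : ℕ) - 1 + 1 = j := by omega
        simp only [msg, e1, if_true] at h1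
        have h2 := injective_enc h1
        have e2 : (j : ℕ) - f ^ D = 0 := by omega
        simpa only [scanState, e1, e2, mul_zero] using h2
    have hsuf : H ω (f * f * (j + 1)) (M * (f * f)) = H ω' (f * f * (j + 1)) (M * (f * f)) := by
      rcases Nat.lt_or_ge (j + 1) M with hlt | hge
      · have h1 := hm ⟨j + 1, hlt⟩
        have e1 : ¬ ((j : ℕ) + 1 + 1 = j) := by omega
        simp only [msg, e1, if_true, if_false] at h1
        have h2 := injective_enc h1
        have e2 : min M ((j : ℕ) + 1 + f ^ D) = M := by omega
        simpa only [scanState, e2, mul_comm (f * f) M] using h2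
      · have e1 : (j : ℕ) + 1 = M := by omega
        rw [e1, mul_comm M]; exact hH.empty _ _ _
    have hτj : τ ω j = τ ω' j := congrArg Prod.fst h0
    refine Prod.ext hτj (funext fun i => ?_)
    have hi := i.2
    refine ha' _ _ _ (cell_lt j i) (hcell i) ?_ ?_
    · exact hH.append _ _ 0 (f * f * j) _ (Nat.zero_le _) (by omega) (by omega) hpre
        (hH.interval (i : ℕ) (by omega) fun i' hi' => hcell ⟨i', by omega⟩)
    · have h1 : H ω (f * f * j + i + 1) (f * f * j + i + 1 + (f * f - 1 - i)) =
          H ω' (f * f * j + i + 1) (f * f * j + i + 1 + (f * f - 1 - i)) := by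
        refine hH.interval _ (by omega) fun i' hi' => ?_
        have := hcell ⟨i + 1 + i', by omega⟩
        simpa only [← add_assoc] using this
      have e1 : f * f * j + i + 1 + (f * f - 1 - i) = f * f * (j + 1) := by
        rw [mul_add, mul_one]; omega
      rw [e1] at h1
      refine hH.append _ _ _ (f * f * (j + 1)) _ ?_ ?_ le_rfl h1 hsuf
      · rw [mul_add]; omega
      · rw [mul_add]; omega
  · intro ω j
    exact (sum_tag_le_of_linked (m := fun k => msg ω k j) (fun k => (k : ℕ))
      (fun k => hne ω k j) fun k => hlen ω k j).trans hcost
  · intro ω k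
    exact (sum_tag_le_of_linked (m := fun j => msg ω k j) (fun _ => (k : ℕ))
      (fun j h => (hne ω k j h).symm) fun j => hlen ω k j).trans hcost
  · omega
  · rw [width_prod, width_nat, width_pi]
    have : f * f * width R' ≤ f * f * 49 := Nat.mul_le_mul_left _ hR'
    have := hp.four_le
    omega
  · exact hp.machines_lt.le
  · exact hp.space_lt
  · exact below_scanState hτ hb hHb D
  · exact below_block hτ hb'
  · intro ω k j
    have h := below_scanState (f := f) hτ hb hHb D ω k
    have h2 := (below_prod.1 (below_prod.1 h).2)
    simp only [msg]
    split_ifs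
    · exact h2.1
    · exact h2.2
    · simp

/-- Every cell learns the aggregates over the preceding and over the following cells. -/
theorem reach_scan (hp : Params M f D S W) {τ : Ω → Fin M → ℕ} {a : Ω → ℕ → R}
    {a' : Ω → ℕ → R'} (hH : Aggregate (M * (f * f)) a H)
    (ha' : ∀ ω ω' p, p < M * (f * f) → a ω p = a ω' p → H ω 0 p = H ω' 0 p →
      H ω (p + 1) (M * (f * f)) = H ω' (p + 1) (M * (f * f)) → a' ω p = a' ω' p)
    (hX : width X ≤ 8 * f) (hR : width R ≤ 32) (hR' : width R' ≤ 49)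
    (hτ : ∀ ω j, τ ω j < W) (hb : ∀ ω, ∀ p < M * (f * f), Below W (a ω p))
    (hb' : ∀ ω, ∀ p < M * (f * f), Below W (a' ω p))
    (hHb : ∀ ω lo hi, lo ≤ hi → hi ≤ M * (f * f) → Below W (H ω lo hi)) :
    Reach S W (2 * D + 3) (arr M (f * f) τ a) (arr M (f * f) τ a') := by
  have h1 := reach_scan_start hp hH hX hR hτ hb hHb
  have h2 := Reach.iterate (g := fun s => mem (scanState M f τ a H s)) D
    fun s _ => reach_scan_step hp hH hX hR hτ hb hHb s
  have h3 := reach_scan_finish hp hH ha' hX hR hR' hτ hb hb' hHb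
  have := (h1.trans h2).trans h3
  rwa [show 1 + 2 * D + 2 = 2 * D + 3 by ring] at this

end Scan

end MPC

/-! ### Routing items between cells -/

namespace MPC

open Enc

variable {Ω : Type*} {M f D S W : ℕ} {R Z : Type} [Enc R] [Enc Z]

theorem length_filterMap_eq_sum {A B : Type*} (g : A → Option B) (l : List A) :
    (l.filterMap g).length = (l.map fun x => if (g x).isSome then 1 else 0).sum := by
  induction l with
  | nil => rfl
  | cons x l ih =>
    rw [List.filterMap_cons, List.map_cons, List.sum_cons]
    cases h : g x <;> simp [ih, Nat.add_comm]

/-- The items that machine `k` sends to machine `j`. -/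
def itemsTo (b : ℕ) (item : ℕ → R → Option (ℕ × Z)) (a : Ω → ℕ → R) (ω : Ω) (k j : Fin M) :
    List (ℕ × Z) :=
  (List.finRange b).filterMap fun i : Fin b =>
    (item (b * k + i) (a ω (b * k + i))).filter fun x => decide (x.1 / b = j)

omit [Enc R] [Enc Z] in
theorem mem_itemsTo {b : ℕ} {item : ℕ → R → Option (ℕ × Z)} {a : Ω → ℕ → R} {ω : Ω} {k j : Fin M}
    {x : ℕ × Z} : x ∈ itemsTo b item a ω k j ↔
      x.1 / b = j ∧ ∃ i : Fin b, item (b * k + i) (a ω (b * k + i)) = some x := by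
  simp only [itemsTo, List.mem_filterMap, List.mem_finRange, true_and, Option.filter_eq_some_iff,
    decide_eq_true_eq]
  exact ⟨fun ⟨i, h1, h2⟩ => ⟨h2, i, h1⟩, fun ⟨h2, i, h1⟩ => ⟨i, h1, h2⟩⟩

omit [Enc R] [Enc Z] in
theorem length_itemsTo {b : ℕ} (item : ℕ → R → Option (ℕ × Z)) (a : Ω → ℕ → R) (ω : Ω)
    (k j : Fin M) : (itemsTo b item a ω k j).length = ∑ i : Fin b,
      if ((item (b * k + i) (a ω (b * k + i))).filter fun x => decide (x.1 / b = j)).isSome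
      then 1 else 0 := by
  rw [itemsTo, length_filterMap_eq_sum, ← List.ofFn_eq_map, List.sum_ofFn]

omit [Enc R] [Enc Z] in
theorem sum_length_itemsTo_right {b : ℕ} (item : ℕ → R → Option (ℕ × Z)) (a : Ω → ℕ → R) (ω : Ω)
    (k : Fin M) : ∑ j, (itemsTo b item a ω k j).length ≤ b := by
  simp only [length_itemsTo]
  rw [Finset.sum_comm]
  calc _ ≤ ∑ _i : Fin b, 1 := Finset.sum_le_sum fun i _ => ?_
    _ = b := by simp
  cases h : item (b * k + i) (a ω (b * k + i)) with
  | none => simp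
  | some x =>
    rw [Finset.sum_boole, Nat.cast_id, Finset.card_le_one]
    intro j hj j' hj'
    simp only [Option.filter_some, Finset.mem_filter, Finset.mem_univ, true_and] at hj hj'
    have e : x.1 / b = j := by by_contra hc; simp [hc] at hj
    have e' : x.1 / b = j' := by by_contra hc; simp [hc] at hj'
    exact Fin.ext (e.symm.trans e')

omit [Enc R] [Enc Z] in
-- The items arriving at a machine have distinct destinations among its `b` cells.
theorem sum_length_itemsTo_left {b : ℕ} {item : ℕ → R → Option (ℕ × Z)} {a : Ω → ℕ → R} {ω : Ω}
    (hinj : ∀ p p' q z z', p < M * b → p' < M * b → item p (a ω p) = some (q, z) →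
      item p' (a ω p') = some (q, z') → p = p') (j : Fin M) :
    ∑ k : Fin M, (itemsTo b item a ω k j).length ≤ b := by
  classical
  rcases Nat.eq_zero_or_pos b with rfl | hb
  · simp [length_itemsTo]
  simp only [length_itemsTo]
  rw [← Finset.sum_product', Finset.univ_product_univ, Finset.sum_boole, Nat.cast_id]
  have hdest : ∀ x : Fin M × Fin b, x ∈ Finset.univ.filter (fun x : Fin M × Fin b =>
      (((item (b * x.1 + x.2) (a ω (b * x.1 + x.2))).filter
        fun y => decide (y.1 / b = j)).isSome = true)) →
      ∃ q z, item (b * x.1 + x.2) (a ω (b * x.1 + x.2)) = some (q, z) ∧ q / b = j := by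
    intro x hx
    simp only [Finset.mem_filter, Finset.mem_univ, true_and, Option.isSome_iff_exists] at hx
    obtain ⟨⟨q, z⟩, h⟩ := hx
    rw [Option.filter_eq_some_iff] at h
    exact ⟨q, z, h.1, by simpa using h.2⟩
  choose! q z hq using hdest
  have h := Finset.card_le_card_of_injOn (s := Finset.univ.filter (fun x : Fin M × Fin b =>
      (((item (b * x.1 + x.2) (a ω (b * x.1 + x.2))).filter
        fun y => decide (y.1 / b = j)).isSome = true))) (t := Finset.Ico (b * j) (b * j + b)) q
      (fun x hx => ?_) (fun x hx x' hx' he => ?_)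
  · simpa using h
  · have := (hq x hx).2
    rw [Finset.mem_coe, Finset.mem_Ico, ← this]
    have := Nat.div_add_mod (q x) b
    have := Nat.mod_lt (q x) hb
    omega
  · have h1 := (hq x hx).1
    have h2 := (hq x' hx').1
    rw [← he] at h2
    have := hinj _ _ _ _ _ (cell_lt x.1 x.2) (cell_lt x'.1 x'.2) h1 h2
    have e1 : (x.1 : ℕ) = x'.1 := by
      have := congrArg (· / b) this
      simpa [Nat.mul_add_div hb, Nat.div_eq_of_lt] using this
    have e2 : (x.2 : ℕ) = x'.2 := by
      rw [e1] at this; omega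
    exact Prod.ext (Fin.ext e1) (Fin.ext e2)

/-- Every cell may send an item to another cell, at most one item being sent to each cell. -/
theorem exists_reach_route (hp : Params M f D S W) {τ : Ω → Fin M → ℕ} {a : Ω → ℕ → R}
    (item : ℕ → R → Option (ℕ × Z))
    (hdest : ∀ ω p q z, p < M * (f * f) → item p (a ω p) = some (q, z) → q < M * (f * f))
    (hinj : ∀ ω p p' q z z', p < M * (f * f) → p' < M * (f * f) → item p (a ω p) = some (q, z) →
      item p' (a ω p') = some (q, z') → p = p')
    (hR : width R ≤ 32) (hZ : width Z ≤ 16) (hτ : ∀ ω j, τ ω j < W)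
    (hb : ∀ ω, ∀ p < M * (f * f), Below W (a ω p))
    (hz : ∀ ω p q z, p < M * (f * f) → item p (a ω p) = some (q, z) → Below W z) :
    ∃ r : Ω → ℕ → Option Z,
      (∀ ω q z, r ω q = some z ↔ ∃ p < M * (f * f), item p (a ω p) = some (q, z)) ∧
      Reach S W 2 (arr M (f * f) τ a) (arr M (f * f) τ fun ω p => (a ω p, r ω p)) := by
  classical
  -- The received item is defined by choice; injectivity of the destinations makes it unique.
  let r : Ω → ℕ → Option Z := fun ω q =>
    if h : ∃ z, ∃ p < M * (f * f), item p (a ω p) = some (q, z) then some h.choose else none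
  have hr : ∀ ω q z, r ω q = some z ↔ ∃ p < M * (f * f), item p (a ω p) = some (q, z) := by
    intro ω q z
    constructor
    · intro h
      simp only [r] at h
      split_ifs at h with h'
      rw [Option.some.injEq] at h
      rw [← h]; exact h'.choose_spec
    · rintro ⟨p, hp1, hp2⟩
      have h' : ∃ z, ∃ p < M * (f * f), item p (a ω p) = some (q, z) := ⟨z, p, hp1, hp2⟩
      simp only [r, dif_pos h', Option.some.injEq]
      obtain ⟨p', h1, h2⟩ := h'.choose_spec
      have := hinj ω p p' _ _ _ hp1 h1 hp2 h2
      subst this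
      rw [hp2] at h2
      simpa using h2.symm
  refine ⟨r, hr, ?_⟩
  have hw : 0 < width (ℕ × Z) := by rw [width_prod, width_nat]; omega
  have hw' : width (ℕ × Z) ≤ 17 := by rw [width_prod, width_nat]; omega
  have hsp := hp.space
  have h4 := hp.four_le
  have hffpos : 0 < f * f := by omega
  -- An item has at most 17 words, and tagging at most triples a message. Together with the cells of
  -- at most 32 words and one further word this fits into `100 * (f * f)` words.
  have hcost : ∀ {k : ℕ} {l : List (ℕ × Z)}, (tag k (l.flatMap enc)).length ≤ 51 * l.length := by
    intro k l
    refine length_tag_le.trans ?_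
    rw [length_flatMap]
    nlinarith [Nat.mul_le_mul_left l.length hw']
  have hwR : f * f * width R ≤ f * f * 32 := Nat.mul_le_mul_left _ hR
  refine reach_exchange (fun ω k j => (itemsTo (f * f) item a ω k j).flatMap enc) (51 * (f * f))
    ?_ ?_ ?_ ?_ ?_ ?_ ?_ ?_ ?_ ?_ ?_
  · intro ω ω' k h
    have : ∀ i : Fin (f * f), a ω (f * f * k + i) = a ω' (f * f * k + i) := fun i =>
      congrFun (congrArg Prod.snd h) i
    funext j
    simp only [itemsTo, this]
  · intro ω ω' j h hm
    have hL : ∀ k, itemsTo (f * f) item a ω k j = itemsTo (f * f) item a ω' k j := fun k =>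
      flatMap_injective hw (hm k)
    have hτj : τ ω j = τ ω' j := congrArg Prod.fst h
    refine Prod.ext hτj (funext fun i => Prod.ext (congrFun (congrArg Prod.snd h) i) ?_)
    refine Option.ext fun z => ?_
    have hq : (f * f * j + i) / (f * f) = j := by
      rw [Nat.mul_add_div hffpos, Nat.div_eq_of_lt i.2, add_zero]
    have key : ∀ ω, r ω (f * f * j + i) = some z ↔
        ∃ k, (f * f * j + i, z) ∈ itemsTo (f * f) item a ω k j := by
      intro ω
      rw [hr]
      simp only [mem_itemsTo, hq, true_and]
      constructor
      · rintro ⟨p, hp1, hp2⟩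
        obtain ⟨k, i', rfl⟩ := exists_cell hp1
        exact ⟨k, i', hp2⟩
      · rintro ⟨k, i', h⟩
        exact ⟨_, cell_lt k i', h⟩
    simp only [key, hL]
  · intro ω j
    calc _ ≤ ∑ k : Fin M, 51 * (itemsTo (f * f) item a ω k j).length :=
          Finset.sum_le_sum fun k _ => hcost
      _ = 51 * ∑ k : Fin M, (itemsTo (f * f) item a ω k j).length := by rw [Finset.mul_sum]
      _ ≤ _ := Nat.mul_le_mul_left _ (sum_length_itemsTo_left (hinj ω) j)
  · intro ω k
    calc _ ≤ ∑ j : Fin M, 51 * (itemsTo (f * f) item a ω k j).length :=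
          Finset.sum_le_sum fun k _ => hcost
      _ = 51 * ∑ j : Fin M, (itemsTo (f * f) item a ω k j).length := by rw [Finset.mul_sum]
      _ ≤ _ := Nat.mul_le_mul_left _ (sum_length_itemsTo_right item a ω k)
  · rw [width_prod, width_nat, width_pi]
    omega
  · rw [width_prod, width_nat, width_pi, width_prod, width_option]
    have : f * f * (width R + (width Z + 1)) ≤ f * f * 49 := Nat.mul_le_mul_left _ (by omega)
    omega
  · exact hp.machines_lt.le
  · exact hp.space_lt
  · exact below_block hτ hb
  · refine below_block hτ fun ω p hp1 => below_mk.2 ⟨hb ω p hp1, ?_⟩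
    rw [below_option hp.one_lt]
    intro z hzz
    obtain ⟨p', h1, h2⟩ := (hr ω p z).1 hzz
    exact hz ω p' p z h1 h2
  · intro ω k j y hy
    rw [List.mem_flatMap] at hy
    obtain ⟨x, hx, hy⟩ := hy
    obtain ⟨-, i, h⟩ := mem_itemsTo.1 hx
    have hb : Below W x := below_prod.2 ⟨below_nat.2
      ((hdest ω _ _ _ (cell_lt k i) h).trans hp.cells_lt), hz ω _ _ _ (cell_lt k i) h⟩
    exact hb y hy

end MPC

namespace MPC

open Enc

/-! ### Sorting -/

/-- The position of cell `p` when `N` cells are sorted stably by the keys `d`. -/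
def rank (N : ℕ) (d : ℕ → ℕ) (p : ℕ) : ℕ :=
  ((Finset.range N).filter fun q => d q < d p ∨ d q = d p ∧ q < p).card

theorem rank_lt {N : ℕ} {d : ℕ → ℕ} {p : ℕ} (hp : p < N) : rank N d p < N := by
  conv_rhs => rw [← Finset.card_range N]
  refine Finset.card_lt_card ((Finset.filter_ssubset).2 ⟨p, by simpa using hp, by simp⟩)

theorem rank_lt_rank {N : ℕ} {d : ℕ → ℕ} {p p' : ℕ} (hp : p < N)
    (h : d p < d p' ∨ d p = d p' ∧ p < p') : rank N d p < rank N d p' := by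
  refine Finset.card_lt_card ((Finset.ssubset_iff_of_subset fun q hq => ?_).2 ⟨p, ?_, ?_⟩)
  · simp only [Finset.mem_filter] at hq ⊢
    exact ⟨hq.1, by omega⟩
  · simpa using ⟨hp, h⟩
  · simp

theorem lex_of_rank_lt {N : ℕ} {d : ℕ → ℕ} {p p' : ℕ} (hp' : p' < N)
    (h : rank N d p < rank N d p') : d p < d p' ∨ d p = d p' ∧ p < p' := by
  by_contra hc
  rcases (show (d p' < d p ∨ d p' = d p ∧ p' < p) ∨ p = p' by omega) with h' | rfl
  · exact absurd (rank_lt_rank hp' h') h.not_gt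
  · exact absurd h (lt_irrefl _)

theorem rank_injOn {N : ℕ} {d : ℕ → ℕ} {p p' : ℕ} (hp : p < N) (hp' : p' < N)
    (h : rank N d p = rank N d p') : p = p' := by
  by_contra hc
  rcases (show (d p < d p' ∨ d p = d p' ∧ p < p') ∨ (d p' < d p ∨ d p' = d p ∧ p' < p) by omega)
    with h' | h'
  · exact absurd (rank_lt_rank hp h') (by omega)
  · exact absurd (rank_lt_rank hp' h') (by omega)

theorem image_rank {N : ℕ} {d : ℕ → ℕ} : (Finset.range N).image (rank N d) = Finset.range N := by
  refine Finset.eq_of_subset_of_card_le ?_ ?_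
  · intro x hx
    obtain ⟨p, hp, rfl⟩ := Finset.mem_image.1 hx
    exact Finset.mem_range.2 (rank_lt (Finset.mem_range.1 hp))
  · rw [Finset.card_image_of_injOn]
    intro p hp p' hp' h
    exact rank_injOn (by simpa using hp) (by simpa using hp') h

/-- Stability in a form suited to a scan: ties count among the preceding cells but not among the
following ones. -/
theorem rank_eq {N : ℕ} {d : ℕ → ℕ} {p : ℕ} (hp : p < N) : rank N d p =
    ((Finset.Ico 0 p).filter fun q => d q < d p + 1).card +
    ((Finset.Ico (p + 1) N).filter fun q => d q < d p).card := by
  rw [rank, ← Finset.card_union_of_disjoint]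
  · congr 1
    ext q
    simp only [Finset.mem_filter, Finset.mem_range, Finset.mem_union, Finset.mem_Ico]
    rcases eq_or_ne q p with rfl | hqp
    · simp
    · omega
  · rw [Finset.disjoint_left]
    intro q h1 h2
    simp only [Finset.mem_filter, Finset.mem_Ico] at h1 h2
    omega

/-- Two arrays with the same cells up to their order. -/
def SameCells {R : Type} (N : ℕ) (a a' : ℕ → R) : Prop :=
  (Multiset.range N).map a = (Multiset.range N).map a'

theorem SameCells.sum {R : Type} {N : ℕ} {a a' : ℕ → R} (h : SameCells N a a') {A : Type*}
    [AddCommMonoid A] (F : R → A) :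
    ∑ p ∈ Finset.range N, F (a p) = ∑ p ∈ Finset.range N, F (a' p) := by
  have := congrArg (fun s => (s.map F).sum) h
  simp only [Multiset.map_map] at this
  exact this

theorem SameCells.exists_iff {R : Type} {N : ℕ} {a a' : ℕ → R} (h : SameCells N a a')
    (P : R → Prop) : (∃ p < N, P (a p)) ↔ ∃ p < N, P (a' p) := by
  have h1 : ∀ x, (∃ p < N, a p = x) ↔ ∃ p < N, a' p = x := by
    intro x
    have := congrArg (fun s => x ∈ s) h
    simpa [Multiset.mem_map] using this
  constructor
  · rintro ⟨p, hp, hx⟩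
    obtain ⟨p', hp', e⟩ := (h1 (a p)).1 ⟨p, hp, rfl⟩
    exact ⟨p', hp', e ▸ hx⟩
  · rintro ⟨p, hp, hx⟩
    obtain ⟨p', hp', e⟩ := (h1 (a' p)).2 ⟨p, hp, rfl⟩
    exact ⟨p', hp', e ▸ hx⟩

theorem SameCells.forall {R : Type} {N : ℕ} {a a' : ℕ → R} (h : SameCells N a a')
    {P : R → Prop} (h' : ∀ p < N, P (a' p)) : ∀ p < N, P (a p) := by
  intro p hp
  by_contra hc
  obtain ⟨p', hp', hx⟩ := (h.exists_iff fun r => ¬ P r).1 ⟨p, hp, hc⟩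
  exact hx (h' p' hp')

theorem sameCells_of_rank {R : Type} {N : ℕ} {a a' : ℕ → R} {d : ℕ → ℕ}
    (h : ∀ p < N, a' (rank N d p) = a p) : SameCells N a' a := by
  have h1 : (Multiset.range N).map (rank N d) = Multiset.range N := by
    have h2 := Finset.image_val_of_injOn (s := Finset.range N) (f := rank N d) (by
      intro p hp p' hp' h
      exact rank_injOn (by simpa using hp) (by simpa using hp') h)
    rw [image_rank] at h2
    exact h2.symm
  unfold SameCells
  conv_lhs => rw [← h1, Multiset.map_map]
  exact Multiset.map_congr rfl fun p hp => h p (Multiset.mem_range.1 hp)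

variable {Ω : Type*} {M f D S W : ℕ} {R : Type} [Enc R]

omit [Enc R] in
theorem aggregate_count {N : ℕ} {a : Ω → ℕ → R} (P : R → ℕ → Prop) [∀ r c, Decidable (P r c)]
    (f : ℕ) : Aggregate N a fun ω lo hi (c : Fin f) =>
      ((Finset.Ico lo hi).filter fun q => P (a ω q) c).card where
  append ω ω' lo mid hi h1 h2 _ e1 e2 := by
    funext c
    have e1 := congrFun e1 c
    have e2 := congrFun e2 c
    simp only [Finset.card_filter] at e1 e2 ⊢
    rw [← Finset.sum_Ico_consecutive _ h1 h2, ← Finset.sum_Ico_consecutive _ h1 h2, e1, e2]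
  empty ω ω' p := by simp
  single ω ω' p _ h := by
    simp only [Nat.Ico_succ_singleton, Finset.filter_singleton, h]

/-- One pass of radix sort. -/
theorem exists_reach_pass (hp : Params M f D S W) {τ : Ω → Fin M → ℕ} {a : Ω → ℕ → R}
    (digit : R → ℕ) (hd : ∀ r, digit r < f) (hR : width R ≤ 16) (hτ : ∀ ω j, τ ω j < W)
    (hb : ∀ ω, ∀ p < M * (f * f), Below W (a ω p)) :
    ∃ a' : Ω → ℕ → R,
      (∀ ω, ∀ p < M * (f * f), a' ω (rank (M * (f * f)) (fun q => digit (a ω q)) p) = a ω p) ∧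
      Reach S W (2 * D + 6) (arr M (f * f) τ a) (arr M (f * f) τ a') := by
  set N := M * (f * f) with hN
  have hNW : N < W := hp.cells_lt
  have hcount : ∀ {s : Finset ℕ} {lo hi : ℕ}, s ⊆ Finset.Ico lo hi → hi ≤ N → s.card < W := by
    intro s lo hi hs hhi
    have := Finset.card_le_card hs
    rw [Nat.card_Ico] at this
    omega
  -- The aggregate is a vector of `f` cumulative counters: entry `c` counts the digits at most `c`.
  let H : Ω → ℕ → ℕ → Fin f → ℕ := fun ω lo hi c =>
    ((Finset.Ico lo hi).filter fun q => digit (a ω q) < c + 1).card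
  have hH : Aggregate N a H := aggregate_count (fun r c => digit r < c + 1) f
  have hrank : ∀ ω, ∀ p < N, rank N (fun q => digit (a ω q)) p =
      -- For the following cells the inequality is strict, hence the counter of the preceding digit;
      -- no digit lies below 0.
      H ω 0 p ⟨digit (a ω p), hd _⟩ + if h : digit (a ω p) = 0 then 0 else
        H ω (p + 1) N ⟨digit (a ω p) - 1, (Nat.sub_le _ _).trans_lt (hd _)⟩ := by
    intro ω p hp1
    rw [rank_eq hp1]
    congr 1
    split_ifs with h
    · simp [h]
    · simp only [H]
      rw [Nat.sub_add_cancel (Nat.pos_of_ne_zero h)]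
  have h1 := reach_scan (a := a)
    (a' := fun ω p => (a ω p, rank N (fun q => digit (a ω q)) p)) hp hH ?_ ?_ (by omega) ?_ hτ hb
    ?_ ?_
  rotate_left
  · intro ω ω' p hp1 e1 e2 e3
    rw [hrank ω p hp1, hrank ω' p hp1, e1, e2, e3]
  · rw [width_pi, width_nat]; omega
  · rw [width_prod, width_nat]; omega
  · intro ω p hp1
    exact below_mk.2 ⟨hb ω p hp1, below_nat.2 ((rank_lt hp1).trans hNW)⟩
  · intro ω lo hi _ hhi
    refine below_pi.2 fun c => below_nat.2 ?_
    exact hcount (Finset.filter_subset _ _) hhi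
  have hroute := exists_reach_route hp (τ := τ)
    (a := fun ω p => (a ω p, rank N (fun q => digit (a ω q)) p))
    (fun _ x => some (x.2, x.1)) ?_ ?_ ?_ hR hτ ?_ ?_
  rotate_left
  · intro ω p q z hp1 h
    simp only [Option.some.injEq, Prod.mk.injEq] at h
    rw [← h.1]; exact rank_lt hp1
  · intro ω p p' q z z' hp1 hp2 h h'
    simp only [Option.some.injEq, Prod.mk.injEq] at h h'
    exact rank_injOn hp1 hp2 (h.1.trans h'.1.symm)
  · rw [width_prod, width_nat]; omega
  · intro ω p hp1
    exact below_mk.2 ⟨hb ω p hp1, below_nat.2 ((rank_lt hp1).trans hNW)⟩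
  · intro ω p q z hp1 h
    simp only [Option.some.injEq, Prod.mk.injEq] at h
    rw [← h.2]; exact hb ω p hp1
  obtain ⟨r, hr, h2⟩ := hroute
  have h3 := reach_map hp (τ := τ)
    (a := fun ω p => ((a ω p, rank N (fun q => digit (a ω q)) p), r ω p))
    (a' := fun ω p => (r ω p).getD (a ω p)) ?_ (by omega) hτ ?_
  rotate_left
  · intro ω ω' p _ h
    simp only [Prod.mk.injEq] at h
    rw [h.2, h.1.1]
  · intro ω p hp1
    cases h : r ω p with
    | none => exact hb ω p hp1
    | some z =>
      obtain ⟨p', hp', h'⟩ := (hr ω p z).1 h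
      simp only [Option.some.injEq, Prod.mk.injEq] at h'
      rw [Option.getD_some, ← h'.2]
      exact hb ω p' hp'
  refine ⟨fun ω p => (r ω p).getD (a ω p), fun ω p hp1 => ?_, ?_⟩
  · have := (hr ω (rank N (fun q => digit (a ω q)) p) (a ω p)).2 ⟨p, hp1, rfl⟩
    simp only [this, Option.getD_some]
  · have := (h1.trans h2).trans h3
    rwa [show 2 * D + 3 + 2 + 1 = 2 * D + 6 by ring] at this

/-- The first `N` cells are sorted by `key`. -/
def Sorted {R : Type} (N : ℕ) (key : R → ℕ) (a : ℕ → R) : Prop :=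
  ∀ p q, p < q → q < N → key (a p) ≤ key (a q)

/-- Radix sort. -/
theorem exists_reach_sort (hp : Params M f D S W) {τ : Ω → Fin M → ℕ} {a : Ω → ℕ → R}
    (key : R → ℕ) (hkey : ∀ ω, ∀ p < M * (f * f), key (a ω p) < f ^ D)
    (hR : width R ≤ 16) (hτ : ∀ ω j, τ ω j < W) (hb : ∀ ω, ∀ p < M * (f * f), Below W (a ω p)) :
    ∃ a' : Ω → ℕ → R, (∀ ω, SameCells (M * (f * f)) (a' ω) (a ω)) ∧
      (∀ ω, Sorted (M * (f * f)) key (a' ω)) ∧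
      Reach S W ((2 * D + 6) * D) (arr M (f * f) τ a) (arr M (f * f) τ a') := by
  set N := M * (f * f) with hN
  have hf := hp.two_le
  have main : ∀ i, ∃ a' : Ω → ℕ → R, (∀ ω, SameCells N (a' ω) (a ω)) ∧
      (∀ ω, Sorted N (fun r => key r % f ^ i) (a' ω)) ∧
      Reach S W ((2 * D + 6) * i) (arr M (f * f) τ a) (arr M (f * f) τ a') := by
    intro i
    induction i with
    | zero =>
      exact ⟨a, fun _ => rfl, fun ω p q _ _ => by simp [Nat.mod_one], Reach.refl _⟩
    | succ i ih =>
      obtain ⟨a1, h1, h2, h3⟩ := ih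
      have hb1 : ∀ ω, ∀ p < N, Below W (a1 ω p) := fun ω => (h1 ω).forall (hb ω)
      obtain ⟨a2, h4, h5⟩ := exists_reach_pass hp (τ := τ) (a := a1)
        (fun r => key r / f ^ i % f) (fun r => Nat.mod_lt _ (by omega)) hR hτ hb1
      refine ⟨a2, fun ω => (sameCells_of_rank (h4 ω)).trans (h1 ω), fun ω p' q' hpq hq => ?_, ?_⟩
      · have hsurj : ∀ x < N, ∃ p < N, rank N (fun q => key (a1 ω q) / f ^ i % f) p = x := by
          intro x hx
          have : x ∈ (Finset.range N).image (rank N fun q => key (a1 ω q) / f ^ i % f) := by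
            rw [image_rank]; simpa using hx
          obtain ⟨p, hp1, rfl⟩ := Finset.mem_image.1 this
          exact ⟨p, by simpa using hp1, rfl⟩
        obtain ⟨p, hp1, rfl⟩ := hsurj p' (hpq.trans hq)
        obtain ⟨q, hq1, rfl⟩ := hsurj q' hq
        rw [h4 ω p hp1, h4 ω q hq1]
        beta_reduce
        rw [Nat.mod_pow_succ, Nat.mod_pow_succ]
        have hlt : key (a1 ω p) % f ^ i < f ^ i := Nat.mod_lt _ (by positivity)
        -- Digit `i` decides; for equal digits stability keeps the former order, which is sorted by
        -- the lower digits.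
        rcases lex_of_rank_lt hq1 hpq with h | ⟨h, h'⟩
        · have := Nat.mul_le_mul_left (f ^ i) (Nat.succ_le_of_lt h)
          rw [Nat.mul_succ] at this
          exact le_trans (by omega) (Nat.le_add_left _ _)
        · have := h2 ω p q h' hq1
          beta_reduce at h this
          rw [h]
          omega
      · have := h3.trans h5
        rwa [← Nat.mul_succ] at this
  obtain ⟨a', h1, h2, h3⟩ := main D
  refine ⟨a', h1, fun ω p q hpq hq => ?_, h3⟩
  have hk : ∀ p < N, key (a' ω p) < f ^ D := (h1 ω).forall (P := fun r => key r < f ^ D) (hkey ω)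
  have := h2 ω p q hpq hq
  beta_reduce at this
  rwa [Nat.mod_eq_of_lt (hk p (hpq.trans hq)), Nat.mod_eq_of_lt (hk q hq)] at this

/-! ### Groups of cells with the same key -/

/-- The total weight of the cells in an interval that attain the maximal key. -/
def topWeight (κ wt : ℕ → ℕ) (lo hi : ℕ) : ℕ :=
  ∑ q ∈ Finset.Ico lo hi, if κ q = (Finset.Ico lo hi).sup κ then wt q else 0

theorem sup_Ico_append {κ : ℕ → ℕ} {lo mid hi : ℕ} (h1 : lo ≤ mid) (h2 : mid ≤ hi) :
    (Finset.Ico lo hi).sup κ = max ((Finset.Ico lo mid).sup κ) ((Finset.Ico mid hi).sup κ) := by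
  rw [← Finset.Ico_union_Ico_eq_Ico h1 h2, Finset.sup_union]

/-- If `x` bounds the keys of an interval, the cells with key `x` attain the maximum or do not
exist. Thus the maximum and its weight, two words that can be merged over intervals, answer the
query for `x`. -/
theorem sum_eq_topWeight {κ wt : ℕ → ℕ} {lo hi x : ℕ} (hx : (Finset.Ico lo hi).sup κ ≤ x) :
    ∑ q ∈ Finset.Ico lo hi, (if κ q = x then wt q else 0) =
      if (Finset.Ico lo hi).sup κ = x then topWeight κ wt lo hi else 0 := by
  split_ifs with h
  · rw [topWeight, h]
  · refine Finset.sum_eq_zero fun q hq => if_neg ?_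
    have : κ q ≤ (Finset.Ico lo hi).sup κ := Finset.le_sup hq
    omega

theorem topWeight_append {κ wt : ℕ → ℕ} {lo mid hi : ℕ} (h1 : lo ≤ mid) (h2 : mid ≤ hi) :
    topWeight κ wt lo hi =
      (if (Finset.Ico lo mid).sup κ = (Finset.Ico lo hi).sup κ then topWeight κ wt lo mid else 0) +
      if (Finset.Ico mid hi).sup κ = (Finset.Ico lo hi).sup κ then topWeight κ wt mid hi else 0 := by
  have h := sup_Ico_append (κ := κ) h1 h2
  conv_lhs => rw [topWeight]
  rw [← Finset.sum_Ico_consecutive _ h1 h2, sum_eq_topWeight (by omega),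
    sum_eq_topWeight (by omega)]

omit [Enc R] in
theorem aggregate_top {N : ℕ} {a : Ω → ℕ → R} (key wt : R → ℕ) :
    Aggregate N a fun ω lo hi => ((Finset.Ico lo hi).sup fun q => key (a ω q),
      topWeight (fun q => key (a ω q)) (fun q => wt (a ω q)) lo hi) where
  append ω ω' lo mid hi h1 h2 _ e1 e2 := by
    simp only [Prod.mk.injEq] at e1 e2 ⊢
    rw [topWeight_append h1 h2, topWeight_append h1 h2, sup_Ico_append h1 h2,
      sup_Ico_append h1 h2, e1.1, e1.2, e2.1, e2.2]
    exact ⟨rfl, rfl⟩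
  empty ω ω' p := by simp [topWeight]
  single ω ω' p _ h := by simp [topWeight, h]

omit [Enc R] in
theorem Aggregate.prod {N : ℕ} {a : Ω → ℕ → R} {X Y : Type} {H : Ω → ℕ → ℕ → X}
    {H' : Ω → ℕ → ℕ → Y} (h : Aggregate N a H) (h' : Aggregate N a H') :
    Aggregate N a fun ω lo hi => (H ω lo hi, H' ω lo hi) where
  append ω ω' lo mid hi h1 h2 h3 e1 e2 := by
    simp only [Prod.mk.injEq] at e1 e2 ⊢
    exact ⟨h.append _ _ _ _ _ h1 h2 h3 e1.1 e2.1, h'.append _ _ _ _ _ h1 h2 h3 e1.2 e2.2⟩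
  empty ω ω' p := Prod.ext (h.empty _ _ _) (h'.empty _ _ _)
  single ω ω' p h1 h2 := Prod.ext (h.single _ _ _ h1 h2) (h'.single _ _ _ h1 h2)

/-- The number of rounds for sorting and computing the group sums. -/
def groupRounds (D : ℕ) : ℕ := (2 * D + 6) * D + (2 * D + 3)

/-- The array is sorted by a key, and every cell learns the total weight of the preceding cells
with the same key and of all cells with the same key. -/
theorem exists_reach_group (hp : Params M f D S W) {τ : Ω → Fin M → ℕ} {a : Ω → ℕ → R}
    (key wt : R → ℕ) (U : ℕ) (hkey : ∀ ω, ∀ p < M * (f * f), key (a ω p) ≤ U) (hU : U < f ^ D)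
    (hUW : U < W) (hwt : ∀ r, wt r ≤ 1) (hR : width R ≤ 16) (hτ : ∀ ω j, τ ω j < W)
    (hb : ∀ ω, ∀ p < M * (f * f), Below W (a ω p)) :
    ∃ a' : Ω → ℕ → R, (∀ ω, SameCells (M * (f * f)) (a' ω) (a ω)) ∧
      (∀ ω, Sorted (M * (f * f)) key (a' ω)) ∧
      Reach S W (groupRounds D) (arr M (f * f) τ a) (arr M (f * f) τ fun ω p => (a' ω p,
        ∑ q ∈ Finset.range p, (if key (a' ω q) = key (a' ω p) then wt (a' ω q) else 0),
        ∑ q ∈ Finset.range (M * (f * f)), if key (a ω q) = key (a' ω p) then wt (a ω q) else 0)) := by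
  set N := M * (f * f) with hN
  have hNW : N < W := hp.cells_lt
  have hf := hp.two_le
  obtain ⟨a', h1, h2, h3⟩ := exists_reach_sort hp (τ := τ) key
    (fun ω p hp1 => (hkey ω p hp1).trans_lt hU) hR hτ hb
  refine ⟨a', h1, h2, h3.trans ?_⟩
  have hkey' : ∀ ω, ∀ p < N, key (a' ω p) ≤ U := fun ω =>
    (h1 ω).forall (P := fun r => key r ≤ U) (hkey ω)
  have hb' : ∀ ω, ∀ p < N, Below W (a' ω p) := fun ω => (h1 ω).forall (hb ω)
  have hsum : ∀ (s : Finset ℕ) (P : ℕ → Prop) [DecidablePred P] (ω : Ω) (a : Ω → ℕ → R),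
      ∑ q ∈ s, (if P q then wt (a ω q) else 0) ≤ s.card := by
    intro s P _ ω a
    refine (Finset.sum_le_sum (g := fun _ => 1) fun q _ => ?_).trans (by simp)
    split_ifs
    · exact hwt _
    · exact Nat.zero_le _
  have hsup : ∀ (F : R → ℕ) (ω : Ω) (lo hi : ℕ), hi ≤ N → (∀ p < N, F (a' ω p) ≤ U) →
      ((Finset.Ico lo hi).sup fun q => F (a' ω q)) < W := by
    intro F ω lo hi hhi hF
    refine (Finset.sup_le fun q hq => hF q ?_).trans_lt hUW
    rw [Finset.mem_Ico] at hq
    omega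
  have htop : ∀ (F : R → ℕ) (ω : Ω) (lo hi : ℕ), hi ≤ N →
      topWeight (fun q => F (a' ω q)) (fun q => wt (a' ω q)) lo hi < W := by
    intro F ω lo hi hhi
    refine (hsum _ _ ω a').trans_lt ?_
    rw [Nat.card_Ico]; omega
  -- In a sorted array the equal keys before a cell attain the maximum of the prefix and those after
  -- it the minimum of the suffix. The complement `U - key` turns the latter into a maximum.
  let H : Ω → ℕ → ℕ → (ℕ × ℕ) × (ℕ × ℕ) := fun ω lo hi =>
    (((Finset.Ico lo hi).sup fun q => key (a' ω q),
      topWeight (fun q => key (a' ω q)) (fun q => wt (a' ω q)) lo hi),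
     ((Finset.Ico lo hi).sup fun q => U - key (a' ω q),
      topWeight (fun q => U - key (a' ω q)) (fun q => wt (a' ω q)) lo hi))
  have hH : Aggregate N a' H := (aggregate_top key wt).prod (aggregate_top (fun r => U - key r) wt)
  have hpre : ∀ ω, ∀ p < N,
      ∑ q ∈ Finset.range p, (if key (a' ω q) = key (a' ω p) then wt (a' ω q) else 0) =
      if (H ω 0 p).1.1 = key (a' ω p) then (H ω 0 p).1.2 else 0 := by
    intro ω p hp1
    rw [Finset.range_eq_Ico]
    refine sum_eq_topWeight (κ := fun q => key (a' ω q)) (wt := fun q => wt (a' ω q))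
      (Finset.sup_le fun q hq => ?_)
    exact h2 ω q p (Finset.mem_Ico.1 hq).2 hp1
  have hsuf : ∀ ω, ∀ p < N,
      ∑ q ∈ Finset.Ico (p + 1) N, (if key (a' ω q) = key (a' ω p) then wt (a' ω q) else 0) =
      if (H ω (p + 1) N).2.1 = U - key (a' ω p) then (H ω (p + 1) N).2.2 else 0 := by
    intro ω p hp1
    refine Eq.trans ?_ (sum_eq_topWeight (κ := fun q => U - key (a' ω q))
      (wt := fun q => wt (a' ω q)) (Finset.sup_le fun q hq => ?_))
    · refine Finset.sum_congr rfl fun q hq => ?_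
      have e1 := hkey' ω p hp1
      have e2 := hkey' ω q (Finset.mem_Ico.1 hq).2
      simp only [show (key (a' ω q) = key (a' ω p)) ↔ (U - key (a' ω q) = U - key (a' ω p)) by omega]
    · rw [Finset.mem_Ico] at hq
      have := h2 ω p q (by omega) hq.2
      omega
  -- Sorting does not change a total over all cells, which splits into the part before the cell, the
  -- cell itself and the part after it.
  have htot : ∀ ω, ∀ p < N,
      ∑ q ∈ Finset.range N, (if key (a ω q) = key (a' ω p) then wt (a ω q) else 0) =
      (if (H ω 0 p).1.1 = key (a' ω p) then (H ω 0 p).1.2 else 0) + wt (a' ω p) +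
      if (H ω (p + 1) N).2.1 = U - key (a' ω p) then (H ω (p + 1) N).2.2 else 0 := by
    intro ω p hp1
    rw [← hpre ω p hp1, ← hsuf ω p hp1,
      ← (h1 ω).sum fun r => if key r = key (a' ω p) then wt r else 0]
    rw [Finset.range_eq_Ico, Finset.range_eq_Ico, ← Finset.sum_Ico_consecutive _ (Nat.zero_le p)
      hp1.le, Finset.sum_eq_sum_Ico_succ_bot hp1]
    simp [add_assoc]
  refine reach_scan hp hH ?_ ?_ (by omega) ?_ hτ hb' ?_ ?_
  · intro ω ω' p hp1 e1 e2 e3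
    rw [hpre ω p hp1, hpre ω' p hp1, htot ω p hp1, htot ω' p hp1, e1, e2, e3]
  · simp only [width_prod, width_nat]; omega
  · simp only [width_prod, width_nat]; omega
  · intro ω p hp1
    refine below_mk.2 ⟨hb' ω p hp1, below_mk.2 ⟨below_nat.2 ?_, below_nat.2 ?_⟩⟩
    · refine (hsum _ _ ω a').trans_lt ?_
      rw [Finset.card_range]; omega
    · refine (hsum _ _ ω a).trans_lt ?_
      rw [Finset.card_range]; omega
  · intro ω lo hi _ hhi
    exact below_mk.2 ⟨below_mk.2 ⟨below_nat.2 (hsup key ω lo hi hhi (hkey' ω)),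
      below_nat.2 (htop key ω lo hi hhi)⟩, below_mk.2
      ⟨below_nat.2 (hsup (fun r => U - key r) ω lo hi hhi fun _ _ => Nat.sub_le _ _),
      below_nat.2 (htop (fun r => U - key r) ω lo hi hhi)⟩⟩

end MPC

/-! ### Arcs with degrees, ranks and positions -/

namespace MPC

open Enc

/-- The record of a directed edge: its end points, its original cell, the degrees of its end
points, its rank among the edges with the same origin and the position of its copies. -/
structure Arc where
  u : ℕ
  v : ℕ
  home : ℕ
  dv : ℕ
  du : ℕ
  rank : ℕ
  pos : ℕ

instance : Enc Arc where
  width := 7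
  enc r := [r.u, r.v, r.home, r.dv, r.du, r.rank, r.pos]
  length_enc _ := rfl
  injective_enc r r' h := by
    cases r; cases r'; simp_all

theorem width_arc : width Arc = 7 := rfl

theorem below_arc {W : ℕ} {r : Arc} : Below W r ↔ r.u < W ∧ r.v < W ∧ r.home < W ∧ r.dv < W ∧
    r.du < W ∧ r.rank < W ∧ r.pos < W := by
  simp [Below, enc]

/-- The data of an arc that are not computed. -/
def Arc.core (r : Arc) : ℕ × ℕ × ℕ := (r.u, r.v, r.home)

/-- The origin of an arc, and `n` for an empty cell. -/
def keyU (n : ℕ) (o : Option Arc) : ℕ := o.elim n Arc.u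

/-- The end of an arc, and `n` for an empty cell. -/
def keyV (n : ℕ) (o : Option Arc) : ℕ := o.elim n Arc.v

/-- The number of arcs in a cell. -/
def count {A : Type} (o : Option A) : ℕ := o.elim 0 fun _ => 1

/-- The number of copies of an arc: the degree of its origin if this is low. -/
def copies (low : ℕ → Prop) [DecidablePred low] (o : Option Arc) : ℕ :=
  o.elim 0 fun r => if low r.du then r.du else 0

/-- The array `y` contains the arcs of `x`, sorted by origins, with the computed data. -/
structure Layout (n N : ℕ) (low : ℕ → Prop) [DecidablePred low] (d : ℕ → ℕ)
    (x y : ℕ → Option Arc) : Prop where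
  same : SameCells N (fun p => (y p).map Arc.core) (fun p => (x p).map Arc.core)
  sorted : Sorted N (keyU n) y
  u_lt : ∀ p < N, ∀ r, y p = some r → r.u < n
  v_lt : ∀ p < N, ∀ r, y p = some r → r.v < n
  du_eq : ∀ p < N, ∀ r, y p = some r → r.du = d r.u
  dv_eq : ∀ p < N, ∀ r, y p = some r → r.dv = d r.v
  count_eq : ∀ u < n, ∑ q ∈ Finset.range N, (if keyU n (y q) = u then count (y q) else 0) = d u
  rank_eq : ∀ p < N, ∀ r, y p = some r → r.rank =
    ∑ q ∈ Finset.range p, if keyU n (y q) = r.u then count (y q) else 0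
  pos_eq : ∀ p < N, ∀ r, y p = some r → r.pos = ∑ q ∈ Finset.range p, copies low (y q)

theorem count_le_one {A : Type} (o : Option A) : count o ≤ 1 := by cases o <;> simp [count]

theorem SameCells.map {R R' : Type} {N : ℕ} {a a' : ℕ → R} (h : SameCells N a a') (g : R → R') :
    SameCells N (fun p => g (a p)) (fun p => g (a' p)) := by
  have := congrArg (Multiset.map g) h
  simp only [Multiset.map_map] at this
  exact this

theorem below_some {X : Type} [Enc X] {W : ℕ} {x : X} (h : Below W (some x)) : Below W x :=
  fun y hy => h y (List.mem_cons_of_mem _ hy)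

theorem aggregate_sum {Ω : Type*} {R : Type} {N : ℕ} {a : Ω → ℕ → R} (w : R → ℕ) :
    Aggregate N a fun ω lo hi => ∑ q ∈ Finset.Ico lo hi, w (a ω q) where
  append ω ω' lo mid hi h1 h2 _ e1 e2 := by
    rw [← Finset.sum_Ico_consecutive _ h1 h2, ← Finset.sum_Ico_consecutive _ h1 h2, e1, e2]
  empty ω ω' p := by simp
  single ω ω' p _ h := by simp [h]

variable {Ω : Type*} {M f D S W : ℕ}

/-- What is assumed about the initial array of arcs of a graph with degrees `d`. -/
structure ArcArray (n N off : ℕ) (low : ℕ → Prop) [DecidablePred low] (d : ℕ → ℕ)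
    (x : ℕ → Option Arc) : Prop where
  u_lt : ∀ p < N, ∀ r, x p = some r → r.u < n
  v_lt : ∀ p < N, ∀ r, x p = some r → r.v < n
  home_eq : ∀ p < N, ∀ r, x p = some r → r.home = p
  countU : ∀ u < n, ∑ q ∈ Finset.range N, (if keyU n (x q) = u then count (x q) else 0) = d u
  countV : ∀ v < n, ∑ q ∈ Finset.range N, (if keyV n (x q) = v then count (x q) else 0) = d v
  count_le : ∑ q ∈ Finset.range N, count (x q) ≤ off
  copies_le : off + ∑ q ∈ Finset.range N,
    (x q).elim 0 (fun r => if low (d r.u) then d r.u else 0) ≤ N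

/-- Grouping by ends provides `dv`. Grouping by origins afterwards provides `du` and `rank` and
leaves the arcs sorted by origin. A prefix sum of the numbers of copies gives `pos`. -/
theorem exists_reach_layout (hp : Params M f D S W) {τ : Ω → Fin M → ℕ} {n off : ℕ}
    {low : ℕ → Prop} [DecidablePred low] {d : Ω → ℕ → ℕ} {x : Ω → ℕ → Option Arc}
    (hx : ∀ ω, ArcArray n (M * (f * f)) off low (d ω) (x ω)) (hn : n < f ^ D) (hnW : n < W)
    (hd : ∀ ω u, d ω u < W) (hτ : ∀ ω j, τ ω j < W)
    (hb : ∀ ω, ∀ p < M * (f * f), Below W (x ω p)) :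
    ∃ y : Ω → ℕ → Option Arc, (∀ ω, Layout n (M * (f * f)) low (d ω) (x ω) (y ω)) ∧
      (∀ ω, ∀ p < M * (f * f), Below W (y ω p)) ∧
      Reach S W (2 * groupRounds D + (2 * D + 5)) (arr M (f * f) τ x) (arr M (f * f) τ y) := by
  set N := M * (f * f) with hN
  have hNW : N < W := hp.cells_lt
  have hwA : width (Option Arc) = 8 := rfl
  have hf := hp.two_le
  have hkey : ∀ (o : Option Arc) (g : Arc → ℕ), (∀ r, o = some r → g r < n) → o.elim n g ≤ n := by
    intro o g h
    cases o with
    | none => simp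
    | some r => simpa using (h r rfl).le
  -- the degrees of the ends
  obtain ⟨x1, hx1, -, h1⟩ := exists_reach_group hp (τ := τ) (a := x) (keyV n) count n
    (fun ω p hp1 => hkey _ _ ((hx ω).v_lt p hp1)) hn hnW count_le_one (by omega) hτ hb
  have hx1v : ∀ ω, ∀ p < N, ∀ r, x1 ω p = some r → r.v < n := fun ω =>
    (hx1 ω).forall (P := fun o => ∀ r, o = some r → r.v < n) (hx ω).v_lt
  have hx1u : ∀ ω, ∀ p < N, ∀ r, x1 ω p = some r → r.u < n := fun ω =>
    (hx1 ω).forall (P := fun o => ∀ r, o = some r → r.u < n) (hx ω).u_lt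
  have hx1b : ∀ ω, ∀ p < N, Below W (x1 ω p) := fun ω => (hx1 ω).forall (hb ω)
  let y1 : Ω → ℕ → Option Arc := fun ω p => (x1 ω p).map fun r => { r with dv := d ω r.v }
  have hy1b : ∀ ω, ∀ p < N, Below W (y1 ω p) := by
    intro ω p hp1
    rw [below_option hp.one_lt]
    intro r hr
    obtain ⟨r0, h0, rfl⟩ := Option.map_eq_some_iff.1 hr
    have hb0 := hx1b ω p hp1
    rw [h0] at hb0
    have hb1 := below_arc.1 (below_some hb0)
    rw [below_arc]
    exact ⟨hb1.1, hb1.2.1, hb1.2.2.1, hd _ _, hb1.2.2.2.2⟩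
  have h2 := reach_map hp (τ := τ) (a' := y1) (a := fun ω p => (x1 ω p,
    ∑ q ∈ Finset.range p, (if keyV n (x1 ω q) = keyV n (x1 ω p) then count (x1 ω q) else 0),
    ∑ q ∈ Finset.range N, if keyV n (x ω q) = keyV n (x1 ω p) then count (x ω q) else 0))
    (by
      have key : ∀ ω, ∀ p < N, y1 ω p = (x1 ω p).map fun r => { r with
          dv := ∑ q ∈ Finset.range N,
            if keyV n (x ω q) = keyV n (x1 ω p) then count (x ω q) else 0 } := by
        intro ω p hp1
        refine Option.map_congr fun r hr => ?_
        have := (hx ω).countV r.v (hx1v ω p hp1 r hr)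
        rw [← this, hr]
        rfl
      intro ω ω' p hp1 h
      simp only [Prod.mk.injEq] at h
      rw [key ω p hp1, key ω' p hp1, h.1, ← h.2.2, h.1]) (by omega) hτ hy1b
  -- the degrees of the origins and the ranks
  have hy1 : ∀ ω, SameCells N (fun p => (y1 ω p).map Arc.core) (fun p => (x ω p).map Arc.core) := by
    intro ω
    have := (hx1 ω).map (Option.map Arc.core)
    refine Eq.trans (Multiset.map_congr rfl fun p _ => ?_) this
    simp only [y1, Option.map_map]
    rfl
  have hkU1 : ∀ ω p, keyU n (y1 ω p) = keyU n (x1 ω p) := by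
    intro ω p; simp only [y1, keyU]; cases x1 ω p <;> rfl
  have hc1 : ∀ ω p, count (y1 ω p) = count (x1 ω p) := by
    intro ω p; simp only [y1, count]; cases x1 ω p <;> rfl
  have hy1c : ∀ ω, ∀ u < n,
      ∑ q ∈ Finset.range N, (if keyU n (y1 ω q) = u then count (y1 ω q) else 0) = d ω u := by
    intro ω u hu
    rw [← (hx ω).countU u hu, ← (hx1 ω).sum fun o => if keyU n o = u then count o else 0]
    simp only [hkU1, hc1]
    rfl
  obtain ⟨x2, hx2, hs2, h3⟩ := exists_reach_group hp (τ := τ) (a := y1) (keyU n) count n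
    (fun ω p hp1 => by rw [hkU1]; exact hkey _ _ (hx1u ω p hp1)) hn hnW count_le_one (by omega)
    hτ hy1b
  have hy1prop : ∀ ω, ∀ p < N, ∀ r, y1 ω p = some r → r.u < n ∧ r.v < n ∧ r.dv = d ω r.v := by
    intro ω p hp1 r hr
    obtain ⟨r0, h0, rfl⟩ := Option.map_eq_some_iff.1 hr
    exact ⟨hx1u ω p hp1 r0 h0, hx1v ω p hp1 r0 h0, rfl⟩
  have hx2prop : ∀ ω, ∀ p < N, ∀ r, x2 ω p = some r → r.u < n ∧ r.v < n ∧ r.dv = d ω r.v :=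
    fun ω => (hx2 ω).forall (P := fun o => ∀ r, o = some r → r.u < n ∧ r.v < n ∧ r.dv = d ω r.v)
      (hy1prop ω)
  have hx2b : ∀ ω, ∀ p < N, Below W (x2 ω p) := fun ω => (hx2 ω).forall (hy1b ω)
  let rk : Ω → ℕ → ℕ := fun ω p =>
    ∑ q ∈ Finset.range p, if keyU n (x2 ω q) = keyU n (x2 ω p) then count (x2 ω q) else 0
  have hrk : ∀ ω, ∀ p < N, rk ω p < W := by
    intro ω p hp1
    refine (Finset.sum_le_sum (g := fun _ => 1) fun q _ => ?_).trans_lt ?_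
    · split_ifs
      · exact count_le_one _
      · exact Nat.zero_le _
    · simp; omega
  let y2 : Ω → ℕ → Option Arc := fun ω p =>
    (x2 ω p).map fun r => { r with du := d ω r.u, rank := rk ω p }
  have hy2b : ∀ ω, ∀ p < N, Below W (y2 ω p) := by
    intro ω p hp1
    rw [below_option hp.one_lt]
    intro r hr
    obtain ⟨r0, h0, rfl⟩ := Option.map_eq_some_iff.1 hr
    have hb0 := hx2b ω p hp1
    rw [h0] at hb0
    have hb1 := below_arc.1 (below_some hb0)
    rw [below_arc]
    exact ⟨hb1.1, hb1.2.1, hb1.2.2.1, hb1.2.2.2.1, hd _ _, hrk ω p hp1, hb1.2.2.2.2.2.2⟩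
  have h4 := reach_map hp (τ := τ) (a' := y2) (a := fun ω p => (x2 ω p,
    ∑ q ∈ Finset.range p, (if keyU n (x2 ω q) = keyU n (x2 ω p) then count (x2 ω q) else 0),
    ∑ q ∈ Finset.range N, if keyU n (y1 ω q) = keyU n (x2 ω p) then count (y1 ω q) else 0))
    (by
      have key : ∀ ω, ∀ p < N, y2 ω p = (x2 ω p).map fun r => { r with
          du := ∑ q ∈ Finset.range N,
            if keyU n (y1 ω q) = keyU n (x2 ω p) then count (y1 ω q) else 0
          rank := ∑ q ∈ Finset.range p,
            if keyU n (x2 ω q) = keyU n (x2 ω p) then count (x2 ω q) else 0 } := by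
        intro ω p hp1
        refine Option.map_congr fun r hr => ?_
        have := hy1c ω r.u (hx2prop ω p hp1 r hr).1
        have e : keyU n (x2 ω p) = r.u := by rw [hr]; rfl
        simp only [rk, ← this, e]
      intro ω ω' p hp1 h
      simp only [Prod.mk.injEq] at h
      rw [key ω p hp1, key ω' p hp1, h.2.1, h.2.2, h.1]) (by omega) hτ hy2b
  -- the positions of the copies
  have hkU2 : ∀ ω p, keyU n (y2 ω p) = keyU n (x2 ω p) := by
    intro ω p; simp only [y2, keyU]; cases x2 ω p <;> rfl
  have hc2 : ∀ ω p, count (y2 ω p) = count (x2 ω p) := by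
    intro ω p; simp only [y2, count]; cases x2 ω p <;> rfl
  have hcop : ∀ ω, ∑ q ∈ Finset.range N, copies low (y2 ω q) = ∑ q ∈ Finset.range N,
      (x ω q).elim 0 (fun r => if low (d ω r.u) then d ω r.u else 0) := by
    intro ω
    have e1 : ∀ q, copies low (y2 ω q) =
        (x2 ω q).elim 0 (fun r => if low (d ω r.u) then d ω r.u else 0) := by
      intro q; simp only [y2, copies]; cases x2 ω q <;> rfl
    have e2 : ∀ q, (y1 ω q).elim 0 (fun r => if low (d ω r.u) then d ω r.u else 0) =
        (x1 ω q).elim 0 (fun r => if low (d ω r.u) then d ω r.u else 0) := by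
      intro q; simp only [y1]; cases x1 ω q <;> rfl
    simp only [e1]
    rw [(hx2 ω).sum fun o : Option Arc => o.elim 0 fun r => if low (d ω r.u) then d ω r.u else 0]
    simp only [e2]
    rw [(hx1 ω).sum fun o : Option Arc => o.elim 0 fun r => if low (d ω r.u) then d ω r.u else 0]
  have hsumle : ∀ ω lo hi, hi ≤ N → ∑ q ∈ Finset.Ico lo hi, copies low (y2 ω q) ≤ N := by
    intro ω lo hi hhi
    refine le_trans (Finset.sum_le_sum_of_subset (t := Finset.range N) fun q hq => ?_) ?_
    · rw [Finset.mem_Ico] at hq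
      rw [Finset.mem_range]; omega
    · rw [hcop]
      have := (hx ω).copies_le
      omega
  let y3 : Ω → ℕ → Option Arc := fun ω p =>
    (y2 ω p).map fun r => { r with pos := ∑ q ∈ Finset.range p, copies low (y2 ω q) }
  have hkU3 : ∀ ω p, keyU n (y3 ω p) = keyU n (x2 ω p) := by
    intro ω p; rw [← hkU2]; simp only [y3, keyU]; cases y2 ω p <;> rfl
  have hc3 : ∀ ω p, count (y3 ω p) = count (x2 ω p) := by
    intro ω p; rw [← hc2]; simp only [y3, count]; cases y2 ω p <;> rfl
  have hcop3 : ∀ ω p, copies low (y3 ω p) = copies low (y2 ω p) := by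
    intro ω p; simp only [y3, copies]; cases y2 ω p <;> rfl
  have hy3b : ∀ ω, ∀ p < N, Below W (y3 ω p) := by
    intro ω p hp1
    rw [below_option hp.one_lt]
    intro r hr
    obtain ⟨r0, h0, rfl⟩ := Option.map_eq_some_iff.1 hr
    have hb0 := hy2b ω p hp1
    rw [h0] at hb0
    have hb1 := below_arc.1 (below_some hb0)
    rw [below_arc]
    refine ⟨hb1.1, hb1.2.1, hb1.2.2.1, hb1.2.2.2.1, hb1.2.2.2.2.1, hb1.2.2.2.2.2.1, ?_⟩
    rw [Finset.range_eq_Ico]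
    exact (hsumle ω 0 p hp1.le).trans_lt hNW
  have h5 := reach_scan hp (τ := τ) (a := y2) (a' := y3) (aggregate_sum (copies low))
    (fun ω ω' p _ e1 e2 _ => by
      simp only [y3, Finset.range_eq_Ico, e1, e2]) (by rw [width_nat]; omega) (by omega) (by omega)
    hτ hy2b hy3b (fun ω lo hi _ hhi => below_nat.2 ((hsumle ω lo hi hhi).trans_lt hNW))
  have hy3 : ∀ ω, ∀ p, ∀ r, y3 ω p = some r → ∃ r0, x2 ω p = some r0 ∧ r.u = r0.u ∧ r.v = r0.v ∧
      r.du = d ω r0.u ∧ r.dv = r0.dv ∧ r.rank = rk ω p ∧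
      r.pos = ∑ q ∈ Finset.range p, copies low (y3 ω q) := by
    intro ω p r hr
    obtain ⟨r1, h1, rfl⟩ := Option.map_eq_some_iff.1 hr
    obtain ⟨r0, h0, rfl⟩ := Option.map_eq_some_iff.1 h1
    refine ⟨r0, h0, rfl, rfl, rfl, rfl, rfl, ?_⟩
    simp only [hcop3]
  refine ⟨y3, fun ω => ⟨?_, ?_, ?_, ?_, ?_, ?_, ?_, ?_, ?_⟩, hy3b, ?_⟩
  · refine Eq.trans ?_ (((hx2 ω).map (Option.map Arc.core)).trans (hy1 ω))
    refine Multiset.map_congr rfl fun p _ => ?_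
    simp only [y3, y2, Option.map_map]
    rfl
  · intro p q hpq hq
    rw [hkU3, hkU3]
    exact hs2 ω p q hpq hq
  · intro p hp1 r hr
    obtain ⟨r0, h0, e⟩ := hy3 ω p r hr
    rw [e.1]; exact (hx2prop ω p hp1 r0 h0).1
  · intro p hp1 r hr
    obtain ⟨r0, h0, e⟩ := hy3 ω p r hr
    rw [e.2.1]; exact (hx2prop ω p hp1 r0 h0).2.1
  · intro p hp1 r hr
    obtain ⟨r0, h0, e⟩ := hy3 ω p r hr
    rw [e.2.2.1, e.1]
  · intro p hp1 r hr
    obtain ⟨r0, h0, e⟩ := hy3 ω p r hr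
    rw [e.2.2.2.1, e.2.1]; exact (hx2prop ω p hp1 r0 h0).2.2
  · intro u hu
    simp only [hkU3, hc3]
    rw [(hx2 ω).sum fun o => if keyU n o = u then count o else 0]
    exact hy1c ω u hu
  · intro p hp1 r hr
    obtain ⟨r0, h0, e⟩ := hy3 ω p r hr
    have : keyU n (x2 ω p) = r.u := by rw [h0, e.1]; rfl
    rw [e.2.2.2.2.1]
    simp only [rk, this, hkU3, hc3]
  · intro p hp1 r hr
    obtain ⟨r0, h0, e⟩ := hy3 ω p r hr
    exact e.2.2.2.2.2
  · have := (((h1.trans h2).trans h3).trans h4).trans h5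
    rwa [show groupRounds D + 1 + groupRounds D + 1 + (2 * D + 3) =
      2 * groupRounds D + (2 * D + 5) by ring] at this

end MPC

/-! ### Blocks of arcs and the transposition of their copies -/

namespace MPC

/-- In a sorted array the cells with key below `x` form an initial segment, so their number is its
end. -/
theorem lt_iff_lt_card {N : ℕ} {κ : ℕ → ℕ} (hκ : ∀ p q, p < q → q < N → κ p ≤ κ q) {q : ℕ}
    (hq : q < N) (x : ℕ) : κ q < x ↔ q < ((Finset.range N).filter fun q => κ q < x).card := by
  constructor
  · intro h
    have h1 : Finset.range (q + 1) ⊆ (Finset.range N).filter fun q => κ q < x := by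
      intro q' hq'
      rw [Finset.mem_range] at hq'
      rw [Finset.mem_filter, Finset.mem_range]
      rcases Nat.lt_succ_iff_lt_or_eq.1 hq' with h' | rfl
      · exact ⟨h'.trans hq, (hκ _ _ h' hq).trans_lt h⟩
      · exact ⟨hq, h⟩
    have := Finset.card_le_card h1
    rw [Finset.card_range] at this
    omega
  · intro h
    by_contra hc
    have h1 : ((Finset.range N).filter fun q => κ q < x) ⊆ Finset.range q := by
      intro q' hq'
      rw [Finset.mem_filter, Finset.mem_range] at hq'
      rw [Finset.mem_range]
      by_contra hle
      rcases Nat.lt_or_eq_of_le (not_lt.1 hle) with h' | rfl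
      · have := hκ _ _ h' hq'.1
        omega
      · exact hc hq'.2
    have := Finset.card_le_card h1
    rw [Finset.card_range] at this
    omega

/-- Equal keys occupy an interval, which begins `r` cells before `p` and has length `D`. A cell thus
locates its block from its rank and the size of the group. -/
theorem block_of_sorted {N : ℕ} {κ : ℕ → ℕ} (hκ : ∀ p q, p < q → q < N → κ p ≤ κ q) {p : ℕ}
    (hp : p < N) {r D : ℕ} (hr : r = ((Finset.range p).filter fun q => κ q = κ p).card)
    (hD : D = ((Finset.range N).filter fun q => κ q = κ p).card) :
    r ≤ p ∧ r < D ∧ p - r + D ≤ N ∧ ∀ q < N, κ q = κ p ↔ p - r ≤ q ∧ q < p - r + D := by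
  set s := ((Finset.range N).filter fun q => κ q < κ p).card
  set e := ((Finset.range N).filter fun q => κ q < κ p + 1).card
  have hs : ∀ q < N, κ q < κ p ↔ q < s := fun q hq => lt_iff_lt_card hκ hq _
  have he : ∀ q < N, κ q < κ p + 1 ↔ q < e := fun q hq => lt_iff_lt_card hκ hq _
  have hsp : s ≤ p := not_lt.1 fun h => lt_irrefl _ ((hs p hp).2 h)
  have hep : p < e := (he p hp).1 (Nat.lt_succ_self _)
  have heN : e ≤ N := by
    have := Finset.card_filter_le (Finset.range N) fun q => κ q < κ p + 1
    rwa [Finset.card_range] at this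
  have h1 : ((Finset.range p).filter fun q => κ q = κ p) = Finset.Ico s p := by
    ext q
    simp only [Finset.mem_filter, Finset.mem_range, Finset.mem_Ico]
    constructor
    · rintro ⟨h1, h2⟩
      refine ⟨not_lt.1 fun h => ?_, h1⟩
      have := (hs q (by omega)).2 h
      omega
    · rintro ⟨h1, h2⟩
      refine ⟨h2, ?_⟩
      have h3 := mt (hs q (by omega)).1 (by omega)
      have := hκ q p h2 hp
      omega
  have h2 : ((Finset.range N).filter fun q => κ q = κ p) = Finset.Ico s e := by
    ext q
    simp only [Finset.mem_filter, Finset.mem_range, Finset.mem_Ico]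
    constructor
    · rintro ⟨h1, h2⟩
      exact ⟨not_lt.1 fun h => by have := (hs q h1).2 h; omega, (he q h1).1 (by omega)⟩
    · rintro ⟨h1, h2⟩
      have h3 := mt (hs q (by omega)).1 (by omega)
      have h4 := (he q (by omega)).2 h2
      exact ⟨by omega, by omega⟩
  rw [h1, Nat.card_Ico] at hr
  rw [h2, Nat.card_Ico] at hD
  refine ⟨by omega, by omega, by omega, fun q hq => ?_⟩
  have := Finset.ext_iff.1 h2 q
  simp only [Finset.mem_filter, Finset.mem_range, Finset.mem_Ico, hq, true_and] at this
  rw [this]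
  omega

theorem sum_count_eq_card {n u : ℕ} {y : ℕ → Option Arc} (hu : u < n) {m : ℕ} :
    ∑ q ∈ Finset.range m, (if keyU n (y q) = u then count (y q) else 0) =
      ((Finset.range m).filter fun q => keyU n (y q) = u).card := by
  rw [Finset.card_filter]
  refine Finset.sum_congr rfl fun q hq => ?_
  split_ifs with hk
  · cases hy : y q with
    | none => rw [hy] at hk; simp only [keyU, Option.elim_none] at hk; omega
    | some r => rfl
  · rfl

theorem keyU_eq_iff {n q u : ℕ} {y : ℕ → Option Arc} (hu : u < n) : keyU n (y q) = u ↔ ∃ r, y q = some r ∧ r.u = u := by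
  cases y q with
  | none => simp only [keyU, Option.elim_none]; constructor
            · omega
            · rintro ⟨r, hr, -⟩; simp at hr
  | some r => simp [keyU]

variable {n N : ℕ} {low : ℕ → Prop} [DecidablePred low] {d : ℕ → ℕ} {x y : ℕ → Option Arc}

/-- The number of the copies of the arcs before cell `p`. -/
def copiesBefore (low : ℕ → Prop) [DecidablePred low] (y : ℕ → Option Arc) (p : ℕ) : ℕ :=
  ∑ q ∈ Finset.range p, copies low (y q)

theorem copiesBefore_succ (p : ℕ) :
    copiesBefore low y (p + 1) = copiesBefore low y p + copies low (y p) :=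
  Finset.sum_range_succ _ _

theorem copiesBefore_mono {p q : ℕ} (h : p ≤ q) : copiesBefore low y p ≤ copiesBefore low y q :=
  Finset.sum_le_sum_of_subset (by simpa using h)

theorem copiesBefore_add_copies_le {p q : ℕ} (h : p < q) :
    copiesBefore low y p + copies low (y p) ≤ copiesBefore low y q := by
  rw [← copiesBefore_succ]; exact copiesBefore_mono h

/-- The copies of different arcs occupy disjoint consecutive intervals. -/
theorem copiesBefore_unique {p p' k k' : ℕ} (hk : k < copies low (y p))
    (hk' : k' < copies low (y p')) (h : copiesBefore low y p + k = copiesBefore low y p' + k') :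
    p = p' ∧ k = k' := by
  rcases lt_trichotomy p p' with hlt | rfl | hlt
  · have := copiesBefore_add_copies_le (low := low) (y := y) hlt
    omega
  · exact ⟨rfl, by omega⟩
  · have := copiesBefore_add_copies_le (low := low) (y := y) hlt
    omega

theorem sum_range_copiesBefore {A : Type*} [AddCommMonoid A] (g : ℕ → A) (m : ℕ) :
    ∑ t ∈ Finset.range (copiesBefore low y m), g t =
      ∑ p ∈ Finset.range m, ∑ k ∈ Finset.range (copies low (y p)), g (copiesBefore low y p + k) := by
  induction m with
  | zero => simp [copiesBefore]
  | succ m ih => rw [copiesBefore_succ, Finset.sum_range_add, ih, Finset.sum_range_succ]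

theorem copies_some {r : Arc} (h : low r.du) : copies low (some r) = r.du := by
  simp [copies, h]

namespace Layout

variable (h : Layout n N low d x y)

include h

theorem block {p : ℕ} (hp : p < N) {r : Arc} (hr : y p = some r) :
    r.rank ≤ p ∧ r.rank < r.du ∧ p - r.rank + r.du ≤ N ∧
      ∀ q < N, (∃ r', y q = some r' ∧ r'.u = r.u) ↔ p - r.rank ≤ q ∧ q < p - r.rank + r.du := by
  have hu := h.u_lt p hp r hr
  have hk : keyU n (y p) = r.u := by rw [hr]; rfl
  have h1 := h.rank_eq p hp r hr
  rw [sum_count_eq_card hu] at h1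
  have h2 := h.count_eq r.u hu
  rw [sum_count_eq_card hu, ← h.du_eq p hp r hr] at h2
  have := block_of_sorted (κ := fun q => keyU n (y q)) h.sorted hp (r := r.rank) (D := r.du)
    (by rw [hk]; exact h1) (by rw [hk]; exact h2.symm)
  refine ⟨this.1, this.2.1, this.2.2.1, fun q hq => ?_⟩
  rw [← this.2.2.2 q hq, hk, keyU_eq_iff hu]

theorem pos_eq' {p : ℕ} (hp : p < N) {r : Arc} (hr : y p = some r) :
    r.pos = copiesBefore low y p := h.pos_eq p hp r hr

theorem exists_of_block {p : ℕ} (hp : p < N) {r : Arc} (hr : y p = some r) {i : ℕ}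
    (hi : i < r.du) : ∃ r', y (p - r.rank + i) = some r' ∧ r'.u = r.u ∧ r'.du = r.du ∧
      r'.rank = i := by
  obtain ⟨h1, h2, h3, h4⟩ := h.block hp hr
  have hq : p - r.rank + i < N := by omega
  obtain ⟨r', e1, e2⟩ := (h4 _ hq).2 ⟨by omega, by omega⟩
  have hdu : r'.du = r.du := by rw [h.du_eq _ hq _ e1, h.du_eq _ hp _ hr, e2]
  refine ⟨r', e1, e2, hdu, ?_⟩
  obtain ⟨h1', h2', h3', h4'⟩ := h.block hq e1
  rw [hdu] at h2' h3' h4'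
  rw [e2] at h4'
  -- Both arcs describe the same block; comparing the two starting cells in both directions shows
  -- that they agree, which determines the rank.
  have a1 := (h4 (p - r.rank + i - r'.rank) (by omega)).1
    ((h4' _ (by omega)).2 ⟨le_rfl, by omega⟩)
  have a2 := (h4' (p - r.rank) (by omega)).1 ((h4 _ (by omega)).2 ⟨le_rfl, by omega⟩)
  omega

/-- All arcs with the same low origin have equally many copies, so their copies form rows of length
`du`. -/
theorem copiesBefore_block {p : ℕ} (hp : p < N) {r : Arc} (hr : y p = some r) (hl : low r.du) :
    ∀ i ≤ r.du, copiesBefore low y (p - r.rank + i) =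
      copiesBefore low y (p - r.rank) + i * r.du := by
  intro i
  induction i with
  | zero => simp
  | succ i ih =>
    intro hi
    obtain ⟨r', e1, -, e3, -⟩ := h.exists_of_block hp hr (i := i) (by omega)
    rw [← add_assoc, copiesBefore_succ, ih (by omega), e1, copies_some (e3 ▸ hl), e3]
    ring

/-- The copies of the arcs of a low vertex form a square array: transposing it maps
copy `k` of an arc with rank `i` to copy `i` of the arc with rank `k`. -/
theorem transpose {p : ℕ} (hp : p < N) {r : Arc} (hr : y p = some r) (hl : low r.du) {k : ℕ}
    (hk : k < r.du) : ∃ p' < N, ∃ r', y p' = some r' ∧ p' = p - r.rank + k ∧ r'.u = r.u ∧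
      r'.du = r.du ∧ r'.rank = k ∧ r.pos - r.rank * r.du + k * r.du + r.rank = r'.pos + r.rank ∧
      r'.pos - r'.rank * r'.du + r.rank * r'.du + r'.rank = r.pos + k := by
  obtain ⟨h1, h2, h3, h4⟩ := h.block hp hr
  obtain ⟨r', e1, e2, e3, e4⟩ := h.exists_of_block hp hr hk
  have hq : p - r.rank + k < N := by omega
  refine ⟨_, hq, r', e1, rfl, e2, e3, e4, ?_⟩
  rw [h.pos_eq' hp hr, h.pos_eq' hq e1, h.copiesBefore_block hp hr hl k hk.le, e3, e4]
  have := h.copiesBefore_block hp hr hl r.rank h2.le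
  rw [Nat.sub_add_cancel h1] at this
  rw [this]
  omega

theorem copiesBefore_eq : copiesBefore low y N = ∑ q ∈ Finset.range N,
    (x q).elim 0 (fun r => if low (d r.u) then d r.u else 0) := by
  have e1 := h.same.sum fun o : Option (ℕ × ℕ × ℕ) =>
    o.elim 0 fun c => if low (d c.1) then d c.1 else 0
  refine Eq.trans (Finset.sum_congr rfl fun q hq => ?_) (e1.trans (Finset.sum_congr rfl ?_))
  · rw [Finset.mem_range] at hq
    cases hy : y q with
    | none => rfl
    | some r => simp [copies, Arc.core, h.du_eq q hq r hy]
  · intro q _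
    cases x q <;> rfl

/-- Empty cells have the key `n` and are sorted to the end, so arcs occupy only cells below `off`.
The copies, which start at `off`, never share a cell with an arc. -/
theorem lt_of_some {off : ℕ} (hoff : ∑ q ∈ Finset.range N, count (x q) ≤ off) {p : ℕ} (hp : p < N)
    {r : Arc} (hr : y p = some r) : p < off := by
  have hk : keyU n (y p) < n := by rw [hr]; exact h.u_lt p hp r hr
  have h1 := (lt_iff_lt_card (κ := fun q => keyU n (y q)) h.sorted hp n).1 hk
  have h2 : ((Finset.range N).filter fun q => keyU n (y q) < n).card ≤
      ∑ q ∈ Finset.range N, count (y q) := by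
    rw [Finset.card_filter]
    refine Finset.sum_le_sum fun q _ => ?_
    cases y q with
    | none => simp [keyU]
    | some r => simp only [count, Option.elim_some]; split_ifs <;> simp
  have e1 := h.same.sum (count (A := ℕ × ℕ × ℕ))
  have e2 : ∀ o : Option Arc, count (o.map Arc.core) = count o := by
    intro o; cases o <;> rfl
  simp only [e2] at e1
  omega

end Layout

/-- What the cells know about the pairs of arcs with the same low origin: the copies of the arcs
start at cell `off`, and each copy has received the end of another arc. -/
structure Pairing (N off : ℕ) (low : ℕ → Prop) (y : ℕ → Option Arc)
    (pair : ℕ → Option (Arc × ℕ)) (recv : ℕ → Option (ℕ × ℕ)) : Prop where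
  pair_iff : ∀ q < N, ∀ r k, pair q = some (r, k) ↔
    ∃ p < N, y p = some r ∧ low r.du ∧ k < r.du ∧ q = off + r.pos + k
  recv_iff : ∀ q z, recv q = some z ↔ ∃ q' < N, ∃ r k, pair q' = some (r, k) ∧
    off + (r.pos - r.rank * r.du + k * r.du + r.rank) = q ∧ z = (r.v, r.dv)

/-- A sum over the pairs is a sum over all pairs of arcs with the same low origin. -/
theorem sum_pairing {off : ℕ} {pair : ℕ → Option (Arc × ℕ)} {recv : ℕ → Option (ℕ × ℕ)}
    (h : Layout n N low d x y) (hN : off + copiesBefore low y N ≤ N)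
    (hP : Pairing N off low y pair recv) (ψ : Arc → ℕ × ℕ → ℕ) :
    ∑ q ∈ Finset.range N, (pair q).elim 0 (fun rk => (recv q).elim 0 (ψ rk.1)) =
      ∑ p ∈ Finset.range N, (y p).elim 0 fun r => if low r.du then
        ∑ p' ∈ Finset.range N, (y p').elim 0 (fun r' =>
          if r'.u = r.u then ψ r (r'.v, r'.dv) else 0) else 0 := by
  set g : ℕ → ℕ := fun q => (pair q).elim 0 (fun rk => (recv q).elim 0 (ψ rk.1)) with hg
  have hcell : ∀ p < N, ∀ r, y p = some r → low r.du → ∀ k < r.du, ∀ r',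
      y (p - r.rank + k) = some r' → g (off + (copiesBefore low y p + k)) = ψ r (r'.v, r'.dv) := by
    intro p hp r hr hl k hk r' hr'
    have hcop : copies low (y p) = r.du := by rw [hr, copies_some hl]
    have hlt : ∀ p < N, ∀ k < copies low (y p), off + (copiesBefore low y p + k) < N := by
      intro p hp k hk
      have := copiesBefore_add_copies_le (low := low) (y := y) hp
      omega
    have h1 : pair (off + (copiesBefore low y p + k)) = some (r, k) :=
      (hP.pair_iff _ (hlt p hp k (by omega)) _ _).2
        ⟨p, hp, hr, hl, hk, by rw [h.pos_eq' hp hr]; ring⟩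
    -- The sender is the transposed copy: copy number `r.rank` of the arc with rank `k` at the same
    -- origin.
    have h2 : recv (off + (copiesBefore low y p + k)) = some (r'.v, r'.dv) := by
      obtain ⟨p', hp', r'', e1, e2, e3, e4, e5, e6, e7⟩ := h.transpose hp hr hl hk
      subst e2
      rw [hr', Option.some.injEq] at e1
      subst e1
      have hrk := (h.block hp hr).2.1
      refine (hP.recv_iff _ _).2 ⟨off + (r'.pos + r.rank), ?_, r', r.rank, ?_, ?_, rfl⟩
      · rw [h.pos_eq' hp' hr']
        refine hlt _ hp' _ ?_
        rw [hr', copies_some (e4 ▸ hl), e4]; exact hrk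
      · refine (hP.pair_iff _ ?_ _ _).2 ⟨_, hp', hr', e4 ▸ hl, by rw [e4]; exact hrk, by ring⟩
        rw [h.pos_eq' hp' hr']
        refine hlt _ hp' _ ?_
        rw [hr', copies_some (e4 ▸ hl), e4]; exact hrk
      · rw [e7, h.pos_eq' hp hr]
    simp only [hg, h1, h2, Option.elim_some]
  -- Only the cells that hold copies contribute, so the sum may be restricted to them and then
  -- reorganised by arcs.
  have hsupp : ∀ q < N, g q ≠ 0 → off ≤ q ∧ q < off + copiesBefore low y N := by
    intro q hq hne
    cases hpq : pair q with
    | none => simp [hg, hpq] at hne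
    | some rk =>
      obtain ⟨p, hp, hr, hl, hk, e⟩ := (hP.pair_iff q hq rk.1 rk.2).1 hpq
      have := copiesBefore_add_copies_le (low := low) (y := y) hp
      rw [hr, copies_some hl, ← h.pos_eq' hp hr] at this
      omega
  have h1 : ∑ q ∈ Finset.range N, g q =
      ∑ t ∈ Finset.range (copiesBefore low y N), g (off + t) := by
    have h2 : ∑ q ∈ Finset.range N, g q = ∑ q ∈ Finset.range (off + copiesBefore low y N), g q := by
      symm
      refine Finset.sum_subset (by simpa using hN) fun q hq hq' => ?_
      by_contra hc
      rw [Finset.mem_range] at hq hq'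
      exact hq' (hsupp q hq hc).2
    rw [h2, Finset.sum_range_add, Finset.sum_eq_zero, zero_add]
    intro q hq
    by_contra hc
    rw [Finset.mem_range] at hq
    have := (hsupp q (by omega) hc).1
    omega
  rw [h1, sum_range_copiesBefore fun t => g (off + t)]
  refine Finset.sum_congr rfl fun p hp => ?_
  rw [Finset.mem_range] at hp
  cases hr : y p with
  | none => simp [copies]
  | some r =>
    rw [Option.elim_some]
    split_ifs with hl
    · rw [copies_some hl]
      obtain ⟨b1, b2, b3, b4⟩ := h.block hp hr
      have h3 : ∑ p' ∈ Finset.range N, (y p').elim 0 (fun r' =>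
          if r'.u = r.u then ψ r (r'.v, r'.dv) else 0) =
          ∑ p' ∈ Finset.Ico (p - r.rank) (p - r.rank + r.du), (y p').elim 0 (fun r' =>
          if r'.u = r.u then ψ r (r'.v, r'.dv) else 0) := by
        symm
        refine Finset.sum_subset (fun q hq => ?_) fun q hq hq' => ?_
        · rw [Finset.mem_Ico] at hq
          rw [Finset.mem_range]; omega
        · rw [Finset.mem_range] at hq
          cases hq'' : y q with
          | none => rfl
          | some r' =>
            rw [Option.elim_some, if_neg]
            intro hu
            exact hq' (Finset.mem_Ico.2 ((b4 q hq).1 ⟨r', hq'', hu⟩))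
      rw [h3, Finset.sum_Ico_eq_sum_range, Nat.add_sub_cancel_left]
      refine Finset.sum_congr rfl fun k hk => ?_
      rw [Finset.mem_range] at hk
      obtain ⟨r', e1, e2, -, -⟩ := h.exists_of_block hp hr hk
      rw [hcell p hp r hr hl k hk r' e1, e1, Option.elim_some, if_pos e2]
    · simp [copies, hl]

end MPC

/-! ### Producing the pairs of arcs -/

namespace MPC

open Enc

/-- The last defined value of `g` on an interval. -/
def lastSome {X : Type} (g : ℕ → Option X) (lo hi : ℕ) : Option X :=
  ((List.range' lo (hi - lo)).filterMap g).getLast?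

theorem lastSome_append {X : Type} {g : ℕ → Option X} {lo mid hi : ℕ} (h1 : lo ≤ mid)
    (h2 : mid ≤ hi) : lastSome g lo hi = (lastSome g mid hi).or (lastSome g lo mid) := by
  have : List.range' lo (hi - lo) = List.range' lo (mid - lo) ++ List.range' mid (hi - mid) := by
    have := List.range'_append_1 (s := lo) (m := mid - lo) (n := hi - mid)
    rw [show lo + (mid - lo) = mid by omega, show mid - lo + (hi - mid) = hi - lo by omega] at this
    exact this.symm
  simp only [lastSome]
  rw [this, List.filterMap_append, List.getLast?_append]

theorem lastSome_self {X : Type} (g : ℕ → Option X) (p : ℕ) : lastSome g p p = none := by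
  simp [lastSome]

theorem lastSome_succ {X : Type} (g : ℕ → Option X) (p : ℕ) : lastSome g p (p + 1) = g p := by
  cases h : g p <;> simp [lastSome, h]

theorem exists_of_lastSome {X : Type} {g : ℕ → Option X} {lo hi : ℕ} {x : X}
    (h : lastSome g lo hi = some x) : ∃ c, lo ≤ c ∧ c < hi ∧ g c = some x := by
  have := List.mem_of_getLast? h
  rw [List.mem_filterMap] at this
  obtain ⟨c, hc, hx⟩ := this
  rw [List.mem_range'_1] at hc
  exact ⟨c, hc.1, by omega, hx⟩

theorem lastSome_eq {X : Type} {g : ℕ → Option X} {lo hi c : ℕ} {x : X} (h1 : lo ≤ c) (h2 : c < hi)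
    (hc : g c = some x) (h : ∀ c', c < c' → c' < hi → g c' = none) : lastSome g lo hi = some x := by
  rw [lastSome_append (mid := c + 1) (by omega) (by omega), lastSome_append (mid := c) h1
    (Nat.le_succ c), lastSome_succ, hc]
  cases h' : lastSome g (c + 1) hi with
  | none => rfl
  | some x' =>
    obtain ⟨c', h3, h4, h5⟩ := exists_of_lastSome h'
    rw [h c' (by omega) h4] at h5
    simp at h5

theorem aggregate_lastSome {Ω : Type*} {R X : Type} {N : ℕ} {a : Ω → ℕ → R} (w : R → Option X) :
    Aggregate N a fun ω lo hi => lastSome (fun q => w (a ω q)) lo hi where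
  append ω ω' lo mid hi h1 h2 _ e1 e2 := by
    rw [lastSome_append h1 h2, lastSome_append h1 h2, e1, e2]
  empty ω ω' p := by rw [lastSome_self, lastSome_self]
  single ω ω' p _ h := by rw [lastSome_succ, lastSome_succ, h]

variable {Ω : Type*} {M f D S W : ℕ}

/-- The message of an arc with a low origin to the cell where its copies begin. -/
def headerItem (off : ℕ) (low : ℕ → Prop) [DecidablePred low] (o : Option Arc) :
    Option (ℕ × Arc) :=
  o.bind fun r => if low r.du then some (off + r.pos, r) else none

theorem headerItem_eq_some {off : ℕ} {low : ℕ → Prop} [DecidablePred low] {o : Option Arc} {q : ℕ}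
    {r : Arc} : headerItem off low o = some (q, r) ↔ o = some r ∧ low r.du ∧ q = off + r.pos := by
  cases o with
  | none => simp [headerItem]
  | some r' =>
    simp only [headerItem, Option.bind_some, Option.ite_none_right_eq_some, Option.some.injEq,
      Prod.mk.injEq]
    constructor
    · rintro ⟨h1, h2, rfl⟩; exact ⟨rfl, h1, h2.symm⟩
    · rintro ⟨rfl, h1, h2⟩; exact ⟨h1, h2.symm, rfl⟩

/-- The copy of an arc at cell `q`, given the last arc whose copies begin at or before `q`. -/
def copyAt (off q : ℕ) (o : Option Arc) : Option (Arc × ℕ) :=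
  o.bind fun r => if q < off + r.pos + r.du then some (r, q - (off + r.pos)) else none

theorem copyAt_eq_some {off q : ℕ} {o : Option Arc} {r : Arc} {k : ℕ} :
    copyAt off q o = some (r, k) ↔
      o = some r ∧ q < off + r.pos + r.du ∧ k = q - (off + r.pos) := by
  cases o with
  | none => simp [copyAt]
  | some r' =>
    simp only [copyAt, Option.bind_some, Option.ite_none_right_eq_some, Option.some.injEq,
      Prod.mk.injEq]
    constructor
    · rintro ⟨h1, rfl, h2⟩; exact ⟨rfl, h1, h2.symm⟩
    · rintro ⟨rfl, h1, h2⟩; exact ⟨h1, rfl, h2.symm⟩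

/-- The message of a copy of an arc to the transposed copy. -/
def transposeItem (off : ℕ) (o : Option (Arc × ℕ)) : Option (ℕ × (ℕ × ℕ)) :=
  o.map fun rk => (off + (rk.1.pos - rk.1.rank * rk.1.du + rk.2 * rk.1.du + rk.1.rank),
    (rk.1.v, rk.1.dv))

theorem transposeItem_eq_some {off : ℕ} {o : Option (Arc × ℕ)} {q : ℕ} {z : ℕ × ℕ} :
    transposeItem off o = some (q, z) ↔ ∃ r k, o = some (r, k) ∧
      off + (r.pos - r.rank * r.du + k * r.du + r.rank) = q ∧ z = (r.v, r.dv) := by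
  simp only [transposeItem, Option.map_eq_some_iff, Prod.mk.injEq, Prod.exists]
  constructor
  · rintro ⟨r, k, h1, h2, h3⟩; exact ⟨r, k, h1, h2, h3.symm⟩
  · rintro ⟨r, k, h1, h2, h3⟩; exact ⟨r, k, h1, h2, h3.symm⟩

/-- Each arc with low origin is routed to the cell of its first copy; a scan for the last header
seen so far spreads it over its interval. Transposing the squares is injective, hence a second
routing. -/
theorem exists_reach_pairing (hp : Params M f D S W) {τ : Ω → Fin M → ℕ} {n off : ℕ}
    {low : ℕ → Prop} [DecidablePred low] {d : Ω → ℕ → ℕ} {x y : Ω → ℕ → Option Arc}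
    (hy : ∀ ω, Layout n (M * (f * f)) low (d ω) (x ω) (y ω))
    (hN : ∀ ω, off + copiesBefore low (y ω) (M * (f * f)) ≤ M * (f * f))
    (hτ : ∀ ω j, τ ω j < W) (hb : ∀ ω, ∀ p < M * (f * f), Below W (y ω p)) :
    ∃ (pair : Ω → ℕ → Option (Arc × ℕ)) (recv : Ω → ℕ → Option (ℕ × ℕ)),
      (∀ ω, Pairing (M * (f * f)) off low (y ω) (pair ω) (recv ω)) ∧
      Reach S W (2 * D + 7) (arr M (f * f) τ y)
        (arr M (f * f) τ fun ω p => ((y ω p, pair ω p), recv ω p)) := by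
  set N := M * (f * f) with hNdef
  have hNW : N < W := hp.cells_lt
  have hf := hp.two_le
  have hW1 := hp.one_lt
  have hA : width (Option Arc) = 8 := rfl
  have hybelow : ∀ ω, ∀ p < N, ∀ r, y ω p = some r → Below W r := fun ω p hp1 r hr =>
    (below_option hW1).1 (hb ω p hp1) r hr
  have hcop : ∀ ω p r, y ω p = some r → low r.du → copies low (y ω p) = r.du :=
    fun ω p r hr hl => by rw [hr, copies_some hl]
  -- a copy of an arc lies in the array
  have hend : ∀ ω, ∀ p < N, ∀ r, y ω p = some r → low r.du → off + r.pos + r.du ≤ N := by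
    intro ω p hp1 r hr hl
    have h1 := copiesBefore_add_copies_le (low := low) (y := y ω) hp1
    rw [hcop ω p r hr hl, ← (hy ω).pos_eq' hp1 hr] at h1
    have := hN ω
    omega
  have hlt : ∀ ω, ∀ p < N, ∀ r, y ω p = some r → low r.du → ∀ p' < N, ∀ r', y ω p' = some r' →
      low r'.du → p < p' → r.pos + r.du ≤ r'.pos := by
    intro ω p hp1 r hr hl p' hp' r' hr' hl' hpp
    have h1 := copiesBefore_add_copies_le (low := low) (y := y ω) hpp
    rwa [hcop ω p r hr hl, ← (hy ω).pos_eq' hp1 hr, ← (hy ω).pos_eq' hp' hr'] at h1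
  -- the headers
  have hroute := exists_reach_route hp (τ := τ) (a := y) (fun _ o => headerItem off low o)
    ?_ ?_ (by omega) (by rw [width_arc]; omega) hτ hb ?_
  rotate_left
  · intro ω p q r hp1 h
    obtain ⟨h1, h2, rfl⟩ := headerItem_eq_some.1 h
    have := hend ω p hp1 r h1 h2
    have := ((hy ω).block hp1 h1).2.1
    omega
  · intro ω p p' q r r' hp1 hp2 h h'
    obtain ⟨h1, h2, rfl⟩ := headerItem_eq_some.1 h
    obtain ⟨h1', h2', e⟩ := headerItem_eq_some.1 h'
    have := ((hy ω).block hp1 h1).2.1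
    have := ((hy ω).block hp2 h1').2.1
    rcases lt_trichotomy p p' with hl | hl | hl
    · have := hlt ω p hp1 r h1 h2 p' hp2 r' h1' h2' hl
      omega
    · exact hl
    · have := hlt ω p' hp2 r' h1' h2' p hp1 r h1 h2 hl
      omega
  · intro ω p q r hp1 h
    exact hybelow ω p hp1 r (headerItem_eq_some.1 h).1
  obtain ⟨hd, hhd, h1⟩ := hroute
  have hhd' : ∀ ω q r, hd ω q = some r ↔
      ∃ p < N, y ω p = some r ∧ low r.du ∧ q = off + r.pos := by
    intro ω q r
    rw [hhd]
    simp only [headerItem_eq_some]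
    exact Iff.rfl
  -- the copies
  let pair : Ω → ℕ → Option (Arc × ℕ) := fun ω q => copyAt off q (lastSome (hd ω) 0 (q + 1))
  have hpair : ∀ ω, ∀ q < N, ∀ r k, pair ω q = some (r, k) ↔
      ∃ p < N, y ω p = some r ∧ low r.du ∧ k < r.du ∧ q = off + r.pos + k := by
    intro ω q hq r k
    simp only [pair, copyAt_eq_some]
    constructor
    · rintro ⟨e1, e2, e3⟩
      obtain ⟨c, -, hc, e4⟩ := exists_of_lastSome e1
      obtain ⟨p, hp1, e5, e6, e7⟩ := (hhd' ω c r).1 e4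
      exact ⟨p, hp1, e5, e6, by omega, by omega⟩
    · rintro ⟨p, hp1, e1, e2, e3, e4⟩
      -- No later header can interfere: the copies of the next arcs begin only after the end of this
      -- interval.
      refine ⟨lastSome_eq (c := off + r.pos) (Nat.zero_le _) (by omega)
        ((hhd' ω _ r).2 ⟨p, hp1, e1, e2, rfl⟩) fun c' h1 h2 => ?_, by omega, by omega⟩
      cases hc : hd ω c' with
      | none => rfl
      | some r' =>
        exfalso
        obtain ⟨p', hp', e1', e2', e3'⟩ := (hhd' ω c' r').1 hc
        have := ((hy ω).block hp' e1').2.1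
        rcases lt_trichotomy p p' with hl | rfl | hl
        · have := hlt ω p hp1 r e1 e2 p' hp' r' e1' e2' hl
          omega
        · rw [e1, Option.some.injEq] at e1'
          subst e1'
          omega
        · have := hlt ω p' hp' r' e1' e2' p hp1 r e1 e2 hl
          omega
  have hhdb : ∀ ω q, Below W (hd ω q) := by
    intro ω q
    rw [below_option hW1]
    intro r hr
    obtain ⟨p, hp1, e1, -⟩ := (hhd' ω q r).1 hr
    exact hybelow ω p hp1 r e1
  have hpairb : ∀ ω, ∀ q < N, Below W (pair ω q) := by
    intro ω q hq
    rw [below_option hW1]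
    rintro ⟨r, k⟩ hr
    obtain ⟨p, hp1, e1, -, -, e2⟩ := (hpair ω q hq r k).1 hr
    exact below_mk.2 ⟨hybelow ω p hp1 r e1, below_nat.2 (by omega)⟩
  have h2 := reach_scan hp (τ := τ) (a := fun ω p => (y ω p, hd ω p))
    (a' := fun ω p => (y ω p, pair ω p)) (aggregate_lastSome Prod.snd) ?_
    (by rw [hA]; omega) (by rw [width_prod, hA]; omega)
    (by simp only [width_prod, width_option, width_arc, width_nat]; omega) hτ
    (fun ω p hp1 => below_mk.2 ⟨hb ω p hp1, hhdb ω p⟩)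
    (fun ω p hp1 => below_mk.2 ⟨hb ω p hp1, hpairb ω p hp1⟩) ?_
  rotate_left
  · intro ω ω' p _ e1 e2 _
    rw [Prod.mk.injEq] at e1
    have : ∀ ω, lastSome (hd ω) 0 (p + 1) = (hd ω p).or (lastSome (hd ω) 0 p) := fun ω => by
      rw [lastSome_append (Nat.zero_le p) (Nat.le_succ p), lastSome_succ]
    simp only [pair, this, e1.1, e1.2, e2]
  · intro ω lo hi _ hhi
    rw [below_option hW1]
    intro r hr
    obtain ⟨c, -, -, h⟩ := exists_of_lastSome hr
    exact (below_option hW1).1 (hhdb ω c) r h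
  -- the transposition
  have htr : ∀ ω, ∀ q < N, ∀ r k, pair ω q = some (r, k) → ∃ p < N, y ω p = some r ∧ low r.du ∧
      k < r.du ∧ q = off + r.pos + k ∧ ∃ p' < N, ∃ r', y ω p' = some r' ∧ p' = p - r.rank + k ∧
      r.rank < copies low (y ω p') ∧
      off + (r.pos - r.rank * r.du + k * r.du + r.rank) =
        off + (copiesBefore low (y ω) p' + r.rank) ∧ r'.u = r.u ∧ r'.du = r.du ∧ r'.rank = k := by
    intro ω q hq r k h
    obtain ⟨p, hp1, e1, e2, e3, e4⟩ := (hpair ω q hq r k).1 h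
    obtain ⟨p', hp', r', f1, f2, f3, f4, f5, f6, f7⟩ := (hy ω).transpose hp1 e1 e2 e3
    have hr := ((hy ω).block hp1 e1).2.1
    refine ⟨p, hp1, e1, e2, e3, e4, p', hp', r', f1, f2, ?_, ?_, f3, f4, f5⟩
    · rw [f1, copies_some (f4 ▸ e2), f4]; exact hr
    · rw [f6, (hy ω).pos_eq' hp' f1]
  have hroute := exists_reach_route hp (τ := τ) (a := fun ω p => (y ω p, pair ω p))
    (fun _ o => transposeItem off o.2) ?_ ?_
    (by simp only [width_prod, width_option, width_arc, width_nat]; omega)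
    (by simp only [width_prod, width_nat]; omega) hτ
    (fun ω p hp1 => below_mk.2 ⟨hb ω p hp1, hpairb ω p hp1⟩) ?_
  rotate_left
  · intro ω q q' z hq h
    obtain ⟨r, k, h1, h2, -⟩ := transposeItem_eq_some.1 h
    obtain ⟨p, hp1, e1, e2, e3, e4, p', hp', r', f1, f2, f3, f4, -⟩ := htr ω q hq r k h1
    have := copiesBefore_add_copies_le (low := low) (y := y ω) hp'
    have := hN ω
    omega
  · intro ω q1 q2 q' z1 z2 hq1 hq2 h1 h2
    obtain ⟨r, k, h1, h1', -⟩ := transposeItem_eq_some.1 h1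
    obtain ⟨s, l, h2, h2', -⟩ := transposeItem_eq_some.1 h2
    obtain ⟨p, hp1, e1, e2, e3, e4, p', hp', r', f1, f2, f3, f4, f5, f6, f7⟩ := htr ω q1 hq1 r k h1
    obtain ⟨o, ho1, i1, i2, i3, i4, o', ho', s', g1, g2, g3, g4, g5, g6, g7⟩ := htr ω q2 hq2 s l h2
    -- The destination determines its row and column in the square. The row is the arc of rank `k`
    -- and the column is the rank of the sender, so the sending copy is determined.
    have := copiesBefore_unique (low := low) (y := y ω) f3 g3 (by omega)
    obtain ⟨rfl, hrank⟩ := this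
    rw [f1, Option.some.injEq] at g1
    subst g1
    have hr := ((hy ω).block hp1 e1).1
    have hs := ((hy ω).block ho1 i1).1
    have hpo : p = o := by omega
    subst hpo
    rw [e1, Option.some.injEq] at i1
    subst i1
    omega
  · intro ω q q' z hq h
    obtain ⟨r, k, h1, h2, rfl⟩ := transposeItem_eq_some.1 h
    have hb := below_arc.1 (below_mk.1 ((below_option hW1).1 (hpairb ω q hq) _ h1)).1
    exact below_mk.2 ⟨below_nat.2 hb.2.1, below_nat.2 hb.2.2.2.1⟩
  obtain ⟨recv, hrecv, h3⟩ := hroute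
  refine ⟨pair, recv, fun ω => ⟨hpair ω, fun q z => ?_⟩, ?_⟩
  · rw [hrecv]
    simp only [transposeItem_eq_some]
    exact Iff.rfl
  · have := (h1.trans h2).trans h3
    rwa [show 2 + (2 * D + 3) + 2 = 2 * D + 7 by ring] at this

end MPC

/-! ### Closing the wedges by queries -/

namespace MPC

open Enc

/-- The wedge with the centre `u` and the ends `v`, `w` has to be checked at `u`. -/
def Closing (low : ℕ → Prop) (u : ℕ) (v w : ℕ × ℕ) : Prop :=
  v.1 < w.1 ∧ (low v.2 → u < v.1) ∧ (low w.2 → u < w.1)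

/-- The array contains an arc from `u` to `v`. -/
def HasArc (N : ℕ) (x : ℕ → Option Arc) (u v : ℕ) : Prop :=
  ∃ q < N, ∃ r, x q = some r ∧ r.u = u ∧ r.v = v

open Classical in
/-- The number of the triangles that are found at their low vertices. -/
noncomputable def closedWedges (N : ℕ) (low : ℕ → Prop) [DecidablePred low] (d : ℕ → ℕ) (x : ℕ → Option Arc) : ℕ :=
  ∑ p ∈ Finset.range N, (x p).elim 0 fun r => if low (d r.u) then
    ∑ p' ∈ Finset.range N, (x p').elim 0 (fun r' => if r'.u = r.u then
      if Closing low r.u (r.v, d r.v) (r'.v, d r'.v) ∧ HasArc N x r.v r'.v then 1 else 0 else 0)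
    else 0

/-- The cell of an arc with its data, or of a query for an arc. -/
abbrev Query : Type := Option ((ℕ × ℕ) × Option (ℕ × ℕ × ℕ))

open Classical in
/-- The query of a pair of arcs. -/
noncomputable def pairQuery (low : ℕ → Prop) (rk : Arc × ℕ) (z : ℕ × ℕ) : Query :=
  if Closing low rk.1.u (rk.1.v, rk.1.dv) z then some ((rk.1.v, z.1), none) else none

/-- The arc in a cell, or else the query in a cell. -/
noncomputable def query (low : ℕ → Prop) (c : (Option Arc × Option (Arc × ℕ)) × Option (ℕ × ℕ)) :
    Query :=
  c.1.1.elim (c.1.2.elim none fun rk => c.2.elim none (pairQuery low rk))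
    fun r => some ((r.u, r.v), some (r.home, r.du, r.dv))

/-- The arcs and the queries with the same end points have the same key. -/
def queryKey (n : ℕ) (o : Query) : ℕ := o.elim (n * n) fun c => c.1.1 * n + c.1.2

/-- The number of arcs in a cell. -/
def arcCount (o : Query) : ℕ := o.elim 0 fun c => count c.2

/-- The number of successful queries in a cell, where `k` is the number of matching arcs. -/
def successes (o : Query) (k : ℕ) : ℕ :=
  o.elim 0 fun c => if c.2 = none ∧ 0 < k then 1 else 0

/-- An arc returns to its original cell. -/
def homeItem (o : Query) : Option (ℕ × ((ℕ × ℕ) × (ℕ × ℕ))) :=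
  o.bind fun c => c.2.map fun t => (t.1, (c.1, t.2))

theorem successes_le_one (o : Query) (k : ℕ) : successes o k ≤ 1 := by
  cases o with
  | none => simp [successes]
  | some c => simp only [successes, Option.elim_some]; split_ifs <;> simp

theorem arcCount_le_one (o : Query) : arcCount o ≤ 1 := by
  cases o with
  | none => simp [arcCount]
  | some c => simpa [arcCount] using count_le_one c.2

theorem homeItem_eq_some {o : Query} {q : ℕ} {z : (ℕ × ℕ) × (ℕ × ℕ)} :
    homeItem o = some (q, z) ↔ o = some (z.1, some (q, z.2)) := by
  rcases o with _ | ⟨c, _ | ⟨t1, t2⟩⟩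
  · simp [homeItem]
  · simp [homeItem]
  · simp only [homeItem, Option.bind_some, Option.map_some, Option.some.injEq, Prod.mk.injEq]
    constructor
    · rintro ⟨rfl, rfl⟩; simp
    · rintro ⟨rfl, rfl, rfl⟩; simp

theorem query_eq_arc {low : ℕ → Prop} {c : (Option Arc × Option (Arc × ℕ)) × Option (ℕ × ℕ)}
    {k : ℕ × ℕ} {t : ℕ × ℕ × ℕ} : query low c = some (k, some t) ↔
      ∃ r, c.1.1 = some r ∧ k = (r.u, r.v) ∧ t = (r.home, r.du, r.dv) := by
  obtain ⟨⟨_ | r, _ | rk⟩, _ | z⟩ := c <;> simp [query, pairQuery, eq_comm]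

theorem query_eq_query {low : ℕ → Prop} {c : (Option Arc × Option (Arc × ℕ)) × Option (ℕ × ℕ)}
    {k : ℕ × ℕ} (h : query low c = some (k, none)) :
    c.1.1 = none ∧ ∃ rk z, c.1.2 = some rk ∧ c.2 = some z ∧ k = (rk.1.v, z.1) := by
  obtain ⟨⟨_ | r, _ | rk⟩, _ | z⟩ := c <;> simp_all [query, pairQuery]

theorem mul_add_inj {n a b a' b' : ℕ} (hb : b < n) (hb' : b' < n) (h : a * n + b = a' * n + b') :
    a = a' ∧ b = b' := by
  have h1 := congrArg (· / n) h
  have h2 := congrArg (· % n) h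
  have hn : 0 < n := by omega
  simp only [Nat.add_comm _ b, Nat.add_comm _ b',
    Nat.add_mul_div_right _ _ hn, Nat.add_mul_mod_self_right, Nat.div_eq_of_lt hb,
    Nat.div_eq_of_lt hb', Nat.mod_eq_of_lt hb, Nat.mod_eq_of_lt hb', zero_add] at h1 h2
  exact ⟨h1, h2⟩

/-- The count depends only on the multiset of the cores of the arcs, which the layout preserves. It
may therefore be evaluated on `y`, where the degrees are stored in the records. -/
theorem closedWedges_eq {n N : ℕ} {low : ℕ → Prop} [DecidablePred low] {d : ℕ → ℕ}
    {x y : ℕ → Option Arc} (h : Layout n N low d x y) :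
    closedWedges N low d x = ∑ p ∈ Finset.range N, (y p).elim 0 fun r => if low r.du then
      ∑ p' ∈ Finset.range N, (y p').elim 0 (fun r' => if r'.u = r.u then
        (open Classical in if Closing low r.u (r.v, r.dv) (r'.v, r'.dv) ∧ HasArc N y r.v r'.v
          then 1 else 0) else 0)
      else 0 := by
  classical
  have harc : ∀ u v, HasArc N x u v ↔ HasArc N y u v := by
    intro u v
    have := (h.same.exists_iff fun o => ∃ k, o = some (u, v, k)).symm
    have e : ∀ z : ℕ → Option Arc, (∃ p < N, ∃ k, (z p).map Arc.core = some (u, v, k)) ↔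
        HasArc N z u v := by
      intro z
      refine exists_congr fun p => and_congr_right fun _ => ?_
      cases z p <;> simp [Arc.core]
    rwa [e, e] at this
  let g : Option (ℕ × ℕ × ℕ) → Option (ℕ × ℕ × ℕ) → ℕ := fun o o' =>
    o.elim 0 fun c => if low (d c.1) then o'.elim 0 fun c' => if c'.1 = c.1 then
      (if Closing low c.1 (c.2.1, d c.2.1) (c'.2.1, d c'.2.1) ∧ HasArc N y c.2.1 c'.2.1
        then 1 else 0) else 0 else 0
  have hg : ∀ r r' : Arc, g (some r.core) (some r'.core) = if low (d r.u) then
      if r'.u = r.u then if Closing low r.u (r.v, d r.v) (r'.v, d r'.v) ∧ HasArc N y r.v r'.v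
        then 1 else 0 else 0 else 0 := fun _ _ => rfl
  have hg0 : ∀ o, g none o = 0 := fun _ => rfl
  have hg1 : ∀ r, g (some r) none = 0 := fun _ => ite_self _
  clear_value g
  have h1 : closedWedges N low d x = ∑ p ∈ Finset.range N, ∑ p' ∈ Finset.range N,
      g ((x p).map Arc.core) ((x p').map Arc.core) := by
    refine Finset.sum_congr rfl fun p _ => ?_
    cases x p with
    | none => simp [hg0]
    | some r =>
      simp only [Option.elim_some, Option.map_some]
      by_cases hl : low (d r.u)
      · rw [if_pos hl]
        refine Finset.sum_congr rfl fun p' _ => ?_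
        cases x p' with
        | none => simp [hg1]
        | some r' =>
          simp only [Option.elim_some, Option.map_some, hg, hl, harc, if_true]
      · rw [if_neg hl]
        refine (Finset.sum_eq_zero fun p' _ => ?_).symm
        cases x p' with
        | none => simp [hg1]
        | some r' => simp only [Option.map_some, hg, hl, if_false]
  have h2 : ∑ p ∈ Finset.range N, ∑ p' ∈ Finset.range N,
      g ((x p).map Arc.core) ((x p').map Arc.core) = ∑ p ∈ Finset.range N,
      ∑ p' ∈ Finset.range N, g ((y p).map Arc.core) ((y p').map Arc.core) := by
    rw [← h.same.sum fun o => ∑ p' ∈ Finset.range N, g o ((x p').map Arc.core)]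
    exact Finset.sum_congr rfl fun p _ => (h.same.sum (g ((y p).map Arc.core))).symm
  rw [h1, h2]
  refine Finset.sum_congr rfl fun p hp => ?_
  rw [Finset.mem_range] at hp
  cases hr : y p with
  | none => simp [hg0]
  | some r =>
    simp only [Option.elim_some, Option.map_some, h.du_eq p hp r hr, h.dv_eq p hp r hr]
    by_cases hl : low (d r.u)
    · rw [if_pos hl]
      refine Finset.sum_congr rfl fun p' hp' => ?_
      rw [Finset.mem_range] at hp'
      cases hr' : y p' with
      | none => simp [hg1]
      | some r' =>
        simp only [Option.elim_some, Option.map_some, hg, hl, h.dv_eq p' hp' r' hr', if_true]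
    · rw [if_neg hl]
      refine Finset.sum_eq_zero fun p' _ => ?_
      cases y p' with
      | none => simp [hg1]
      | some r' => simp only [Option.map_some, hg, hl, if_false]

/-- The number of successful queries. -/
theorem sum_successes {n N off : ℕ} {low : ℕ → Prop} [DecidablePred low] {d : ℕ → ℕ}
    {x y : ℕ → Option Arc} {pair : ℕ → Option (Arc × ℕ)} {recv : ℕ → Option (ℕ × ℕ)}
    (h : Layout n N low d x y) (hoff : ∑ q ∈ Finset.range N, count (x q) ≤ off)
    (hN : off + copiesBefore low y N ≤ N) (hP : Pairing N off low y pair recv)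
    {e : ℕ → Query} (he : ∀ p, e p = query low ((y p, pair p), recv p)) :
    ∑ p ∈ Finset.range N, successes (e p) (∑ q ∈ Finset.range N,
      if queryKey n (e q) = queryKey n (e p) then arcCount (e q) else 0) =
      closedWedges N low d x := by
  classical
  rw [closedWedges_eq h]
  rw [← sum_pairing h hN hP fun r z => if Closing low r.u (r.v, r.dv) z ∧ HasArc N y r.v z.1
    then 1 else 0]
  refine Finset.sum_congr rfl fun p hp => ?_
  rw [Finset.mem_range] at hp
  -- A cell with a pair lies beyond `off` and holds no arc, so the priority of arcs in `query` loses
  -- no pair.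
  have hpair : ∀ rk, pair p = some rk → y p = none ∧ rk.1.v < n := by
    intro rk hrk
    obtain ⟨p', hp', h1, h2, h3, h4⟩ := (hP.pair_iff p hp rk.1 rk.2).1 hrk
    refine ⟨?_, h.v_lt p' hp' _ h1⟩
    by_contra hc
    obtain ⟨r, hr⟩ := Option.ne_none_iff_exists'.1 hc
    have := h.lt_of_some hoff hp hr
    omega
  have hrecv : ∀ q z, recv q = some z → z.1 < n := by
    intro q z hz
    obtain ⟨q', hq', r, k, h1, -, rfl⟩ := (hP.recv_iff q z).1 hz
    obtain ⟨p', hp', h1, -⟩ := (hP.pair_iff q' hq' r k).1 h1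
    exact h.v_lt p' hp' _ h1
  -- For `b < n` the key `a * n + b` determines both end points, so the group contains an arc
  -- exactly if the queried edge exists.
  have hpos : ∀ a b : ℕ, a < n → b < n → (0 < ∑ q ∈ Finset.range N,
      (if queryKey n (e q) = a * n + b then arcCount (e q) else 0) ↔ HasArc N y a b) := by
    intro a b ha hb
    rw [Finset.sum_pos_iff]
    refine exists_congr fun q => ?_
    rw [Finset.mem_range]
    refine and_congr_right fun hq => ?_
    have hite : (0 < if queryKey n (e q) = a * n + b then arcCount (e q) else 0) ↔
        queryKey n (e q) = a * n + b ∧ 0 < arcCount (e q) := by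
      split_ifs with h1 <;> simp [h1]
    rw [hite, he]
    cases hy : y q with
    | none =>
      simp only [query, Option.elim_none, reduceCtorEq, false_and, exists_false, iff_false]
      rintro ⟨-, hlt⟩
      revert hlt
      rcases pair q with _ | rk
      · simp [arcCount]
      rcases recv q with _ | z
      · simp [arcCount]
      intro hlt
      simp only [Option.elim_some, pairQuery] at hlt
      by_cases hc : Closing low rk.1.u (rk.1.v, rk.1.dv) z <;> simp [hc, arcCount, count] at hlt
    | some r =>
      simp only [query, Option.elim_some, Option.some.injEq, exists_eq_left']
      constructor
      · rintro ⟨h1, -⟩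
        exact mul_add_inj (h.v_lt q hq r hy) hb h1
      · rintro ⟨rfl, rfl⟩
        exact ⟨rfl, Nat.one_pos⟩
  rw [he p]
  cases hpr : pair p with
  | none => rcases y p with _ | r <;> simp [query, successes]
  | some rk =>
    obtain ⟨h1, h2⟩ := hpair rk hpr
    cases hrc : recv p with
    | none => simp [query, successes, h1]
    | some z =>
      simp only [query, h1, Option.elim_none, Option.elim_some, pairQuery]
      by_cases hc : Closing low rk.1.u (rk.1.v, rk.1.dv) z
      · have h3 := hpos _ _ h2 (hrecv p z hrc)
        rw [if_pos hc]
        exact if_congr ⟨fun hh => ⟨hc, h3.1 hh.2⟩, fun hh => ⟨rfl, h3.2 hh.2⟩⟩ rfl rfl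
      · simp [hc, successes]

variable {Ω : Type*} {M f D S W : ℕ}

/-- The number of rounds for counting the triangles at the low vertices. -/
def countRounds (D : ℕ) : ℕ := 3 * groupRounds D + (6 * D + 19)

/-- From the array of arcs, the machines compute the degrees of the end points of all arcs and the
number of triangles at the low vertices. -/
theorem reach_count (hp : Params M f D S W) {τ : Ω → Fin M → ℕ} {n off : ℕ}
    {low : ℕ → Prop} [DecidablePred low] {d : Ω → ℕ → ℕ} {x : Ω → ℕ → Option Arc}
    (hx : ∀ ω, ArcArray n (M * (f * f)) off low (d ω) (x ω)) (hn : n * n < f ^ D) (hnW : n * n < W)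
    (hd : ∀ ω u, d ω u < W) (hτ : ∀ ω j, τ ω j < W)
    (hb : ∀ ω, ∀ p < M * (f * f), Below W (x ω p)) :
    Reach S W (countRounds D) (arr M (f * f) τ x) (arr M (f * f) τ fun ω p =>
      ((x ω p).map fun r => ((r.u, r.v), (d ω r.u, d ω r.v)),
        closedWedges (M * (f * f)) low (d ω) (x ω))) := by
  classical
  set N := M * (f * f) with hNdef
  have hNW : N < W := hp.cells_lt
  have hf := hp.two_le
  have hW1 := hp.one_lt
  have hnn : n ≤ n * n := Nat.le_mul_self n
  obtain ⟨y, hy, hyb, r1⟩ := exists_reach_layout hp hx (by omega) (by omega) hd hτ hb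
  have hcop : ∀ ω, off + copiesBefore low (y ω) N ≤ N := fun ω => by
    rw [(hy ω).copiesBefore_eq]; exact (hx ω).copies_le
  obtain ⟨pair, recv, hP, r2⟩ := exists_reach_pairing hp hy hcop hτ hyb
  have hyr : ∀ ω, ∀ p < N, ∀ r, y ω p = some r → Below W r := fun ω p hp1 r hr =>
    (below_option hW1).1 (hyb ω p hp1) r hr
  let e : Ω → ℕ → Query := fun ω p => query low ((y ω p, pair ω p), recv ω p)
  have hpair : ∀ ω, ∀ q < N, ∀ rk, pair ω q = some rk → rk.1.v < n := by
    intro ω q hq rk h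
    obtain ⟨p', hp', h1, -⟩ := ((hP ω).pair_iff q hq rk.1 rk.2).1 h
    exact (hy ω).v_lt p' hp' _ h1
  have hrecv : ∀ ω q z, recv ω q = some z → z.1 < n := by
    intro ω q z hz
    obtain ⟨q', hq', r, k, h1, -, rfl⟩ := ((hP ω).recv_iff q z).1 hz
    exact hpair ω q' hq' _ h1
  have he : ∀ ω, ∀ p < N, ∀ c, e ω p = some c → c.1.1 < n ∧ c.1.2 < n := by
    intro ω p hp1 c hc
    obtain ⟨k, _ | t⟩ := c
    · obtain ⟨-, rk, z, h1, h2, rfl⟩ := query_eq_query hc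
      exact ⟨hpair ω p hp1 rk h1, hrecv ω p z h2⟩
    · obtain ⟨r, h1, rfl, -⟩ := query_eq_arc.1 hc
      exact ⟨(hy ω).u_lt p hp1 r h1, (hy ω).v_lt p hp1 r h1⟩
  have heb : ∀ ω, ∀ p < N, Below W (e ω p) := by
    intro ω p hp1
    rw [below_option hW1]
    rintro ⟨⟨u, v⟩, t⟩ hc
    have h1 := he ω p hp1 _ hc
    simp only at h1
    refine below_mk.2 ⟨below_mk.2 ⟨below_nat.2 (by omega), below_nat.2 (by omega)⟩,
      (below_option hW1).2 ?_⟩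
    rintro t' rfl
    obtain ⟨r, h2, -, rfl⟩ := query_eq_arc.1 hc
    have h3 := below_arc.1 (hyr ω p hp1 r h2)
    exact below_mk.2 ⟨below_nat.2 h3.2.2.1, below_mk.2 ⟨below_nat.2 h3.2.2.2.2.1,
      below_nat.2 h3.2.2.2.1⟩⟩
  have hwQ : width Query = 7 := rfl
  have r3 := reach_map hp (τ := τ) (a := fun ω p => ((y ω p, pair ω p), recv ω p)) (a' := e)
    (fun ω ω' p _ h => congrArg (query low) h) (by omega) hτ heb
  -- matching the queries with the arcs
  obtain ⟨e', hs, -, r4⟩ := exists_reach_group hp (τ := τ) (a := e) (queryKey n) arcCount (n * n)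
    (by
      intro ω p hp1
      cases hc : e ω p with
      | none => simp [queryKey]
      | some c =>
        obtain ⟨h1, h2⟩ := he ω p hp1 c hc
        have : (c.1.1 + 1) * n ≤ n * n := Nat.mul_le_mul_right _ h1
        rw [Nat.succ_mul] at this
        simp only [queryKey, Option.elim_some]
        omega) hn hnW arcCount_le_one (by omega) hτ heb
  have heb' : ∀ ω, ∀ p < N, Below W (e' ω p) := fun ω => (hs ω).forall (heb ω)
  let tot : Ω → ℕ → ℕ := fun ω p => ∑ q ∈ Finset.range N,
    if queryKey n (e ω q) = queryKey n (e' ω p) then arcCount (e ω q) else 0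
  let pre : Ω → ℕ → ℕ := fun ω p => ∑ q ∈ Finset.range p,
    if queryKey n (e' ω q) = queryKey n (e' ω p) then arcCount (e' ω q) else 0
  have hle : ∀ (z : ℕ → Query) (P : ℕ → Prop) [DecidablePred P], ∀ k ≤ N,
      ∑ q ∈ Finset.range k, (if P q then arcCount (z q) else 0) < W := by
    intro z P _ k hk
    refine lt_of_le_of_lt ?_ (hk.trans_lt hNW)
    calc _ ≤ ∑ _q ∈ Finset.range k, 1 := Finset.sum_le_sum fun q _ => by
          have := arcCount_le_one (z q)
          split_ifs <;> omega
      _ = k := by simp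
  let w : Query × ℕ × ℕ → ℕ := fun c => successes c.1 c.2.2
  have hw : ∀ c, w c ≤ 1 := fun c => successes_le_one _ _
  let T : Ω → ℕ := fun ω => closedWedges N low (d ω) (x ω)
  have hT : ∀ ω, ∑ p ∈ Finset.range N, w (e' ω p, pre ω p, tot ω p) = T ω := by
    intro ω
    have h1 := (hs ω).sum fun o => successes o (∑ q ∈ Finset.range N,
      if queryKey n (e ω q) = queryKey n o then arcCount (e ω q) else 0)
    exact h1.trans (sum_successes (hy ω) (hx ω).count_le (hcop ω) (hP ω) fun p => rfl)
  have hTW : ∀ ω, T ω < W := by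
    intro ω
    rw [← hT]
    refine lt_of_le_of_lt ?_ hNW
    calc _ ≤ ∑ _q ∈ Finset.range N, 1 := Finset.sum_le_sum fun q _ => hw _
      _ = N := by simp
  have r5 := reach_scan hp (τ := τ) (a := fun ω p => (e' ω p, pre ω p, tot ω p))
    (a' := fun ω p => (e' ω p, T ω)) (aggregate_sum w) ?_ (by rw [width_nat]; omega)
    (by simp only [width_prod, hwQ, width_nat]; omega)
    (by simp only [width_prod, hwQ, width_nat]; omega) hτ
    (fun ω p hp1 => below_mk.2 ⟨heb' ω p hp1, below_mk.2 ⟨below_nat.2 (hle _ _ _ hp1.le),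
      below_nat.2 (hle _ _ _ le_rfl)⟩⟩)
    (fun ω p hp1 => below_mk.2 ⟨heb' ω p hp1, below_nat.2 (hTW ω)⟩) ?_
  rotate_left
  · intro ω ω' p hp1 h1 h2 h3
    have hsum : ∀ ω, T ω = ∑ q ∈ Finset.Ico 0 p, w (e' ω q, pre ω q, tot ω q) +
        (w (e' ω p, pre ω p, tot ω p) +
        ∑ q ∈ Finset.Ico (p + 1) N, w (e' ω q, pre ω q, tot ω q)) := by
      intro ω
      rw [← hT, Finset.range_eq_Ico, ← Finset.sum_Ico_consecutive _ (Nat.zero_le p) hp1.le,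
        Finset.sum_eq_sum_Ico_succ_bot hp1]
    rw [Prod.mk.injEq, hsum, hsum, h1, h2, h3]
    exact ⟨congrArg Prod.fst h1, rfl⟩
  · intro ω lo hi h1 h2
    refine below_nat.2 (lt_of_le_of_lt ?_ hNW)
    calc _ ≤ ∑ _q ∈ Finset.Ico lo hi, 1 := Finset.sum_le_sum fun q _ => hw _
      _ ≤ N := by simp; omega
  -- the arcs return to their cells
  have hhome : ∀ ω q z, (∃ p < N, homeItem (e' ω p) = some (q, z)) ↔
      q < N ∧ (x ω q).map (fun r => ((r.u, r.v), (d ω r.u, d ω r.v))) = some z := by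
    intro ω q z
    rw [(hs ω).exists_iff fun o => homeItem o = some (q, z)]
    have h1 : (∃ p < N, homeItem (e ω p) = some (q, z)) ↔ ∃ p < N, ∃ c,
        (y ω p).map Arc.core = some c ∧ c.2.2 = q ∧
          ((c.1, c.2.1), (d ω c.1, d ω c.2.1)) = z := by
      refine exists_congr fun p => and_congr_right fun hp1 => ?_
      rw [homeItem_eq_some]
      simp only [e]
      rw [query_eq_arc]
      constructor
      · rintro ⟨r, h1, h2, h3⟩
        change y ω p = some r at h1
        rw [Prod.mk.injEq] at h3
        refine ⟨r.core, by rw [h1]; rfl, h3.1.symm, ?_⟩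
        rw [Prod.ext_iff, h2, h3.2, (hy ω).du_eq p hp1 r h1, (hy ω).dv_eq p hp1 r h1]
        exact ⟨rfl, rfl⟩
      · rintro ⟨c, h1, rfl, rfl⟩
        obtain ⟨r, h2, rfl⟩ := Option.map_eq_some_iff.1 h1
        refine ⟨r, h2, rfl, ?_⟩
        rw [(hy ω).du_eq p hp1 r h2, (hy ω).dv_eq p hp1 r h2]
        rfl
    rw [h1, (hy ω).same.exists_iff fun o => ∃ c, o = some c ∧ c.2.2 = q ∧
          ((c.1, c.2.1), (d ω c.1, d ω c.2.1)) = z]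
    constructor
    · rintro ⟨p, hp1, c, h2, rfl, rfl⟩
      obtain ⟨r, h3, rfl⟩ := Option.map_eq_some_iff.1 h2
      have h4 := (hx ω).home_eq p hp1 r h3
      simp only [Arc.core, h4, h3]
      exact ⟨hp1, rfl⟩
    · rintro ⟨hq, h2⟩
      obtain ⟨r, h3, rfl⟩ := Option.map_eq_some_iff.1 h2
      exact ⟨q, hq, r.core, by rw [h3]; rfl, (hx ω).home_eq q hq r h3, rfl⟩
  have hroute := exists_reach_route hp (τ := τ) (a := fun ω p => (e' ω p, T ω))
    (fun _ c => homeItem c.1) ?_ ?_ (by simp only [width_prod, hwQ, width_nat]; omega)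
    (by simp only [width_prod, width_nat]; omega) hτ
    (fun ω p hp1 => below_mk.2 ⟨heb' ω p hp1, below_nat.2 (hTW ω)⟩) ?_
  rotate_left
  · intro ω p q z hp1 h
    exact ((hhome ω q z).1 ⟨p, hp1, h⟩).1
  · intro ω p p' q z z' hp1 hp2 h h'
    by_contra hne
    -- Sorting is known only up to multisets. The number of records returning to cell `q` is
    -- therefore compared with the original array, where at most one arc has the home `q`.
    let g : Option (ℕ × ℕ × ℕ) → ℕ := fun o => if ∃ c, o = some c ∧ c.2.2 = q then 1 else 0
    let g' : Query → ℕ := fun o => if ∃ z, homeItem o = some (q, z) then 1 else 0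
    have h1 : ∑ p ∈ Finset.range N, g' (e' ω p) = ∑ p ∈ Finset.range N, g ((x ω p).map Arc.core) := by
      rw [(hs ω).sum, ← (hy ω).same.sum g]
      refine Finset.sum_congr rfl fun p _ => if_congr ?_ rfl rfl
      simp only [homeItem_eq_some, e, query_eq_arc]
      constructor
      · rintro ⟨z, r, h1, h2, h3⟩
        exact ⟨r.core, by rw [h1]; rfl, (congrArg Prod.fst h3).symm⟩
      · rintro ⟨c, h1, rfl⟩
        obtain ⟨r, h2, rfl⟩ := Option.map_eq_some_iff.1 h1
        exact ⟨((r.u, r.v), (r.du, r.dv)), r, h2, rfl, rfl⟩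
    have h2 : ∑ p ∈ Finset.range N, g ((x ω p).map Arc.core) ≤ 1 := by
      simp only [g]
      rw [Finset.sum_boole, Nat.cast_id, Finset.card_le_one]
      have : ∀ i < N, (∃ c, (x ω i).map Arc.core = some c ∧ c.2.2 = q) → i = q := by
        rintro i hi ⟨c, f1, rfl⟩
        obtain ⟨r, f2, rfl⟩ := Option.map_eq_some_iff.1 f1
        exact ((hx ω).home_eq i hi r f2).symm
      intro i hi j hj
      rw [Finset.mem_filter, Finset.mem_range] at hi hj
      rw [this i hi.1 hi.2, this j hj.1 hj.2]
    have h3 : ∑ p ∈ {p, p'}, g' (e' ω p) ≤ ∑ p ∈ Finset.range N, g' (e' ω p) := by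
      refine Finset.sum_le_sum_of_subset fun i hi => ?_
      rw [Finset.mem_insert, Finset.mem_singleton] at hi
      rw [Finset.mem_range]
      rcases hi with rfl | rfl <;> assumption
    rw [Finset.sum_pair hne] at h3
    have h4 : g' (e' ω p) = 1 := if_pos ⟨z, h⟩
    have h5 : g' (e' ω p') = 1 := if_pos ⟨z', h'⟩
    omega
  · intro ω p q z hp1 h
    have h1 := (below_option hW1).1 (heb' ω p hp1) _ (homeItem_eq_some.1 h)
    exact below_prod.2 ⟨(below_mk.1 h1).1,
      (below_mk.1 ((below_option hW1).1 (below_mk.1 h1).2 _ rfl)).2⟩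
  obtain ⟨r, hr, r6⟩ := hroute
  have hr' : ∀ ω, ∀ p < N, r ω p = (x ω p).map fun r => ((r.u, r.v), (d ω r.u, d ω r.v)) := by
    intro ω p hp1
    ext z
    rw [hr, hhome]
    exact ⟨fun h => h.2, fun h => ⟨hp1, h⟩⟩
  have r7 := reach_map hp (τ := τ) (a := fun ω p => ((e' ω p, T ω), r ω p))
    (a' := fun ω p => ((x ω p).map fun r => ((r.u, r.v), (d ω r.u, d ω r.v)), T ω))
    (fun ω ω' p hp1 h => by
      simp only [← hr' ω p hp1, ← hr' ω' p hp1]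
      simp only [Prod.mk.injEq] at h ⊢
      exact ⟨h.2, h.1.2⟩) (by simp only [width_prod, width_option, width_nat]; omega) hτ
    (fun ω p hp1 => by
      refine below_mk.2 ⟨(below_option hW1).2 fun z hz => ?_, below_nat.2 (hTW ω)⟩
      obtain ⟨r, h1, rfl⟩ := Option.map_eq_some_iff.1 hz
      have h2 := below_arc.1 ((below_option hW1).1 (hb ω p hp1) r h1)
      exact below_mk.2 ⟨below_mk.2 ⟨below_nat.2 h2.1, below_nat.2 h2.2.1⟩,
        below_mk.2 ⟨below_nat.2 (hd _ _), below_nat.2 (hd _ _)⟩⟩)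
  have := (((((r1.trans r2).trans r3).trans r4).trans r5).trans r6).trans r7
  rwa [show 2 * groupRounds D + (2 * D + 5) + (2 * D + 7) + 1 + groupRounds D + (2 * D + 3) + 2 + 1 =
    countRounds D by unfold countRounds; ring] at this

end MPC

/-! ### From listed edges to arrays of arcs -/

open CountTriangles

/-- A concatenation of lists with the same positive length determines these lists. -/
theorem List.flatMap_injective_of_length {A B : Type*} {g : A → List B} {k : ℕ} (hk : 0 < k)
    (hg : ∀ x, (g x).length = k) (hi : Function.Injective g) :
    ∀ {l l' : List A}, l.flatMap g = l'.flatMap g → l = l'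
  | [], [], _ => rfl
  | [], x :: l, h | x :: l, [], h => by
    have := congrArg List.length h
    simp only [List.flatMap_nil, List.flatMap_cons, List.length_nil, List.length_append, hg] at this
    omega
  | x :: l, x' :: l', h => by
    simp only [List.flatMap_cons] at h
    obtain ⟨h1, h2⟩ := List.append_inj h (by rw [hg, hg])
    rw [hi h1, List.flatMap_injective_of_length hk hg hi h2]

theorem List.sum_map_flatMap {A B : Type*} (l : List A) (f : A → List B) (g : B → ℕ) :
    ((l.flatMap f).map g).sum = (l.map fun a => ((f a).map g).sum).sum := by
  induction l with
  | nil => rfl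
  | cons a l ih => simp [ih]

namespace ListsEdges

variable {n M : ℕ} {G : SimpleGraph (Fin n)} {Q : Finset (Fin n)}
  {es : Fin M → List (Fin n × Fin n)}

theorem adj (h : ListsEdges G Q es) {j : Fin M} {e : Fin n × Fin n} (he : e ∈ es j) :
    G.Adj e.1 e.2 ∧ e.1 ∈ Q ∧ e.2 ∈ Q :=
  (h.2 e.1 e.2).1 (List.mem_map.2 ⟨e, List.mem_flatMap.2 ⟨j, List.mem_finRange j, he⟩, rfl⟩)

/-- The edges with both ends in a subset. -/
theorem filter (h : ListsEdges G Q es) {Q' : Finset (Fin n)} (hQ : Q' ⊆ Q)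
    {p : Fin n × Fin n → Bool} (hp : ∀ j, ∀ e ∈ es j, p e ↔ e.1 ∈ Q' ∧ e.2 ∈ Q') :
    ListsEdges G Q' fun j => (es j).filter p := by
  have e1 : (List.finRange M).flatMap (fun j => (es j).filter p) =
      ((List.finRange M).flatMap es).filter p := by
    rw [List.filter_flatMap]
  refine ⟨?_, fun u v => ?_⟩
  · rw [e1]
    exact h.1.sublist (List.filter_sublist.map _)
  · rw [e1]
    simp only [List.mem_map, List.mem_filter]
    constructor
    · rintro ⟨e, ⟨h1, h2⟩, h3⟩
      obtain ⟨j, -, hj⟩ := List.mem_flatMap.1 h1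
      have h4 := (hp j e hj).1 h2
      have h5 := h.adj hj
      rcases Sym2.eq_iff.1 h3 with ⟨rfl, rfl⟩ | ⟨rfl, rfl⟩
      · exact ⟨h5.1, h4⟩
      · exact ⟨h5.1.symm, h4.2, h4.1⟩
    · rintro ⟨h1, h2, h3⟩
      obtain ⟨e, he, h4⟩ := List.mem_map.1 ((h.2 u v).2 ⟨h1, hQ h2, hQ h3⟩)
      obtain ⟨j, -, hj⟩ := List.mem_flatMap.1 he
      refine ⟨e, ⟨he, (hp j e hj).2 ?_⟩, h4⟩
      rcases Sym2.eq_iff.1 h4 with ⟨rfl, rfl⟩ | ⟨rfl, rfl⟩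
      · exact ⟨h2, h3⟩
      · exact ⟨h3, h2⟩

/-- A sum over the arcs of all listed edges. -/
theorem sum_arcs [DecidableRel G.Adj] (h : ListsEdges G Q es) (ψ : Fin n → Fin n → ℕ) :
    ∑ j, ((es j).map fun e => ψ e.1 e.2 + ψ e.2 e.1).sum =
      ∑ u, ∑ v, if G.Adj u v ∧ u ∈ Q ∧ v ∈ Q then ψ u v else 0 := by
  set L := (List.finRange M).flatMap es with hL
  let arcs : List (Fin n × Fin n) := L.flatMap fun e => [(e.1, e.2), (e.2, e.1)]
  have hadj : ∀ e ∈ L, G.Adj e.1 e.2 ∧ e.1 ∈ Q ∧ e.2 ∈ Q := fun e he =>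
    (h.2 e.1 e.2).1 (List.mem_map.2 ⟨e, he, rfl⟩)
  have h1 : ∑ j, ((es j).map fun e => ψ e.1 e.2 + ψ e.2 e.1).sum =
      (L.map fun e => ψ e.1 e.2 + ψ e.2 e.1).sum := by
    rw [hL, List.sum_map_flatMap, ← List.sum_ofFn, List.ofFn_eq_map]
  have h2 : (L.map fun e => ψ e.1 e.2 + ψ e.2 e.1).sum = (arcs.map fun a => ψ a.1 a.2).sum := by
    simp only [arcs]
    rw [List.sum_map_flatMap L]
    simp
  have hnd : arcs.Nodup := by
    rw [List.nodup_flatMap]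
    refine ⟨fun e he => ?_, ?_⟩
    · have hne := G.ne_of_adj (hadj e he).1
      simp only [List.nodup_cons, List.mem_cons, List.not_mem_nil, or_false, Prod.mk.injEq,
        not_false_eq_true, List.nodup_nil, and_true, not_and]
      exact fun h1 _ => hne h1
    · refine (List.pairwise_map.1 h.1).imp fun {e e'} hne => ?_
      simp only [Function.onFun]
      intro a ha ha'
      apply hne
      simp only [List.mem_cons, List.not_mem_nil, or_false] at ha ha'
      rcases ha with rfl | rfl <;> rcases ha' with ha' | ha' <;> rw [Prod.mk.injEq] at ha' <;>
        simp [ha'.1, ha'.2, Sym2.eq_swap]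
  rw [h1, h2, ← List.sum_toFinset _ hnd, ← Finset.sum_product', ← Finset.sum_filter]
  refine Finset.sum_congr ?_ fun _ _ => rfl
  ext ⟨u, v⟩
  have h3 : s(u, v) ∈ L.map (fun e => s(e.1, e.2)) ↔ G.Adj u v ∧ u ∈ Q ∧ v ∈ Q := h.2 u v
  simp only [Finset.mem_filter, Finset.mem_product, Finset.mem_univ, true_and, ← h3,
    List.mem_toFinset, arcs, List.mem_flatMap, List.mem_map, List.mem_cons, List.not_mem_nil,
    or_false, Prod.mk.injEq, Sym2.eq_iff]
  refine exists_congr fun e => and_congr_right fun _ => ?_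
  tauto

end ListsEdges

namespace MPC

open Enc

/-- Local computation without a fixed-width encoding, needed to pass between `graphMemory`, whose
length varies, and arrays. -/
theorem reach_of_local {Ω : Type*} {M S W : ℕ} {c c' : Ω → Fin M → List ℕ}
    (h : ∀ ω ω' j, c ω j = c ω' j → c' ω j = c' ω' j)
    (hb : ∀ ω j, (c' ω j).length ≤ S ∧ ∀ x ∈ c' ω j, x < W) : Reach S W 1 c c' :=
  Round.reach ⟨c', fun _ _ _ => [], fun ω ω' j e => ⟨h ω ω' j e, rfl⟩, fun ω j => by simp,
    by simp, hb⟩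

/-- The two directions of all edges in a list. -/
def arcList {n : ℕ} (l : List (Fin n × Fin n)) : List (Fin n × Fin n) :=
  l.flatMap fun e => [(e.1, e.2), (e.2, e.1)]

theorem length_arcList {n : ℕ} (l : List (Fin n × Fin n)) : (arcList l).length = 2 * l.length := by
  simp [arcList, List.length_flatMap, mul_comm]

/-- The array of the arcs of listed edges, with `b` cells on each machine. -/
def arcArray {n M : ℕ} (b : ℕ) (es : Fin M → List (Fin n × Fin n)) (p : ℕ) : Option Arc :=
  if h : p / b < M then
    ((arcList (es ⟨p / b, h⟩))[p % b]?).map fun a => ⟨a.1, a.2, p, 0, 0, 0, 0⟩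
  else none

theorem arcArray_cell {n M b : ℕ} {es : Fin M → List (Fin n × Fin n)} (j : Fin M) (i : Fin b) :
    arcArray b es (b * j + i) =
      ((arcList (es j))[(i : ℕ)]?).map fun a => ⟨a.1, a.2, b * j + i, 0, 0, 0, 0⟩ := by
  have hb : 0 < b := i.pos
  have h1 : (b * j + i) / b = j := by
    rw [Nat.mul_add_div hb, Nat.div_eq_of_lt i.2, add_zero]
  have h2 : (b * j + i) % b = i := by rw [Nat.mul_add_mod, Nat.mod_eq_of_lt i.2]
  rw [arcArray, dif_pos (by rw [h1]; exact j.2), h2]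
  simp only [h1]

theorem sum_cells {M b : ℕ} (g : ℕ → ℕ) :
    ∑ p ∈ Finset.range (M * b), g p = ∑ j : Fin M, ∑ i : Fin b, g (b * j + i) := by
  induction M with
  | zero => simp
  | succ M ih =>
    rw [Fin.sum_univ_castSucc, Nat.succ_mul, Finset.sum_range_add, ih]
    simp only [Fin.val_castSucc, Fin.val_last]
    rw [Finset.sum_range (fun i => g (M * b + i)), mul_comm M b]

theorem sum_getElem? {A : Type*} (l : List A) {b : ℕ} (hb : l.length ≤ b) (g : A → ℕ) :
    ∑ i : Fin b, (l[(i : ℕ)]?).elim 0 g = (l.map g).sum := by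
  rw [← Finset.sum_range (fun i => (l[i]?).elim 0 g)]
  induction l generalizing b with
  | nil => simp
  | cons x l ih =>
    obtain ⟨b, rfl⟩ : ∃ b', b = b' + 1 := ⟨b - 1, by simp at hb; omega⟩
    rw [Finset.sum_range_succ']
    simp only [List.getElem?_cons_succ, List.getElem?_cons_zero, Option.elim_some, List.map_cons,
      List.sum_cons]
    rw [ih (by simpa using hb), add_comm]

variable {n M b : ℕ} {G : SimpleGraph (Fin n)} {Q : Finset (Fin n)}
  {es : Fin M → List (Fin n × Fin n)}

/-- The bridge between array and graph: degrees, existence of arcs, numbers of arcs and of copies,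
and the wedge count are all instances of such sums. -/
theorem sum_arcArray [DecidableRel G.Adj] (h : ListsEdges G Q es) (hb : ∀ j, 2 * (es j).length ≤ b)
    (ψ : ℕ → ℕ → ℕ) :
    ∑ p ∈ Finset.range (M * b), (arcArray b es p).elim 0 (fun r => ψ r.u r.v) =
      ∑ u : Fin n, ∑ v : Fin n, if G.Adj u v ∧ u ∈ Q ∧ v ∈ Q then ψ u v else 0 := by
  rw [sum_cells, ← h.sum_arcs fun u v => ψ u v]
  refine Finset.sum_congr rfl fun j _ => ?_
  have h1 := sum_getElem? (arcList (es j)) (b := b) (by rw [length_arcList]; exact hb j)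
    fun a => ψ a.1 a.2
  have h2 : ((arcList (es j)).map fun a => ψ a.1 a.2).sum =
      ((es j).map fun e => ψ e.1 e.2 + ψ e.2 e.1).sum := by
    rw [arcList, List.sum_map_flatMap]
    simp
  rw [← h2, ← h1]
  refine Finset.sum_congr rfl fun i _ => ?_
  rw [arcArray_cell]
  cases (arcList (es j))[(i : ℕ)]? <;> rfl

/-- The degrees in `G[Q]`, and `0` for vertices outside of `Q`. -/
def degOf (G : SimpleGraph (Fin n)) [DecidableRel G.Adj] (Q : Finset (Fin n)) (u : ℕ) : ℕ :=
  if h : u < n then if (⟨u, h⟩ : Fin n) ∈ Q then deg G Q ⟨u, h⟩ else 0 else 0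

theorem degOf_val [DecidableRel G.Adj] {u : Fin n} (hu : u ∈ Q) : degOf G Q u = deg G Q u := by
  simp [degOf, hu]

theorem degOf_le [DecidableRel G.Adj] (u : ℕ) : degOf G Q u ≤ n := by
  unfold degOf
  split_ifs
  · exact deg_le G Q _
  · omega
  · omega

theorem sum_adj [DecidableRel G.Adj] (ψ : Fin n → ℕ) :
    (∑ u : Fin n, ∑ v : Fin n, if G.Adj u v ∧ u ∈ Q ∧ v ∈ Q then ψ u else 0) =
      ∑ u ∈ Q, deg G Q u * ψ u := by
  rw [← Finset.sum_subset (Finset.subset_univ Q)]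
  · refine Finset.sum_congr rfl fun u hu => ?_
    rw [← Finset.sum_filter, Finset.sum_const, smul_eq_mul, deg, nbrs]
    congr 2
    ext v
    simp [hu, and_comm]
  · intro u _ hu
    simp [hu]

theorem arcArray_eq_some {p : ℕ} {r : Arc} (h : arcArray b es p = some r) :
    r.home = p ∧ r.u < n ∧ r.v < n ∧ r.dv = 0 ∧ r.du = 0 ∧ r.rank = 0 ∧ r.pos = 0 := by
  unfold arcArray at h
  split_ifs at h with h1
  obtain ⟨a, -, rfl⟩ := Option.map_eq_some_iff.1 h
  exact ⟨rfl, a.1.2, a.2.2, rfl, rfl, rfl, rfl⟩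

theorem sum_keyU (x : ℕ → Option Arc) (N : ℕ) {u : ℕ} (hu : u < n) :
    ∑ q ∈ Finset.range N, (if keyU n (x q) = u then count (x q) else 0) =
      ∑ q ∈ Finset.range N, (x q).elim 0 fun r => if r.u = u then 1 else 0 := by
  refine Finset.sum_congr rfl fun q _ => ?_
  cases x q with
  | none => exact if_neg hu.ne'
  | some r => rfl

theorem sum_keyV (x : ℕ → Option Arc) (N : ℕ) {u : ℕ} (hu : u < n) :
    ∑ q ∈ Finset.range N, (if keyV n (x q) = u then count (x q) else 0) =
      ∑ q ∈ Finset.range N, (x q).elim 0 fun r => if r.v = u then 1 else 0 := by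
  refine Finset.sum_congr rfl fun q _ => ?_
  cases x q with
  | none => exact if_neg hu.ne'
  | some r => rfl

theorem hasArc_iff (h : ListsEdges G Q es) (hb : ∀ j, 2 * (es j).length ≤ b) (v w : Fin n) :
    HasArc (M * b) (arcArray b es) v w ↔ G.Adj v w ∧ v ∈ Q ∧ w ∈ Q := by
  classical
  have h1 := sum_arcArray h hb fun u u' => if u = v ∧ u' = w then 1 else 0
  have h2 : HasArc (M * b) (arcArray b es) v w ↔ 0 < ∑ p ∈ Finset.range (M * b),
      (arcArray b es p).elim 0 (fun r => if r.u = v ∧ r.v = w then 1 else 0) := by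
    rw [Finset.sum_pos_iff]
    refine exists_congr fun p => and_congr Finset.mem_range.symm ?_
    cases arcArray b es p with
    | none => simp
    | some r =>
      simp only [Option.some.injEq, exists_eq_left', Option.elim_some]
      split_ifs with h <;> simp [h]
  rw [h2, h1]
  have h3 : (∑ u : Fin n, ∑ v' : Fin n, if G.Adj u v' ∧ u ∈ Q ∧ v' ∈ Q then
      (if (u : ℕ) = v ∧ (v' : ℕ) = w then 1 else 0) else 0) =
      if G.Adj v w ∧ v ∈ Q ∧ w ∈ Q then 1 else 0 := by
    rw [Finset.sum_eq_single v, Finset.sum_eq_single w]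
    · simp
    · intro x _ hx
      simp [Fin.val_inj, hx]
    · simp
    · intro x _ hx
      simp [Fin.val_inj, hx]
    · simp
  rw [h3]
  split_ifs with h <;> simp [h]

/-- At a low vertex `u`, `Closing` together with the closing arc says that `u` precedes both ends
and that the ends are increasing, which is the representative selected in `hits`. -/
theorem closedWedges_arcArray [DecidableRel G.Adj] (h : ListsEdges G Q es)
    (hb : ∀ j, 2 * (es j).length ≤ b) {lo : ℕ → Prop} [DecidablePred lo] {A : Finset (Fin n)}
    (hA : ∀ v, v ∈ A ↔ v ∈ Q ∧ lo (deg G Q v)) :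
    closedWedges (M * b) lo (degOf G Q) (arcArray b es) = hits G A Q := by
  classical
  set x := arcArray b es with hx
  set d := degOf G Q
  have h1 : ∀ u v : ℕ, ∑ p' ∈ Finset.range (M * b), (x p').elim 0 (fun r' => if r'.u = u then
      if Closing lo u (v, d v) (r'.v, d r'.v) ∧ HasArc (M * b) x v r'.v then 1 else 0 else 0) =
      ∑ u' : Fin n, ∑ w : Fin n, if G.Adj u' w ∧ u' ∈ Q ∧ w ∈ Q then
        (if u' = u then if Closing lo u (v, d v) (w, d w) ∧ HasArc (M * b) x v w then 1 else 0
          else 0) else 0 := fun u v => sum_arcArray h hb fun u' w => if u' = u then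
      if Closing lo u (v, d v) (w, d w) ∧ HasArc (M * b) x v w then 1 else 0 else 0
  unfold closedWedges
  simp only [h1]
  rw [sum_arcArray h hb fun u v => if lo (d u) then ∑ u' : Fin n, ∑ w : Fin n,
    if G.Adj u' w ∧ u' ∈ Q ∧ w ∈ Q then (if u' = u then
      if Closing lo u (v, d v) (w, d w) ∧ HasArc (M * b) x v w then 1 else 0 else 0) else 0 else 0]
  unfold hits
  refine Finset.sum_congr rfl fun u _ => Finset.sum_congr rfl fun v _ => ?_
  by_cases huv : G.Adj u v ∧ u ∈ Q ∧ v ∈ Q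
  · rw [if_pos huv]
    have hu : d u = deg G Q u := degOf_val huv.2.1
    have hv : d v = deg G Q v := degOf_val huv.2.2
    by_cases hl : lo (d u)
    · rw [if_pos hl, Finset.sum_eq_single u]
      · refine Finset.sum_congr rfl fun w _ => ?_
        by_cases huw : G.Adj u w ∧ u ∈ Q ∧ w ∈ Q
        · have hw : d w = deg G Q w := degOf_val huw.2.2
          rw [if_pos huw, if_pos rfl]
          refine if_congr ?_ rfl rfl
          rw [hasArc_iff h hb]
          rw [hu] at hl
          simp only [Closing, IsTriangle, Precedes, hA, hv, hw, huv, huw, hl, Fin.lt_def,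
            true_and, and_true]
          tauto
        · rw [if_neg huw, if_neg]
          rintro ⟨⟨h2, h3⟩, -⟩
          exact huw ⟨h3.2.2, h2.1, h2.2.2⟩
      · intro u' _ hu'
        simp [Fin.val_inj, hu']
      · simp
    · rw [if_neg hl]
      refine (Finset.sum_eq_zero fun w _ => if_neg ?_).symm
      rintro ⟨-, h2, -⟩
      apply hl
      rw [hu]
      exact ((hA u).1 h2.1).2
  · rw [if_neg huv]
    refine (Finset.sum_eq_zero fun w _ => if_neg ?_).symm
    rintro ⟨h2, -⟩
    exact huv ⟨h2.2.1, h2.1.1, h2.1.2.1⟩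

/-- Besides counting, this shows that the degrees are determined by the listed edges alone. -/
theorem degOf_eq_sum [DecidableRel G.Adj] (h : ListsEdges G Q es)
    (hb : ∀ j, 2 * (es j).length ≤ b) (u : ℕ) : degOf G Q u =
      ∑ p ∈ Finset.range (M * b), (arcArray b es p).elim 0 fun r => if r.u = u then 1 else 0 := by
  rw [sum_arcArray h hb fun u' _ => if u' = u then 1 else 0,
    sum_adj fun u' : Fin n => if (u' : ℕ) = u then 1 else 0]
  by_cases hu : u < n
  · have e : ∀ u' : Fin n, ((u' : ℕ) = u ↔ u' = ⟨u, hu⟩) := fun u' => by rw [Fin.ext_iff]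
    simp [e, degOf, hu]
  · rw [degOf, dif_neg hu, Finset.sum_eq_zero]
    intro u' _
    rw [if_neg, mul_zero]
    have := u'.2
    omega

theorem arcArray_spec [DecidableRel G.Adj] (h : ListsEdges G Q es)
    (hb : ∀ j, 2 * (es j).length ≤ b) {lo : ℕ → Prop} [DecidablePred lo] {A : Finset (Fin n)}
    (hA : ∀ v, v ∈ A ↔ v ∈ Q ∧ lo (deg G Q v)) {off : ℕ} (hoff : ∑ v ∈ Q, deg G Q v ≤ off)
    (hcop : off + ∑ v ∈ A, deg G Q v ^ 2 ≤ M * b) :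
    ArcArray n (M * b) off lo (degOf G Q) (arcArray b es) where
  u_lt p _ r hr := (arcArray_eq_some hr).2.1
  v_lt p _ r hr := (arcArray_eq_some hr).2.2.1
  home_eq p _ r hr := (arcArray_eq_some hr).1
  countU u hu := by rw [sum_keyU _ _ hu, degOf_eq_sum h hb]
  countV u hu := by
    -- Arcs come in both directions, so in-degrees equal out-degrees.
    rw [sum_keyV _ _ hu, degOf_eq_sum h hb, sum_arcArray h hb fun _ v' => if v' = u then 1 else 0,
      sum_arcArray h hb fun u' _ => if u' = u then 1 else 0, Finset.sum_comm]
    refine Finset.sum_congr rfl fun v _ => Finset.sum_congr rfl fun w _ => if_congr ?_ rfl rfl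
    rw [G.adj_comm]
    tauto
  count_le := by
    refine le_trans (le_of_eq ?_) hoff
    have h1 : ∀ o : Option Arc, count o = o.elim 0 fun _ => 1 := fun _ => rfl
    simp only [h1]
    rw [sum_arcArray h hb fun _ _ => 1, sum_adj fun _ : Fin n => 1]
    simp
  -- A low vertex of degree `d` is the origin of `d` arcs with `d` copies each, which gives `d²`.
  copies_le := by
    refine le_trans (Nat.add_le_add_left (le_of_eq ?_) off) hcop
    have hA' : A = Q.filter fun v => lo (deg G Q v) := by
      ext v
      rw [hA, Finset.mem_filter]
    rw [sum_arcArray h hb fun u _ => if lo (degOf G Q u) then degOf G Q u else 0,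
      sum_adj fun u : Fin n => if lo (degOf G Q u) then degOf G Q u else 0, hA',
      Finset.sum_filter]
    refine Finset.sum_congr rfl fun u hu => ?_
    rw [degOf_val hu]
    split_ifs <;> ring

/-! ### One iteration of the procedure -/

theorem graphMemory_injective {es es' : Fin M → List (Fin n × Fin n)} {T T' : ℕ} {j : Fin M}
    (h : graphMemory es T j = graphMemory es' T' j) :
    (if (j : ℕ) = 0 then T else 0) = (if (j : ℕ) = 0 then T' else 0) ∧ es j = es' j := by
  rw [graphMemory, graphMemory, List.cons.injEq] at h
  refine ⟨h.1, List.flatMap_injective_of_length (k := 2) two_pos (fun _ => rfl) ?_ h.2⟩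
  intro e e' he
  simp only [List.cons.injEq, Fin.val_inj, and_true] at he
  exact Prod.ext he.1 he.2

theorem below_graphMemory {es : Fin M → List (Fin n × Fin n)} {T W : ℕ} (hn : n ≤ W) (hT : T < W)
    (j : Fin M) : ∀ x ∈ graphMemory es T j, x < W := by
  intro x hx
  rw [graphMemory, List.mem_cons] at hx
  rcases hx with rfl | hx
  · split_ifs <;> omega
  · obtain ⟨e, -, he⟩ := List.mem_flatMap.1 hx
    simp only [List.mem_cons, List.not_mem_nil, or_false] at he
    have h1 := e.1.2
    have h2 := e.2.2
    rcases he with rfl | rfl <;> omega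

theorem length_graphMemory {es : Fin M → List (Fin n × Fin n)} {T : ℕ} (j : Fin M) :
    (graphMemory es T j).length = 2 * (es j).length + 1 := by
  simp [graphMemory, List.length_flatMap, mul_comm]

/-- The edges in a list without an end of degree at most `γ`, together with the degrees. -/
theorem filter_eq_of_arcList {l l' : List (Fin n × Fin n)} {g g' : Fin n → ℕ} {γ : ℝ}
    {P P' : Fin n × Fin n → Bool} (hP : ∀ e ∈ l, P e ↔ γ < g e.1 ∧ γ < g e.2)
    (hP' : ∀ e ∈ l', P' e ↔ γ < g' e.1 ∧ γ < g' e.2)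
    (h : (arcList l).map (fun a => ((a.1, a.2), (g a.1, g a.2))) =
      (arcList l').map fun a => ((a.1, a.2), (g' a.1, g' a.2))) : l.filter P = l'.filter P' := by
  classical
  -- The two consecutive arcs of an edge, with the degrees of their ends; the first of them recovers
  -- the edge with its degrees.
  let φ : (Fin n × Fin n) × ℕ × ℕ → List ((Fin n × Fin n) × (ℕ × ℕ)) := fun c =>
    [((c.1.1, c.1.2), (c.2.1, c.2.2)), ((c.1.2, c.1.1), (c.2.2, c.2.1))]
  have e1 : ∀ (l : List (Fin n × Fin n)) (g : Fin n → ℕ),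
      (arcList l).map (fun a => ((a.1, a.2), (g a.1, g a.2))) =
      (l.map fun e => (e, (g e.1, g e.2))).flatMap φ := by
    intro l g
    rw [arcList, List.map_flatMap, List.flatMap_map]
    rfl
  rw [e1, e1] at h
  have h1 := List.flatMap_injective_of_length (k := 2) two_pos (fun _ => rfl) (fun c c' hc => by
    simp only [φ, List.cons.injEq] at hc
    exact hc.1) h
  have e2 : ∀ (l : List (Fin n × Fin n)) (g : Fin n → ℕ) (P : Fin n × Fin n → Bool),
      (∀ e ∈ l, P e ↔ γ < g e.1 ∧ γ < g e.2) → l.filter P =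
      ((l.map fun e => (e, (g e.1, g e.2))).filter
        fun c => decide (γ < c.2.1 ∧ γ < c.2.2)).map Prod.fst := by
    intro l g P hP
    rw [List.filter_map, List.map_map]
    rw [show (Prod.fst ∘ fun e : Fin n × Fin n => (e, (g e.1, g e.2))) = id from rfl, List.map_id]
    refine List.filter_congr fun e he => ?_
    rw [Bool.eq_iff_iff, hP e he]
    simp
  rw [e2 l g P hP, e2 l' g' P' hP', h1]

variable {Ω : Type*} {f D S W : ℕ}

/-- One iteration of the procedure. -/
theorem reach_iteration (hp : Params M f D S W) {G : Ω → SimpleGraph (Fin n)}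
    [∀ ω, DecidableRel (G ω).Adj] {Q : Ω → Finset (Fin n)} {es : Ω → Fin M → List (Fin n × Fin n)}
    {T : Ω → ℕ} {γ : ℝ} {off : ℕ} {P : Ω → Fin n × Fin n → Bool}
    (hes : ∀ ω, ListsEdges (G ω) (Q ω) (es ω)) (hlen : ∀ ω j, 2 * (es ω j).length ≤ f * f)
    (hoff : ∀ ω, ∑ v ∈ Q ω, deg (G ω) (Q ω) v ≤ off)
    (hcop : ∀ ω, off + ∑ v ∈ low (G ω) γ (Q ω), deg (G ω) (Q ω) v ^ 2 ≤ M * (f * f))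
    (hn : n * n < f ^ D) (hnW : n * n < W) (hT : ∀ ω, T ω < W)
    (hT' : ∀ ω, T ω + hits (G ω) (low (G ω) γ (Q ω)) (Q ω) < W)
    (hP : ∀ ω j, ∀ e ∈ es ω j, P ω e ↔ γ < deg (G ω) (Q ω) e.1 ∧ γ < deg (G ω) (Q ω) e.2) :
    Reach S W (countRounds D + 2) (fun ω => graphMemory (es ω) (T ω))
      (fun ω => graphMemory (fun j => (es ω j).filter (P ω))
        (T ω + hits (G ω) (low (G ω) γ (Q ω)) (Q ω))) := by
  classical
  have hf := hp.two_le
  have hsp := hp.space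
  have h4 := hp.four_le
  have hW1 := hp.one_lt
  have hnn : n ≤ n * n := Nat.le_mul_self n
  have hSW := hp.space_lt
  set b := f * f with hb
  let τ : Ω → Fin M → ℕ := fun ω j => if (j : ℕ) = 0 then T ω else 0
  have hτ : ∀ ω j, τ ω j < W := by
    intro ω j
    have := hT ω
    simp only [τ]
    split_ifs <;> omega
  let x : Ω → ℕ → Option Arc := fun ω => arcArray b (es ω)
  have hxb : ∀ ω, ∀ p < M * b, Below W (x ω p) := by
    intro ω p hp1
    have : M * b < W := hp.cells_lt
    rw [below_option hW1]
    intro r hr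
    obtain ⟨h1, h2, h3, h5, h6, h7, h8⟩ := arcArray_eq_some hr
    rw [below_arc]
    omega
  have hlist : ∀ ω (j : Fin M) (i : Fin b), x ω (b * j + i) =
      ((arcList (es ω j))[(i : ℕ)]?).map fun a => ⟨a.1, a.2, b * j + i, 0, 0, 0, 0⟩ :=
    fun ω j i => arcArray_cell j i
  have hA : ∀ ω v, v ∈ low (G ω) γ (Q ω) ↔ v ∈ Q ω ∧ (deg (G ω) (Q ω) v : ℝ) ≤ γ :=
    fun ω v => mem_low
  let d : Ω → ℕ → ℕ := fun ω => degOf (G ω) (Q ω)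
  have hd : ∀ ω u, d ω u < W := fun ω u => (degOf_le u).trans_lt (by omega)
  -- the array is filled
  have r1 : Reach S W 1 (fun ω => graphMemory (es ω) (T ω)) (arr M b τ x) := by
    refine reach_of_local (fun ω ω' j h => ?_) fun ω j => ⟨?_, below_block hτ hxb ω j⟩
    · obtain ⟨h1, h2⟩ := graphMemory_injective h
      refine congrArg enc (Prod.ext h1 (funext fun i => ?_))
      simp only [hlist, h2]
    · rw [arr, mem, length_enc, width_prod, width_nat, width_pi, width_option, width_arc]
      omega
  have r2 := reach_count hp (τ := τ) (low := fun k : ℕ => (k : ℝ) ≤ γ) (d := d) (x := x)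
    (fun ω => arcArray_spec (hes ω) (hlen ω) (hA ω) (hoff ω) (hcop ω)) hn hnW hd hτ hxb
  have htot : ∀ ω, closedWedges (M * b) (fun k : ℕ => (k : ℝ) ≤ γ) (d ω) (x ω) =
      hits (G ω) (low (G ω) γ (Q ω)) (Q ω) := fun ω =>
    closedWedges_arcArray (hes ω) (hlen ω) (hA ω)
  simp only [← hb, htot] at r2
  have r3 : Reach S W 1 (arr M b τ fun ω p => ((x ω p).map fun r => ((r.u, r.v), (d ω r.u, d ω r.v)),
      hits (G ω) (low (G ω) γ (Q ω)) (Q ω))) (fun ω => graphMemory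
        (fun j => (es ω j).filter (P ω)) (T ω + hits (G ω) (low (G ω) γ (Q ω)) (Q ω))) := by
    refine reach_of_local (fun ω ω' j h => ?_) fun ω j =>
      ⟨?_, below_graphMemory (by omega) (hT' ω) j⟩
    · have h1 := injective_enc h
      rw [Prod.mk.injEq] at h1
      obtain ⟨h1, h2⟩ := h1
      have h2 := fun i => congrFun h2 i
      simp only [Prod.mk.injEq] at h2
      -- Every cell carries the number of new triangles; the first cell of the machine is enough to
      -- update the counter.
      have h3 := (h2 ⟨0, by omega⟩).2
      have h5 : (es ω j).filter (P ω) = (es ω' j).filter (P ω') := by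
        refine filter_eq_of_arcList (g := fun v => d ω v) (g' := fun v => d ω' v) (γ := γ) ?_ ?_ ?_
        · intro e he
          have := (hes ω).adj he
          rw [hP ω j e he, ← degOf_val this.2.1, ← degOf_val this.2.2]
        · intro e he
          have := (hes ω').adj he
          rw [hP ω' j e he, ← degOf_val this.2.1, ← degOf_val this.2.2]
        · refine List.ext_getElem? fun i => ?_
          rcases Nat.lt_or_ge i b with hi | hi
          · have h6 := (h2 ⟨i, hi⟩).1
            have e1 := hlist ω j ⟨i, hi⟩
            have e2 := hlist ω' j ⟨i, hi⟩
            simp only at e1 e2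
            rw [e1, e2, Option.map_map, Option.map_map] at h6
            rw [List.getElem?_map, List.getElem?_map]
            have hinj : Function.Injective
                fun c : (Fin n × Fin n) × (ℕ × ℕ) => (((c.1.1 : ℕ), (c.1.2 : ℕ)), c.2) := by
              intro c c' hc
              simp only [Prod.mk.injEq, Fin.val_inj] at hc
              exact Prod.ext (Prod.ext hc.1.1 hc.1.2) hc.2
            apply Option.map_injective hinj
            rw [Option.map_map, Option.map_map]
            exact h6
          · rw [List.getElem?_eq_none, List.getElem?_eq_none]
            · rw [List.length_map, length_arcList]; exact (hlen ω' j).trans hi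
            · rw [List.length_map, length_arcList]; exact (hlen ω j).trans hi
      simp only [graphMemory, h5]
      congr 1
      by_cases hj : (j : ℕ) = 0
      · simp only [τ, hj, if_true] at h1 ⊢
        rw [h1, h3]
      · simp [hj]
    · rw [length_graphMemory]
      have h1 := (List.filter_sublist (p := P ω) (l := es ω j)).length_le
      have h2 := hlen ω j
      omega
  have := (r1.trans r2).trans r3
  rwa [show 1 + countRounds D + 1 = countRounds D + 2 by ring] at this

end MPC

/-! ### Simulation of all iterations -/

namespace MPC

/-- The admissible inputs: a graph with `m` edges and of arboricity at most `α`, whose edges are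
evenly distributed. -/
structure Input (n m α M : ℕ) where
  graph : SimpleGraph (Fin n)
  [decAdj : DecidableRel graph.Adj]
  edges : Fin M → List (Fin n × Fin n)
  card_eq : graph.edgeFinset.card = m
  arboricity_le : arboricity graph ≤ α
  lists : ListsEdges graph Finset.univ edges
  length_le : ∀ j, (edges j).length ≤ m ⌈/⌉ M

attribute [instance] Input.decAdj

namespace Input

variable {n m α M : ℕ} (ω : Input n m α M)

/-- The unprocessed vertices at the beginning of iteration `i`. -/
noncomputable abbrev rest (i : ℕ) : Finset (Fin n) := remaining ω.graph α i

/-- The edges between unprocessed vertices at the beginning of iteration `i`. -/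
noncomputable def edgesAt (i : ℕ) (j : Fin M) : List (Fin n × Fin n) :=
  (ω.edges j).filter fun e => decide (e.1 ∈ ω.rest i ∧ e.2 ∈ ω.rest i)

theorem lists_edgesAt (i : ℕ) : ListsEdges ω.graph (ω.rest i) (ω.edgesAt i) :=
  ω.lists.filter (Finset.subset_univ _) fun j e _ => by simp

theorem edgesAt_zero : ω.edgesAt 0 = ω.edges := by
  funext j
  simp [edgesAt, rest, remaining]

theorem length_edgesAt_le (i : ℕ) (j : Fin M) : (ω.edgesAt i j).length ≤ m ⌈/⌉ M :=
  (List.filter_sublist.length_le).trans (ω.length_le j)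

-- The degrees of its two ends decide whether an edge survives. Edges are only deleted in place, so
-- the initial bound on the lists remains valid.
open Classical in
theorem edgesAt_succ (i : ℕ) (j : Fin M) : ω.edgesAt (i + 1) j = (ω.edgesAt i j).filter fun e =>
    decide (threshold α i < deg ω.graph (ω.rest i) e.1 ∧
      threshold α i < deg ω.graph (ω.rest i) e.2) := by
  rw [edgesAt, edgesAt, List.filter_filter]
  refine List.filter_congr fun e _ => ?_
  simp only [rest, mem_remaining_succ]
  rw [Bool.eq_iff_iff]
  simp only [decide_eq_true_eq, Bool.and_eq_true]
  tauto

/-- The configuration at the beginning of iteration `i`. -/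
noncomputable def config (n m α M i : ℕ) (ω : Input n m α M) : Fin M → List ℕ :=
  graphMemory (ω.edgesAt i) (found ω.graph α i)

theorem config_bounds {S W : ℕ} (hS : 2 * (m ⌈/⌉ M) + 1 ≤ S) (hn : n ≤ W) (hW : n ^ 3 < W)
    (i : ℕ) (j : Fin M) : (config n m α M i ω j).length ≤ S ∧ ∀ x ∈ config n m α M i ω j, x < W := by
  refine ⟨?_, below_graphMemory hn ((found_le _ _ _).trans_lt hW) j⟩
  rw [config, length_graphMemory]
  have := ω.length_edgesAt_le i j
  omega

/-- A program from a simulation of the iterations. -/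
theorem exists_program {S W ℓ : ℕ}
    (h : ∀ i < iterations n, Reach S W ℓ (config n m α M i) (config n m α M (i + 1)))
    (hS : 2 * (m ⌈/⌉ M) + 1 ≤ S) (hn : n ≤ W) (hW : n ^ 3 < W) :
    ∃ P : MPCProgram M, ∀ (G : SimpleGraph (Fin n)) [DecidableRel G.Adj],
      G.edgeFinset.card = m → arboricity G ≤ α → ∀ es : Fin M → List (Fin n × Fin n),
        ListsEdges G Finset.univ es → (∀ j, (es j).length ≤ m ⌈/⌉ M) →
        P.RespectsSpace (graphMemory es 0) (ℓ * iterations n) S W ∧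
        (∀ i ≤ iterations n, ∃ (es' : Fin M → List (Fin n × Fin n)) (T : ℕ),
          ListsEdges G (remaining G α i) es' ∧ (T : ℚ) = counter G α i ∧
          P.run (graphMemory es 0) (ℓ * i) = graphMemory es' T) ∧
        ∀ j : Fin M, P.run (graphMemory es 0) (ℓ * iterations n) j =
          [if (j : ℕ) = 0 then (G.cliqueFinset 3).card else 0] := by
  obtain ⟨P, hP⟩ := MPC.exists_program h fun ω j => ω.config_bounds hS hn hW 0 j
  refine ⟨P, fun G _ hm hα es hes hlen => ?_⟩
  let ω : Input n m α M := ⟨G, es, hm, hα, hes, hlen⟩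
  obtain ⟨h1, h2⟩ := hP ω
  have h0 : config n m α M 0 ω = graphMemory es 0 := by
    rw [config, edgesAt_zero]
    rfl
  rw [h0] at h1 h2
  refine ⟨h1, fun i hi => ⟨ω.edgesAt i, found G α i, ω.lists_edgesAt i, ?_, h2 i hi⟩, fun j => ?_⟩
  · rw [counter_eq_found]
  · rw [h2 _ le_rfl, config]
    have h3 : ω.edgesAt (iterations n) j = [] := by
      rw [List.eq_nil_iff_forall_not_mem]
      intro e he
      have := (ω.lists_edgesAt _).adj he
      exact not_adj_of_mem_remaining_iterations G hα this.2.1 this.2.2 this.1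
    have h4 : found ω.graph α (iterations n) = (G.cliqueFinset 3).card := found_iterations G hα
    rw [graphMemory, h3, h4]
    rfl

theorem config_succ (i : ℕ) : config n m α M (i + 1) = fun ω => graphMemory
    (open Classical in fun j => (ω.edgesAt i j).filter fun e =>
      decide (threshold α i < deg ω.graph (ω.rest i) e.1 ∧
        threshold α i < deg ω.graph (ω.rest i) e.2))
    (found ω.graph α i + hits ω.graph (low ω.graph (threshold α i) (ω.rest i)) (ω.rest i)) := by
  funext ω
  rw [config, found, Finset.sum_range_succ]
  congr 1
  funext j
  exact ω.edgesAt_succ i j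

/-- The simulation of an iteration on many machines. -/
theorem reach_config {f D S W : ℕ} (hp : Params M f D S W) (hlen : 2 * (m ⌈/⌉ M) ≤ f * f)
    (hN : 2 * m + 8 * (m * min α n) ≤ M * (f * f)) (hn : n * n < f ^ D) (hnW : n * n < W)
    (hW : n ^ 3 < W) (i : ℕ) :
    Reach S W (countRounds D + 2) (config n m α M i) (config n m α M (i + 1)) := by
  classical
  have hT : ∀ (ω : Input n m α M) i, found ω.graph α i < W := fun ω i => (found_le _ _ _).trans_lt hW
  rw [config_succ]
  refine reach_iteration hp (G := Input.graph) (Q := fun ω => ω.rest i) (off := 2 * m)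
    (fun ω => ω.lists_edgesAt i) (fun ω j => ?_) (fun ω => ?_) (fun ω => ?_) hn hnW
    (fun ω => hT ω i) (fun ω => ?_) fun ω j e _ => by simp
  · have := ω.length_edgesAt_le i j
    omega
  · have := sum_deg_remaining_le ω.graph α i
    rwa [ω.card_eq] at this
  · have := sum_low_sq_le_min ω.graph ω.arboricity_le i
    rw [ω.card_eq] at this
    exact (Nat.add_le_add_left this _).trans hN
  · have := hT ω (i + 1)
    rwa [found, Finset.sum_range_succ] at this

/-- The simulation of an iteration on a single machine. -/
theorem reach_config_single {S W : ℕ} (hS : 2 * (m ⌈/⌉ 1) + 1 ≤ S) (hn : n ≤ W) (hW : n ^ 3 < W)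
    (i : ℕ) : Reach S W 1 (config n m α 1 i) (config n m α 1 (i + 1)) := by
  classical
  refine reach_of_local (fun ω ω' j h => ?_) fun ω j => ω.config_bounds hS hn hW (i + 1) j
  obtain ⟨h1, h2⟩ := graphMemory_injective h
  have hj : (j : ℕ) = 0 := by omega
  simp only [hj, if_true] at h1
  have h3 : ω.edgesAt i = ω'.edgesAt i := by
    funext j'
    rwa [Subsingleton.elim j' j]
  -- There is only one list of edges, so an array of twice its length holds all arcs. The degrees
  -- and the number of hits are expressed through this array, hence they depend on the memory only.
  have hb : ∀ j', 2 * (ω.edgesAt i j').length ≤ 2 * (ω.edgesAt i j).length := fun j' => by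
    rw [Subsingleton.elim j' j]
  have hb' := hb
  rw [h3] at hb'
  have hd : degOf ω.graph (ω.rest i) = degOf ω'.graph (ω'.rest i) := by
    funext u
    rw [degOf_eq_sum (ω.lists_edgesAt i) hb, degOf_eq_sum (ω'.lists_edgesAt i) (h3 ▸ hb), h3]
  have hhits : hits ω.graph (low ω.graph (threshold α i) (ω.rest i)) (ω.rest i) =
      hits ω'.graph (low ω'.graph (threshold α i) (ω'.rest i)) (ω'.rest i) := by
    rw [← closedWedges_arcArray (ω.lists_edgesAt i) hb (lo := fun k => (k : ℝ) ≤ threshold α i)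
      fun v => mem_low, ← closedWedges_arcArray (ω'.lists_edgesAt i) (h3 ▸ hb)
      (lo := fun k => (k : ℝ) ≤ threshold α i) fun v => mem_low, hd, h3]
  have hdeg : ∀ e ∈ ω'.edgesAt i j, deg ω.graph (ω.rest i) e.1 = deg ω'.graph (ω'.rest i) e.1 ∧
      deg ω.graph (ω.rest i) e.2 = deg ω'.graph (ω'.rest i) e.2 := by
    intro e he
    have a := (ω.lists_edgesAt i).adj (h2 ▸ he)
    have a' := (ω'.lists_edgesAt i).adj he
    rw [← degOf_val a.2.1, ← degOf_val a.2.2, ← degOf_val a'.2.1, ← degOf_val a'.2.2, hd]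
    exact ⟨rfl, rfl⟩
  have h5 : ω.edgesAt (i + 1) j = ω'.edgesAt (i + 1) j := by
    rw [edgesAt_succ, edgesAt_succ, h2]
    refine List.filter_congr fun e he => ?_
    rw [(hdeg e he).1, (hdeg e he).2]
  have h6 : found ω.graph α (i + 1) = found ω'.graph α (i + 1) := by
    rw [found, found, Finset.sum_range_succ, Finset.sum_range_succ, hhits]
    exact congrArg (· + _) h1
  rw [config, config, graphMemory, graphMemory, h5, h6]

end Input

end MPC

/-! ### Choice of the parameters -/

theorem CountTriangles.iterations_le (n : ℕ) :
    (iterations n : ℝ) ≤ 4 * max 1 (Real.logb 2 (Real.logb 2 n)) := by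
  set y := Real.logb 2 (Real.logb 2 n) with hy
  set z := Real.logb (3 / 2) (Real.logb 2 n) with hz
  have h2 : 0 < Real.log 2 := Real.log_pos (by norm_num)
  have h3 : 0 < Real.log (3 / 2) := Real.log_pos (by norm_num)
  -- Since `(3/2)² = 9/4 ≥ 2`, changing the base of the logarithm costs a factor of at most 2.
  have h4 : Real.log 2 ≤ 2 * Real.log (3 / 2) := by
    have h5 : Real.log ((3 / 2 : ℝ) ^ 2) = 2 * Real.log (3 / 2) := by
      rw [Real.log_pow]; norm_num
    rw [← h5]
    exact Real.log_le_log (by norm_num) (by norm_num)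
  have hm : 1 ≤ max 1 y := le_max_left _ _
  have hzy : z ≤ 2 * max 1 y := by
    rw [hz, Real.logb, div_le_iff₀ h3]
    have h5 : Real.log (Real.logb 2 n) = y * Real.log 2 := by
      rw [hy]
      exact (div_mul_cancel₀ _ h2.ne').symm
    rw [h5]
    calc y * Real.log 2 ≤ max 1 y * Real.log 2 :=
          mul_le_mul_of_nonneg_right (le_max_right _ _) h2.le
      _ ≤ max 1 y * (2 * Real.log (3 / 2)) := mul_le_mul_of_nonneg_left h4 (by linarith)
      _ = _ := by ring
  have h6 : (⌈z⌉₊ : ℝ) ≤ 2 * max 1 y + 1 := by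
    rcases le_total z 0 with h | h
    · rw [Nat.ceil_eq_zero.2 h]
      push_cast
      linarith
    · have := Nat.ceil_lt_add_one h
      linarith
  rw [iterations]
  push_cast
  linarith

namespace MPC

/-- The degree of the aggregation tree; its square is the number of array cells per machine. -/
noncomputable def branching (n : ℕ) (δ : ℝ) : ℕ := max 2 ⌊(n : ℝ) ^ (δ / 2)⌋₊

/-- The depth of the aggregation tree. -/
noncomputable def depth (δ : ℝ) : ℕ := 6 * ⌈2 / δ⌉₊ + 5

variable {n : ℕ} {δ : ℝ}

theorem branching_sq_le (hn : 0 < n) (hδ : 0 < δ) :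
    ((branching n δ * branching n δ : ℕ) : ℝ) ≤ 4 * (n : ℝ) ^ δ := by
  have hn1 : (1 : ℝ) ≤ n := by exact_mod_cast hn
  have h1 : (1 : ℝ) ≤ (n : ℝ) ^ (δ / 2) := Real.one_le_rpow hn1 (by positivity)
  have h2 : (branching n δ : ℝ) ≤ 2 * (n : ℝ) ^ (δ / 2) := by
    rw [branching, Nat.cast_max]
    refine max_le (by push_cast; linarith) ?_
    have := Nat.floor_le (a := (n : ℝ) ^ (δ / 2)) (by positivity)
    linarith
  have h3 : (n : ℝ) ^ δ = (n : ℝ) ^ (δ / 2) * (n : ℝ) ^ (δ / 2) := by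
    rw [← Real.rpow_add (by linarith), add_halves]
  rw [h3]
  push_cast
  have h0 : (0 : ℝ) ≤ branching n δ := Nat.cast_nonneg _
  nlinarith

/-- In spite of the rounding, `f² ≥ n^(δ/2)`: from `f ≥ 2` follows `f² ≥ f + 1`, which exceeds
`n^(δ/2)`. -/
theorem le_branching_pow (hn : 0 < n) (hδ : 0 < δ) : n ≤ branching n δ ^ (2 * ⌈2 / δ⌉₊) := by
  have hn1 : (1 : ℝ) ≤ n := by exact_mod_cast hn
  have h1 : (n : ℝ) ^ (δ / 2) ≤ (branching n δ : ℝ) ^ 2 := by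
    have h2 : (2 : ℝ) ≤ branching n δ := by exact_mod_cast le_max_left _ _
    have h3 : (n : ℝ) ^ (δ / 2) < branching n δ + 1 := by
      refine (Nat.lt_floor_add_one _).trans_le ?_
      exact_mod_cast Nat.add_le_add_right (le_max_right _ _) 1
    nlinarith
  have h2 : (n : ℝ) ≤ ((n : ℝ) ^ (δ / 2)) ^ ⌈2 / δ⌉₊ := by
    rw [← Real.rpow_mul_natCast (by linarith)]
    refine le_trans (le_of_eq (Real.rpow_one _).symm) (Real.rpow_le_rpow_of_exponent_le hn1 ?_)
    have := Nat.le_ceil (2 / δ)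
    rw [div_le_iff₀ hδ] at this
    linarith
  have h3 : (n : ℝ) ≤ (branching n δ : ℝ) ^ (2 * ⌈2 / δ⌉₊) := by
    rw [pow_mul]
    exact h2.trans (pow_le_pow_left₀ (by positivity) h1 _)
  exact_mod_cast h3

/-- The depth consists of three times the exponent that reaches `n`, and of 5 more levels with `2^5
= 32` for the constants. It covers the number of machines, at most `18n³ + 1`, and the keys up to
`n²`. -/
theorem lt_branching_pow_depth (hn : 0 < n) (hδ : 0 < δ) : 18 * n ^ 3 + 1 < branching n δ ^ depth δ := by
  have h1 := le_branching_pow hn hδ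
  have h2 : 2 ≤ branching n δ := le_max_left _ _
  have h3 : 2 ^ 5 ≤ branching n δ ^ 5 := Nat.pow_le_pow_left h2 5
  have h4 : n ^ 3 ≤ branching n δ ^ (6 * ⌈2 / δ⌉₊) := by
    calc n ^ 3 ≤ (branching n δ ^ (2 * ⌈2 / δ⌉₊)) ^ 3 := Nat.pow_le_pow_left h1 3
      _ = _ := by rw [← pow_mul]; congr 1; ring
  have h5 : 1 ≤ n ^ 3 := Nat.one_le_pow _ _ hn
  rw [depth, pow_add]
  calc 18 * n ^ 3 + 1 < n ^ 3 * 2 ^ 5 := by omega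
    _ ≤ _ := Nat.mul_le_mul h4 h3

/-- The factor 1800 is `100 · 18`: a memory of `100 * b` words, where `b ≤ 18n³` cells, must be
addressable by words. -/
theorem lt_wordBound {C : ℕ} (hC : 10 ≤ C) (n : ℕ) : 1800 * n ^ 3 < (n + 2) ^ C := by
  calc 1800 * n ^ 3 < (n + 2) ^ 10 := ?_
    _ ≤ (n + 2) ^ C := Nat.pow_le_pow_right (by omega) hC
  rcases Nat.eq_zero_or_pos n with rfl | hn
  · norm_num
  have h1 : 3 ^ 7 ≤ (n + 2) ^ 7 := Nat.pow_le_pow_left (by omega) 7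
  have h2 : n ^ 3 ≤ (n + 2) ^ 3 := Nat.pow_le_pow_left (by omega) 3
  have h3 : 1 ≤ n ^ 3 := Nat.one_le_pow _ _ hn
  calc 1800 * n ^ 3 < 3 ^ 7 * n ^ 3 := by omega
    _ ≤ (n + 2) ^ 7 * (n + 2) ^ 3 := Nat.mul_le_mul h1 h2
    _ = _ := by rw [← pow_add]

theorem card_edgeFinset_le_sq (G : SimpleGraph (Fin n)) [DecidableRel G.Adj] :
    G.edgeFinset.card ≤ n * n := by
  have h1 := sum_deg_univ G
  have h2 : ∑ v, deg G Finset.univ v ≤ ∑ _v : Fin n, n := Finset.sum_le_sum fun v _ => deg_le G _ v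
  simp only [Finset.sum_const, Finset.card_univ, Fintype.card_fin, smul_eq_mul] at h2
  omega

theorem card_edgeFinset_eq_zero {G : SimpleGraph (Fin n)} [DecidableRel G.Adj]
    (h : arboricity G ≤ 0) : G.edgeFinset.card = 0 := by
  have h1 := sum_deg_univ G
  have h2 := sum_deg_le G h Finset.univ
  simp only [mul_zero, zero_mul] at h2
  omega

end MPC

/-! ### Assembly of the bounds -/

theorem mainTheorem3 :
    ∃ C : ℕ, ∀ δ : ℝ, 0 < δ → ∃ K : ℝ, ∀ n m α : ℕ, 0 < n →
      ∃ (M S : ℕ) (P : MPCProgram M) (r : ℕ → ℕ),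
        0 < M ∧
        -- space per machine, total space, number of rounds
        (S : ℝ) ≤ C * (n : ℝ) ^ δ ∧
        M * S ≤ C * max 1 (m * α) ∧
        r 0 = 0 ∧ Monotone r ∧
        (r (CountTriangles.iterations n) : ℝ) ≤ K * max 1 (Real.logb 2 (Real.logb 2 n)) ∧
        ∀ (G : SimpleGraph (Fin n)) [DecidableRel G.Adj],
          G.edgeFinset.card = m → arboricity G ≤ α →
          -- the procedure returns the exact number of triangles
          CountTriangles.output G α = ((G.cliqueFinset 3).card : ℚ) ∧
          -- the program, on every evenly distributed input, executes the procedure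
          ∀ es : Fin M → List (Fin n × Fin n),
            ListsEdges G Finset.univ es → (∀ j, (es j).length ≤ m ⌈/⌉ M) →
            P.RespectsSpace (graphMemory es 0) (r (CountTriangles.iterations n)) S ((n + 2) ^ C) ∧
            (∀ i ≤ CountTriangles.iterations n,
              ∃ (es' : Fin M → List (Fin n × Fin n)) (T : ℕ),
                ListsEdges G (CountTriangles.remaining G α i) es' ∧
                (T : ℚ) = CountTriangles.counter G α i ∧
                P.run (graphMemory es 0) (r i) = graphMemory es' T) ∧
            ∀ j : Fin M, P.run (graphMemory es 0) (r (CountTriangles.iterations n)) j =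
              [if (j : ℕ) = 0 then (G.cliqueFinset 3).card else 0] := by
  classical
  -- The largest demand is that of the total space: at most `100(N + b) ≤ 200N ≤ 3600mα` words. The
  -- space per machine needs `100b ≤ 400n^δ`, and words need an exponent of at least 10.
  obtain ⟨C, hC⟩ : ∃ C : ℕ, C = 4000 := ⟨_, rfl⟩
  have hC' : (C : ℝ) = 4000 := by rw [hC]; norm_num
  refine ⟨C, fun δ hδ => ⟨(MPC.countRounds (MPC.depth δ) + 2 : ℕ) * 4, fun n m α hn => ?_⟩⟩
  have hn1 : (1 : ℝ) ≤ n := by exact_mod_cast hn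
  have hnδ : (1 : ℝ) ≤ (n : ℝ) ^ δ := Real.one_le_rpow hn1 hδ.le
  have hm1 : 1 ≤ max 1 (m * α) := le_max_left _ _
  have hrounds : ∀ ℓ ≤ MPC.countRounds (MPC.depth δ) + 2, ((ℓ * iterations n : ℕ) : ℝ) ≤
      (MPC.countRounds (MPC.depth δ) + 2 : ℕ) * 4 * max 1 (Real.logb 2 (Real.logb 2 n)) := by
    intro ℓ hℓ
    rw [Nat.cast_mul, mul_assoc]
    exact mul_le_mul (by exact_mod_cast hℓ) (iterations_le n) (by positivity) (by positivity)
  have hmono : ∀ ℓ : ℕ, Monotone fun i => ℓ * i := fun ℓ i j h => Nat.mul_le_mul_left ℓ h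
  have hout : ∀ (G : SimpleGraph (Fin n)) [DecidableRel G.Adj], arboricity G ≤ α →
      output G α = ((G.cliqueFinset 3).card : ℚ) := by
    intro G _ hα
    rw [output, counter_eq_found, found_iterations G hα]
  by_cases hin : ∃ (G : SimpleGraph (Fin n)) (_ : DecidableRel G.Adj),
      G.edgeFinset.card = m ∧ arboricity G ≤ α
  swap
  -- Without an admissible graph `m` need not be bounded in terms of `n`, and any program will do.
  · refine ⟨1, 1, ⟨fun _ _ x => (x, fun _ => [])⟩, fun i => 0 * i, one_pos, ?_, ?_, rfl,
      hmono 0, hrounds 0 (Nat.zero_le _), fun G inst h1 h2 => absurd ⟨G, inst, h1, h2⟩ hin⟩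
    · rw [hC']; push_cast; linarith
    · rw [hC]; omega
  obtain ⟨G₀, _, hcard, harb⟩ := hin
  have hmn : m ≤ n * n := hcard ▸ MPC.card_edgeFinset_le_sq G₀
  -- If `α = 0`, there are no edges; otherwise the factor is at least 1.
  have hmα : m ≤ m * min α n := by
    rcases Nat.eq_zero_or_pos α with rfl | h0
    · have := MPC.card_edgeFinset_eq_zero harb
      omega
    · exact Nat.le_mul_of_pos_right m (by omega)
  set f := MPC.branching n δ with hf
  set b := f * f with hb
  -- The `2m` arcs and `8 · m · min α n` copies need at most `10 · m · min α n` cells; the rest is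
  -- slack.
  set N := 18 * (m * min α n) with hN
  have hf2 : 2 ≤ f := le_max_left _ _
  have hb4 : 4 ≤ b := Nat.mul_le_mul hf2 hf2
  have hbδ : (b : ℝ) ≤ 4 * (n : ℝ) ^ δ := MPC.branching_sq_le hn hδ
  have hW := MPC.lt_wordBound (C := C) (by omega) n
  have hN3 : N ≤ 18 * n ^ 3 := by
    have : m * min α n ≤ n * n * n := Nat.mul_le_mul hmn (min_le_right _ _)
    rw [hN, show n ^ 3 = n * n * n by ring]
    omega
  have hNα : N ≤ 18 * (m * α) := by
    have : m * min α n ≤ m * α := Nat.mul_le_mul_left m (min_le_left _ _)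
    omega
  have hn3 : 1 ≤ n ^ 3 := Nat.one_le_pow _ _ hn
  have hnn3 : n * n ≤ n ^ 3 := by
    rw [show n ^ 3 = n * n * n by ring]; exact Nat.le_mul_of_pos_right _ hn
  have hnn : n ≤ n * n := Nat.le_mul_self n
  -- If the array is smaller than the block of one machine, `b` cells could violate the total space
  -- bound `O(max{1, mα})`. A single machine with `2m + 3` words is used then. Otherwise `b ≤ N`,
  -- and rounding the number of machines up at most doubles the space.
  rcases Nat.lt_or_ge N b with hlt | hge
  · have hc : m ⌈/⌉ 1 = m := by simp
    obtain ⟨P, hP⟩ := MPC.Input.exists_program (n := n) (m := m) (α := α) (M := 1)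
      (S := 2 * m + 3) (W := (n + 2) ^ C) (ℓ := 1)
      (fun i _ => MPC.Input.reach_config_single (by rw [hc]; omega) (by omega) (by omega) i)
      (by rw [hc]; omega) (by omega) (by omega)
    refine ⟨1, 2 * m + 3, P, fun i => 1 * i, one_pos, ?_, ?_, rfl, hmono 1,
      hrounds 1 (by omega), fun G _ h1 h2 => ⟨hout G h2, hP G h1 h2⟩⟩
    · have : 2 * m + 3 ≤ 3 * b := by omega
      have : ((2 * m + 3 : ℕ) : ℝ) ≤ 3 * b := by exact_mod_cast this
      rw [hC']
      linarith
    · rw [hC]; omega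
  · set M := N / b + 1 with hM
    have hb0 : 0 < b := by omega
    have hMb : N < M * b := by
      rw [mul_comm]; exact Nat.lt_mul_div_succ N hb0
    have hMf : M * (f * f) = M * b := rfl
    have hMb' : M * b ≤ N + b := by
      rw [hM, Nat.succ_mul]
      exact Nat.add_le_add_right (Nat.div_mul_le_self N b) b
    have hMN : M ≤ N + 1 := Nat.succ_le_succ (Nat.div_le_self N b)
    have hpow := MPC.lt_branching_pow_depth hn hδ
    rw [← hf] at hpow
    have hp : MPC.Params M f (MPC.depth δ) (100 * b) ((n + 2) ^ C) :=
      ⟨hf2, by omega, le_rfl, by omega, by omega⟩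
    -- As `18m ≤ N < M * b`, the average load is far below `b`; the factor 4 absorbs the rounding in
    -- `b / 2`.
    have hlen : 2 * (m ⌈/⌉ M) ≤ b := by
      have h1 : m ⌈/⌉ M ≤ b / 2 := by
        rw [ceilDiv_le_iff_le_mul (show 0 < M from Nat.succ_pos _)]
        have h2 : b ≤ 4 * (b / 2) := by omega
        have h3 : M * b ≤ M * (4 * (b / 2)) := Nat.mul_le_mul_left _ h2
        have h4 : M * (4 * (b / 2)) = 4 * (M * (b / 2)) := by ring
        omega
      omega
    obtain ⟨P, hP⟩ := MPC.Input.exists_program (n := n) (m := m) (α := α) (M := M)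
      (S := 100 * b) (W := (n + 2) ^ C) (ℓ := MPC.countRounds (MPC.depth δ) + 2)
      (fun i _ => MPC.Input.reach_config hp hlen (by omega) (by omega) (by omega) (by omega) i)
      (by omega) (by omega) (by omega)
    refine ⟨M, 100 * b, P, fun i => (MPC.countRounds (MPC.depth δ) + 2) * i, Nat.succ_pos _, ?_, ?_,
      rfl, hmono _, hrounds _ le_rfl, fun G _ h1 h2 => ⟨hout G h2, hP G h1 h2⟩⟩
    · rw [hC', Nat.cast_mul]
      push_cast at hbδ ⊢
      linarith
    · have : M * (100 * b) = 100 * (M * b) := by ring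
      rw [hC]; omega
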